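/- Let $I$ and $O$ be finite sets, $h:I\to O$ a surjective, non-constant function and $\Lambda=(\lambda_{ij})_{i,j\in I}$ a real matrix with $\lambda_{ij}\ge 0$ for $i\ne j$ and $\sum_j\lambda_{ij}=0$ for all $i$. Vectors in $\mathbb R^I$ are rows when multiplied by $\Lambda$ from the right, $1_{h^{-1}(a)}$ is the indicator column of $h^{-1}(a)$, and $f*v$ is the componentwise product. For $a\in O$ let $\Delta_a\subset\mathbb R^I$ be the set of probability vectors vanishing outside $h^{-1}(a)$, and let $\Delta_e=\bigcup_{a\in O}\Delta_a$ (a disjoint union), with its Borel $\sigma$-algebra. For each $a\in O$ fix an arbitrary $\nu_a\in\Delta_a$ and an arbitrary probability $q_a$ on $O$ with $q_a(a)=0$. For $v\in\mathbb R^I$ put $H_a[v]=\frac{1}{v1_{h^{-1}(a)}}\,1_{h^{-1}(a)}*v$ if $v1_{h^{-1}(a)}\neq0$ and $H_a[v]=\nu_a$ otherwise. Define a triple $(\phi,\lambda,Q)$ on $\Delta_e$ as follows, for $\nu\in\Delta_a$, $a\in O$. (1) $t\mapsto\phi(t,\nu)=\phi_a(t,\nu)$ is the solution on $[0,\infty)$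 of $y'=1_{h^{-1}(a)}*(y\Lambda)-(y\Lambda1_{h^{-1}(a)})\,y$, $y(0)=\nu$. (2) $\lambda(\nu)=-\nu\Lambda1_{h^{-1}(a)}$. (3) $Q(\nu,A)=\sum_{b\in O}1_A(H_b[\nu\Lambda])\,q(\nu,b)$ for Borel $A\subset\Delta_e$, where $q(\nu,b)=\frac{\nu\Lambda1_{h^{-1}(b)}}{-\nu\Lambda1_{h^{-1}(a)}}1_{b\ne a}$ if $\nu\Lambda1_{h^{-1}(a)}\neq0$, and $q(\nu,b)=q_a(b)$ otherwise. Let $\Omega$ be the set of cadlag functions $\omega:[0,\infty)\to I$, $X_t(\omega)=\omega(t)$, $\mathcal F^0=\sigma(X_s:s\ge0)$, $\mathcal F^0_t=\sigma(X_s:s\le t)$, $Y_t=h(X_t)$, and let $0=T_0<T_1<T_2<\cdots$ be the jump times of $Y$ (equal to $\infty$ after the last jump). For $\nu\in\Delta_e$ let $P_\nu$ be the probability on $(\Omega,\mathcal F^0)$ with $P_\nu(X_0=i)=\nu(i)$ and $E_\nu[f(X_{t+s})\mid\mathcal F^0_t]=(e^{s\Lambda}f)(X_t)$ $P_\nu$-a.s.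 for all $s,t\ge0$ and $f:I\to\mathbb R$. The filtering process $\Pi^\nu$ is defined for every $\omega\in\Omega$ by $\Pi^\nu_0=H_{Y_0}[\nu]$, $\Pi^\nu_t=\phi_{Y_{T_n}}(t-T_n,\Pi^\nu_{T_n})$ for $T_n\le t<T_{n+1}$, and $\Pi^\nu_{T_{n+1}}=H_{Y_{T_{n+1}}}[\Pi^\nu_{T_{n+1}-}\Lambda]$ with $\Pi^\nu_{T_{n+1}-}=\phi_{Y_{T_n}}(T_{n+1}-T_n,\Pi^\nu_{T_n})$ if $T_{n+1}<\infty$. Theorem. The equation in (1) has exactly one solution on $[0,\infty)$, and it stays in $\Delta_a$. The triple $(\phi,\lambda,Q)$ is admissible: $\phi:[0,\infty)\times\Delta_e\to\Delta_e$ is continuous, $\phi(0,x)=x$, $\phi(t,\phi(s,x))=\phi(t+s,x)$, and $\phi$ leaves every $\Delta_a$ invariant; $\lambda$ is nonnegative and measurable, and for every $x$ the function $s\mapsto\lambda(\phi(s,x))$ is integrable on $(0,\epsilon]$ for some $\epsilon>0$; $Q$ is a stochastic kernel with $Q(x,\{x\})=0$ for every $x$. For every $\nu\in\Delta_e$, the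 process $Z=\Pi^\nu$ takes values in $\Delta_e$ and, under $P=P_\nu$, is a piecewise-deterministic Markov process with respect to $(\phi,\lambda,Q)$ with starting point $\nu$. That is, there are random times $0=\tau_0\le\tau_1\le\tau_2\le\cdots\le\infty$ such that: (i) $P$-a.s., $Z_0=\nu$, and the trajectories of $Z$ are cadlag with discontinuities precisely at the finite $\tau_n$, $n\ge1$; (ii) $P$-a.s., $Z_t=\phi(t-\tau_{n},Z_{\tau_{n}})$ for $\tau_{n}\le t<\tau_{n+1}$, $n\ge0$; (iii) for $n\ge0$, with $\mathcal G_{n}=\sigma(\tau_1,Z_{\tau_1},\dots,\tau_{n},Z_{\tau_{n}})$ ($\mathcal G_0$ trivial; $Z_{\tau_k}$ is only considered on $\{\tau_k<\infty\}$), for all $t\ge0$ and all Borel $A\subset\Delta_e$, $P$-a.s., $$P(\tau_{n+1}-\tau_{n}>t\mid\mathcal G_{n})=\exp\Big(-\int_0^t\lambda(\phi(s,Z_{\tau_{n}}))\,ds\Big)\quad\text{on }\{\tau_{n}<\infty\},$$ $$P(Z_{\tau_{n+1}}\in A\mid\mathcal G_{n}\vee\sigma(\tau_{n+1}))=Q\big(\phi(\tau_{n+1}-\tau_{n},Z_{\tau_{n}}),A\big)\quad\text{on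 }\{\tau_{n+1}<\infty\}.$$ -/

import Mathlib

open MeasureTheory Set Filter Topology
open scoped NNReal ENNReal Matrix

noncomputable section

namespace FilterPDP

/-! ### General notions: paths, jump times, piecewise-deterministic processes -/

/-- Right-continuous paths on `[0, ∞)` with left limits on `(0, ∞)`. -/
def IsCadlag {E : Type*} [TopologicalSpace E] (f : ℝ≥0 → E) : Prop :=
  (∀ t, ContinuousWithinAt f (Ici t) t) ∧ ∀ t, 0 < t → ∃ l, Tendsto f (𝓝[<] t) (𝓝 l)

/-- The canonical space of cadlag functions. Its `σ`-algebra is the one that a subtype of a product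
inherits: it is generated by the coordinate maps. -/
abbrev CadlagPath (I : Type*) [TopologicalSpace I] : Type _ := {ω : ℝ≥0 → I // IsCadlag ω}

/-- The natural filtration `σ(X_s : s ∈ [0, t])` of a process. -/
abbrev naturalSigma {Ω E : Type*} [MeasurableSpace E] (X : ℝ≥0 → Ω → E) (t : ℝ≥0) :
    MeasurableSpace Ω :=
  ⨆ s ∈ Iic t, MeasurableSpace.comap (X s) inferInstance

/-- The jump times of a right-continuous, piecewise constant path, with `jumpTime y 0 = 0`:
the next jump time is the first exit time from the current value, and `∞` if there is none. -/
def jumpTime {α : Type*} (y : ℝ≥0 → α) : ℕ → ℝ≥0∞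
  | 0 => 0
  | n + 1 => sInf ((fun t : ℝ≥0 => (t : ℝ≥0∞)) ''
      {t : ℝ≥0 | jumpTime y n < t ∧ y t ≠ y (jumpTime y n).toNNReal})

/-- The number of jumps in `(0, t]`, i.e. the `n` with `jumpTime y n ≤ t < jumpTime y (n + 1)`. -/
def jumpCount {α : Type*} (y : ℝ≥0 → α) (t : ℝ≥0) : ℕ := sSup {n | jumpTime y n ≤ t}

/-- The random variable `Z_τ` on `{τ < ∞}`, extended by the constant `z₀` to `{τ = ∞}`. -/
def atTime {Ω E : Type*} (Z : ℝ≥0 → Ω → E) (z₀ : E) (τ : Ω → ℝ≥0∞) (ω : Ω) : E :=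
  open Classical in if τ ω = ⊤ then z₀ else Z (τ ω).toNNReal ω

/-- `σ(T₁, Z_{T₁}, …, T_n, Z_{T_n})` (the trivial `σ`-algebra for `n = 0`). -/
abbrev jumpSigma {Ω E : Type*} [MeasurableSpace E] (Z : ℝ≥0 → Ω → E) (z₀ : E) (T : ℕ → Ω → ℝ≥0∞)
    (n : ℕ) : MeasurableSpace Ω :=
  ⨆ k ∈ Finset.Icc 1 n, MeasurableSpace.comap (T k) inferInstance ⊔
    MeasurableSpace.comap (atTime Z z₀ (T k)) inferInstance

/-- `T` (with `T 0 = 0`) is a sequence of jump times that exhibits `Z` as a piecewise-deterministic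
process with flow `φ`, jump rate `rate`, transition measure `Q` and starting point `z₀`.
The sojourn times are `S_{n+1} = T_{n+1} - T_n`, so that `{S_{n+1} > t, T_n < ∞}` is the event
`{T_n + t < T_{n+1}}`. -/
structure IsPDPWith {Ω E : Type*} [MeasurableSpace Ω] [TopologicalSpace E] [MeasurableSpace E]
    (P : Measure Ω) (Z : ℝ≥0 → Ω → E) (φ : ℝ≥0 → E → E) (rate : E → ℝ) (Q : E → Measure E)
    (z₀ : E) (T : ℕ → Ω → ℝ≥0∞) : Prop where
  measurable_process : ∀ t, Measurable (Z t)
  measurable_time : ∀ n, Measurable (T n)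
  measurable_post : ∀ n, Measurable (atTime Z z₀ (T n))
  time_zero : ∀ ω, T 0 ω = 0
  time_mono : ∀ ω, Monotone fun n => T n ω
  start : ∀ᵐ ω ∂P, Z 0 ω = z₀
  cadlag : ∀ᵐ ω ∂P, IsCadlag fun t => Z t ω
  discontinuity : ∀ᵐ ω ∂P, ∀ t : ℝ≥0,
    ¬ ContinuousAt (fun s => Z s ω) t ↔ ∃ n, 1 ≤ n ∧ T n ω = t
  deterministic : ∀ᵐ ω ∂P, ∀ (n : ℕ) (t : ℝ≥0), T n ω ≤ t → (t : ℝ≥0∞) < T (n + 1) ω →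
    Z t ω = φ (t - (T n ω).toNNReal) (Z (T n ω).toNNReal ω)
  sojourn : ∀ (n : ℕ) (t : ℝ≥0),
    P[{ω | T n ω + t < T (n + 1) ω}.indicator (fun _ => (1 : ℝ)) | jumpSigma Z z₀ T n] =ᵐ[P]
      {ω | T n ω < ⊤}.indicator fun ω =>
        Real.exp (-∫ s in (0 : ℝ)..t, rate (φ s.toNNReal (Z (T n ω).toNNReal ω)))
  jump : ∀ (n : ℕ) (A : Set E), MeasurableSet A →
    P[{ω | T (n + 1) ω < ⊤ ∧ Z (T (n + 1) ω).toNNReal ω ∈ A}.indicator (fun _ => (1 : ℝ)) |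
        jumpSigma Z z₀ T n ⊔ MeasurableSpace.comap (T (n + 1)) inferInstance] =ᵐ[P]
      {ω | T (n + 1) ω < ⊤}.indicator fun ω =>
        (Q (φ ((T (n + 1) ω).toNNReal - (T n ω).toNNReal) (Z (T n ω).toNNReal ω))).real A

/-- `Z` is, under `P`, a piecewise-deterministic process with respect to `(φ, rate, Q)`,
starting at `z₀`. -/
def IsPDP {Ω E : Type*} [MeasurableSpace Ω] [TopologicalSpace E] [MeasurableSpace E]
    (P : Measure Ω) (Z : ℝ≥0 → Ω → E) (φ : ℝ≥0 → E → E) (rate : E → ℝ) (Q : E → Measure E)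
    (z₀ : E) : Prop :=
  ∃ T : ℕ → Ω → ℝ≥0∞, IsPDPWith P Z φ rate Q z₀ T

/-! ### The Markov chain -/

section Chain

variable {I : Type*} [Fintype I]

/-- Rate transition matrices (`Q`-matrices). -/
def IsRateMatrix (Λ : Matrix I I ℝ) : Prop :=
  (∀ i j, i ≠ j → 0 ≤ Λ i j) ∧ ∀ i, ∑ j, Λ i j = 0

/-- `P` makes the coordinate process a Markov process with generator `Λ` and initial
distribution `μ`. -/
structure IsMarkovLaw [DecidableEq I] [TopologicalSpace I] [MeasurableSpace I]
    (P : Measure (CadlagPath I)) (Λ : Matrix I I ℝ) (μ : I → ℝ) : Prop where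
  initial : ∀ i, P.real {ω | ω.1 0 = i} = μ i
  markov : ∀ (t s : ℝ≥0) (f : I → ℝ),
    P[fun ω : CadlagPath I => f (ω.1 (t + s)) |
        naturalSigma (fun (r : ℝ≥0) (ω : CadlagPath I) => ω.1 r) t] =ᵐ[P]
      fun ω => (NormedSpace.exp ((s : ℝ) • Λ) *ᵥ f) (ω.1 t)

end Chain

/-! ### The effective simplex, the flow and the operator `H` -/

section Simplex

variable {I O : Type*} [Fintype I]

/-- `Δ_a`: probability vectors supported in `h⁻¹(a)`. -/
def face (h : I → O) (a : O) : Set (I → ℝ) :=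
  {μ | μ ∈ stdSimplex ℝ I ∧ ∀ i, h i ≠ a → μ i = 0}

/-- The effective simplex `Δ_e`, with the topology and Borel `σ`-algebra inherited from `ℝ^I`. -/
def effSimplex (h : I → O) : Set (I → ℝ) := ⋃ a, face h a

/-- The (unique) `a` such that `x ∈ Δ_a`. -/
def level {h : I → O} (x : effSimplex h) : O := Classical.choose (mem_iUnion.1 x.2)

theorem mem_face_level {h : I → O} (x : effSimplex h) : (x : I → ℝ) ∈ face h (level x) :=
  Classical.choose_spec (mem_iUnion.1 x.2)

variable [DecidableEq O]

/-- `v 1_{h⁻¹(a)}`, the total mass that the row vector `v` gives to `h⁻¹(a)`. -/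
def levelMass (h : I → O) (a : O) (v : I → ℝ) : ℝ := ∑ i, if h i = a then v i else 0

/-- The vector field `F_a(y) = 1_{h⁻¹(a)} * (yΛ) - (yΛ1_{h⁻¹(a)}) y`. -/
def vectorField (Λ : Matrix I I ℝ) (h : I → O) (a : O) (y : I → ℝ) : I → ℝ := fun i =>
  (if h i = a then (y ᵥ* Λ) i else 0) - levelMass h a (y ᵥ* Λ) * y i

/-- `y` solves `y' = F_a(y)` on `[0, ∞)` with `y(0) = x`. -/
def IsFlowCurve (Λ : Matrix I I ℝ) (h : I → O) (a : O) (x : I → ℝ) (y : ℝ → I → ℝ) : Prop :=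
  y 0 = x ∧ ∀ t, 0 ≤ t → HasDerivWithinAt y (vectorField Λ h a (y t)) (Ici 0) t

open Classical in
/-- `φ_a(·, x)`: the global solution of the differential equation with field `F_a` that starts
at `x`, if there is one (in particular if `x ∈ Δ_a`). -/
def flowCurve (Λ : Matrix I I ℝ) (h : I → O) (a : O) (x : I → ℝ) : ℝ → I → ℝ :=
  if hy : ∃ y, IsFlowCurve Λ h a x y then hy.choose else fun _ => x

open Classical in
/-- The global flow on `Δ_e`: `φ(t, x) = φ_a(t, x)` if `x ∈ Δ_a`. -/
def flow (Λ : Matrix I I ℝ) (h : I → O) (t : ℝ≥0) (x : effSimplex h) : effSimplex h :=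
  if hm : flowCurve Λ h (level x) x t ∈ effSimplex h then ⟨flowCurve Λ h (level x) x t, hm⟩ else x

/-- The operator `H_a`, with `νfix a` the probability used when the denominator vanishes. -/
def opH (h : I → O) (νfix : O → I → ℝ) (a : O) (v : I → ℝ) : I → ℝ :=
  if levelMass h a v = 0 then νfix a else fun i => if h i = a then v i / levelMass h a v else 0

/-- The jump rate `-νΛ1_{h⁻¹(a)}` for `ν ∈ Δ_a`. -/
def jumpRate (Λ : Matrix I I ℝ) (h : I → O) (x : effSimplex h) : ℝ :=
  -levelMass h (level x) ((x : I → ℝ) ᵥ* Λ)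

/-- The probability `q(ν, ·)` on `O`; `qfix a` is used for `ν ∈ Δ_a` with jump rate zero. -/
def jumpProb (Λ : Matrix I I ℝ) (h : I → O) (qfix : O → O → ℝ) (x : effSimplex h) (b : O) : ℝ :=
  if levelMass h (level x) ((x : I → ℝ) ᵥ* Λ) = 0 then qfix (level x) b
  else if b = level x then 0
  else levelMass h b ((x : I → ℝ) ᵥ* Λ) / -levelMass h (level x) ((x : I → ℝ) ᵥ* Λ)

/-- `Q(ν, A) = ∑_b 1_A(H_b[νΛ]) q(ν, b)`, as a measure on `Δ_e`. -/
def transMeasure [Fintype O] (Λ : Matrix I I ℝ) (h : I → O) (νfix : O → I → ℝ)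
    (qfix : O → O → ℝ) (x : effSimplex h) : Measure (effSimplex h) :=
  (∑ b, ENNReal.ofReal (jumpProb Λ h qfix x b) •
    Measure.dirac (opH h νfix b ((x : I → ℝ) ᵥ* Λ))).comap Subtype.val

/-- `(φ, rate, Q)` is an admissible triple on `Δ_e`: a flow that leaves every `Δ_a` invariant,
a jump rate function and a transition measure. -/
structure IsPDPTriple (h : I → O) (φ : ℝ≥0 → effSimplex h → effSimplex h)
    (rate : effSimplex h → ℝ) (Q : effSimplex h → Measure (effSimplex h)) : Prop where
  flow_continuous : Continuous fun p : ℝ≥0 × effSimplex h => φ p.1 p.2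
  flow_zero : ∀ x, φ 0 x = x
  flow_add : ∀ t s x, φ t (φ s x) = φ (t + s) x
  flow_invariant : ∀ a t (x : effSimplex h), (x : I → ℝ) ∈ face h a → (φ t x : I → ℝ) ∈ face h a
  rate_nonneg : ∀ x, 0 ≤ rate x
  rate_measurable : Measurable rate
  rate_integrable : ∀ x, ∃ ε : ℝ, 0 < ε ∧
    IntegrableOn (fun s : ℝ => rate (φ s.toNNReal x)) (Ioc 0 ε)
  trans_measurable : Measurable Q
  trans_prob : ∀ x, IsProbabilityMeasure (Q x)
  trans_self : ∀ x, Q x {x} = 0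

/-! ### The filtering process -/

/-- `Π_{T_n}` along the observation path `y`: `Π_0 = H_{y(0)}[μ]` and
`Π_{T_{n+1}} = H_{y(T_{n+1})}[Π_{T_{n+1}-} Λ]`, where
`Π_{T_{n+1}-} = φ_{y(T_n)}(T_{n+1} - T_n, Π_{T_n})` (meaningful if the jump time is finite). -/
def filterAtJump (Λ : Matrix I I ℝ) (h : I → O) (νfix : O → I → ℝ) (μ : I → ℝ)
    (y : ℝ≥0 → O) : ℕ → I → ℝ
  | 0 => opH h νfix (y 0) μ
  | n + 1 => opH h νfix (y (jumpTime y (n + 1)).toNNReal)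
      (flowCurve Λ h (y (jumpTime y n).toNNReal) (filterAtJump Λ h νfix μ y n)
        ((jumpTime y (n + 1)).toNNReal - (jumpTime y n).toNNReal : ℝ≥0) ᵥ* Λ)

/-- `Π_t = φ_{y(T_n)}(t - T_n, Π_{T_n})` for `T_n ≤ t < T_{n+1}`. -/
def filterPath (Λ : Matrix I I ℝ) (h : I → O) (νfix : O → I → ℝ) (μ : I → ℝ)
    (y : ℝ≥0 → O) (t : ℝ≥0) : I → ℝ :=
  flowCurve Λ h (y (jumpTime y (jumpCount y t)).toNNReal)
    (filterAtJump Λ h νfix μ y (jumpCount y t))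
    (t - (jumpTime y (jumpCount y t)).toNNReal : ℝ≥0)

/-- The filtering process `Π^μ` on the canonical space, driven by the observation
`Y_t = h(X_t)`. -/
def filterProcess [TopologicalSpace I] (Λ : Matrix I I ℝ) (h : I → O) (νfix : O → I → ℝ)
    (μ : I → ℝ) (t : ℝ≥0) (ω : CadlagPath I) : I → ℝ :=
  filterPath Λ h νfix μ (fun s => h (ω.1 s)) t

end Simplex

end FilterPDP

end

open FilterPDP

/-!
The process `Z = Π^ν` is rebuilt from the observation `Y = h(X)` alone, so everything is reduced to
the conditional laws of the sequence of jump times of `Y` and of the signal `X` at these times.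

The differential equation is a normalised linear one. With `K` the generator `Λ` killed outside
`h⁻¹(a)`, the vector `unnorm = x exp(tK)` is nonnegative with positive mass, and its normalisation
`normFlow` solves `y' = F_a(y)`; uniqueness holds because `F_a` is smooth. The mass of `unnorm` is
`exp(-∫ λ(φ(s, x)) ds)` (`exp_neg_integral_jumpRate`). Both `unnorm` and its mass are linear
in `x`.

For the chain, the process `f(X_t) - ∫ (Λf)(X_s) ds` is a martingale, and a grid approximation of
the jump times from the right gives Dynkin's formula between two jumps of `Y` for the events of the
past of the first one (`IsMarkovStep.dynkin`). Applied to indicators, it says that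
`P(A, T_n + t < T_{n+1}, X_{T_n + t} = i)`, as a function of `t`, solves the linear equation of the
killed generator, whence `survivalLaw_eq_unnorm`, and that the joint law of `T_{n+1} - T_n` and
`X_{T_{n+1}}` has the density `(unnorm Λ)_j` (`measureReal_next_jump`).

If `Z_{T_n}` is the conditional law of `X_{T_n}` given the observed jumps (`IsCondLaw`), then by
linearity these formulas hold conditionally, with `x = Z_{T_n}`. This gives the law of the sojourn
time (`measure_sojourn`) and, disintegrating the density with respect to the jump time, the law of
`X_{T_{n+1}}` given the past and `T_{n+1}`: it is `νΛ` restricted to the complement of the level set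
and normalised, where `ν = Z_{T_{n+1}-}` (`measure_next_signal`). Conditioning this law on the value
of `Y_{T_{n+1}}` is the operator `H`, so the property passes on to `n + 1` (`IsCondLaw.succ`), and
its image under `j ↦ H_{h(j)}[νΛ]` is `Q(ν, ·)` (`measure_postState_succ`). The `σ`-algebra
generated by the jumps of `Z` is contained in the one generated by the jumps of `Y`, and the
conditional probabilities found are measurable with respect to the smaller one.
-/

noncomputable section

set_option linter.unusedSectionVars false

namespace FilterPDP

/-! ### Differential equations and the exponential of a matrix -/

/-- Two solutions on `[0, ∞)` of an autonomous equation with `C¹` field that start at the same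
point agree: the field is Lipschitz on a ball that contains both trajectories up to time `t`. -/
theorem ode_unique_of_contDiff {E : Type*} [NormedAddCommGroup E] [NormedSpace ℝ E] [ProperSpace E]
    {v : E → E} (hv : ContDiff ℝ 1 v) {f g : ℝ → E}
    (hf : ∀ t, 0 ≤ t → HasDerivWithinAt f (v (f t)) (Ici 0) t)
    (hg : ∀ t, 0 ≤ t → HasDerivWithinAt g (v (g t)) (Ici 0) t)
    (h0 : f 0 = g 0) {t : ℝ} (ht : 0 ≤ t) : f t = g t := by
  have key : ∀ {f : ℝ → E}, (∀ t, 0 ≤ t → HasDerivWithinAt f (v (f t)) (Ici 0) t) →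
      ContinuousOn f (Icc 0 t) := fun hf s hs =>
    ((hf s hs.1).continuousWithinAt).mono Icc_subset_Ici_self
  have hc := (isCompact_Icc.image_of_continuousOn (key hf)).union
    (isCompact_Icc.image_of_continuousOn (key hg))
  obtain ⟨R, hR⟩ := hc.isBounded.subset_closedBall (0 : E)
  obtain ⟨K, hK⟩ := (hv.contDiffOn (s := Metric.closedBall (0 : E) R)).exists_lipschitzOnWith
    one_ne_zero (convex_closedBall 0 R) (isCompact_closedBall 0 R)
  refine ODE_solution_unique_of_mem_Icc_right (v := fun _ => v) (K := K)
    (s := fun _ => Metric.closedBall (0 : E) R) (fun _ _ => hK)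
    (key hf) (fun s hs => (hf s hs.1).mono (Ici_subset_Ici.2 hs.1)) (fun s hs => hR (Or.inl ?_))
    (key hg) (fun s hs => (hg s hs.1).mono (Ici_subset_Ici.2 hs.1)) (fun s hs => hR (Or.inr ?_)) h0
    (right_mem_Icc.2 ht)
  · exact mem_image_of_mem _ (Ico_subset_Icc_self hs)
  · exact mem_image_of_mem _ (Ico_subset_Icc_self hs)

section MatrixExp

variable {I : Type*} [Fintype I] [DecidableEq I]

open NormedSpace

attribute [local instance] Matrix.linftyOpNormedRing Matrix.linftyOpNormedAlgebra

theorem hasDerivAt_matrixExp (B : Matrix I I ℝ) (t : ℝ) :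
    HasDerivAt (fun u : ℝ => exp (u • B)) (exp (t • B) * B) t :=
  hasDerivAt_exp_smul_const B t

theorem continuous_matrixExp (B : Matrix I I ℝ) : Continuous fun u : ℝ => exp (u • B) :=
  continuous_iff_continuousAt.2 fun t => (hasDerivAt_matrixExp B t).continuousAt

theorem hasDerivAt_vecMul_exp (B : Matrix I I ℝ) (x : I → ℝ) (t : ℝ) :
    HasDerivAt (fun u : ℝ => x ᵥ* exp (u • B)) ((x ᵥ* exp (t • B)) ᵥ* B) t := by
  let l : Matrix I I ℝ →ₗ[ℝ] (I → ℝ) :=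
    { toFun := fun M => x ᵥ* M
      map_add' := fun M N => Matrix.vecMul_add M N x
      map_smul' := fun c M => Matrix.vecMul_smul x c M }
  have hl := (LinearMap.toContinuousLinearMap l).hasFDerivAt.comp_hasDerivAt t
    (hasDerivAt_matrixExp B t)
  rw [Matrix.vecMul_vecMul]
  exact hl

theorem exp_add_smul (B : Matrix I I ℝ) (s t : ℝ) :
    exp ((s + t) • B) = exp (s • B) * exp (t • B) := by
  rw [add_smul, Matrix.exp_add_of_commute]
  exact ((Commute.refl B).smul_left s).smul_right t

/-- The exponential of an entrywise nonnegative matrix dominates the identity entrywise. -/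
theorem one_le_exp_of_nonneg {M : Matrix I I ℝ} (hM : ∀ i j, 0 ≤ M i j) (i j : I) :
    (1 : Matrix I I ℝ) i j ≤ exp M i j := by
  have hpow : ∀ n : ℕ, ∀ i j, 0 ≤ (M ^ n) i j := by
    intro n
    induction n with
    | zero => intro i j; rw [pow_zero, Matrix.one_apply]; split_ifs <;> norm_num
    | succ n ih =>
      intro i j
      rw [pow_succ, Matrix.mul_apply]
      exact Finset.sum_nonneg fun k _ => mul_nonneg (ih i k) (hM k j)
  have hs : HasSum (fun n : ℕ => ((n.factorial : ℝ)⁻¹ • M ^ n)) (exp M) :=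
    exp_series_hasSum_exp' (𝕂 := ℝ) M
  have hs2 : HasSum (fun n : ℕ => ((n.factorial : ℝ)⁻¹ • M ^ n) i j) (exp M i j) :=
    Pi.hasSum.1 (Pi.hasSum.1 hs i) j
  have := le_hasSum hs2 0 fun n _ => by
    simp only [Matrix.smul_apply, smul_eq_mul]
    exact mul_nonneg (by positivity) (hpow n i j)
  simpa using this

/-- For a matrix with nonnegative off-diagonal entries, `e^{tB}` dominates a positive multiple of
the identity: shift the diagonal by a large constant. -/
theorem exists_le_exp_of_offDiag_nonneg {B : Matrix I I ℝ} (hB : ∀ i j, i ≠ j → 0 ≤ B i j) {t : ℝ}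
    (ht : 0 ≤ t) : ∃ c > 0, ∀ i j, c * (1 : Matrix I I ℝ) i j ≤ exp (t • B) i j := by
  set c : ℝ := ∑ i, |B i i| with hc
  have hM : ∀ i j, 0 ≤ (t • (B + c • (1 : Matrix I I ℝ))) i j := by
    intro i j
    simp only [Matrix.smul_apply, Matrix.add_apply, smul_eq_mul, Matrix.one_apply]
    refine mul_nonneg ht ?_
    split_ifs with hij
    · subst hij
      have : |B i i| ≤ c := Finset.single_le_sum (f := fun i => |B i i|)
        (fun _ _ => abs_nonneg _) (Finset.mem_univ i)
      linarith [neg_abs_le (B i i)]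
    · simpa using hB i j hij
  have hexp : exp (t • B) = Real.exp (-(t * c)) • exp (t • (B + c • (1 : Matrix I I ℝ))) := by
    have h1 : t • B = (-(t * c)) • (1 : Matrix I I ℝ) + t • (B + c • (1 : Matrix I I ℝ)) := by
      rw [smul_add, smul_smul, neg_smul]; abel
    have h2 : exp ((-(t * c)) • (1 : Matrix I I ℝ)) = Real.exp (-(t * c)) • 1 := by
      have := (algebraMap_exp_comm (𝔸 := Matrix I I ℝ) (-(t * c))).symm
      rwa [Algebra.algebraMap_eq_smul_one, Algebra.algebraMap_eq_smul_one,
        ← Real.exp_eq_exp_ℝ] at this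
    rw [h1, Matrix.exp_add_of_commute, h2]
    · simp
    · exact (Commute.one_left _).smul_left _
  refine ⟨Real.exp (-(t * c)), Real.exp_pos _, fun i j => ?_⟩
  rw [hexp, Matrix.smul_apply, smul_eq_mul]
  exact mul_le_mul_of_nonneg_left (one_le_exp_of_nonneg hM i j) (Real.exp_pos _).le

/-- The only solution of a linear equation on `[0, ∞)`. -/
theorem linear_ode_solution (B : Matrix I I ℝ) {u : ℝ → I → ℝ}
    (hu : ∀ t, 0 ≤ t → HasDerivWithinAt u (u t ᵥ* B) (Ici 0) t) {t : ℝ} (ht : 0 ≤ t) :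
    u t = u 0 ᵥ* exp (t • B) := by
  have hv : ContDiff ℝ 1 fun x : I → ℝ => x ᵥ* B := by
    refine contDiff_pi.2 fun i => ?_
    simp only [Matrix.vecMul, dotProduct]
    fun_prop
  refine ode_unique_of_contDiff hv hu (g := fun t => u 0 ᵥ* exp (t • B))
    (fun s _ => (hasDerivAt_vecMul_exp B (u 0) s).hasDerivWithinAt) ?_ ht
  simp

end MatrixExp

/-! ### The faces of the effective simplex -/

section Faces

variable {I O : Type*} [Fintype I] {h : I → O}

theorem eq_of_mem_face {a b : O} {x : I → ℝ} (ha : x ∈ face h a) (hb : x ∈ face h b) : a = b := by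
  by_contra hab
  have : ∑ i, x i = 0 := Finset.sum_eq_zero fun i _ => by
    by_cases hi : h i = a
    · exact hb.2 i (hi ▸ hab)
    · exact ha.2 i hi
  linarith [ha.1.2]

theorem level_eq {a : O} {x : effSimplex h} (hx : (x : I → ℝ) ∈ face h a) : level x = a :=
  eq_of_mem_face (mem_face_level x) hx

theorem mem_effSimplex {a : O} {x : I → ℝ} (hx : x ∈ face h a) : x ∈ effSimplex h :=
  mem_iUnion.2 ⟨a, hx⟩

theorem isClosed_face (a : O) : IsClosed (face h a) := by
  refine (isClosed_stdSimplex ℝ I).inter ?_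
  have : {x : I → ℝ | ∀ i, h i ≠ a → x i = 0} = ⋂ i, ⋂ (_ : h i ≠ a), {x | x i = 0} := by
    ext; simp
  change IsClosed {x : I → ℝ | ∀ i, h i ≠ a → x i = 0}
  rw [this]
  exact isClosed_iInter fun i => isClosed_iInter fun _ =>
    isClosed_eq (continuous_apply i) continuous_const

theorem measurableSet_effSimplex [Finite O] : MeasurableSet (effSimplex h) :=
  (isClosed_iUnion_of_finite isClosed_face).measurableSet

variable [DecidableEq O]

theorem continuous_levelMass (a : O) : Continuous (levelMass h a) := by
  unfold levelMass
  refine continuous_finsetSum _ fun i _ => ?_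
  split_ifs <;> fun_prop

theorem levelMass_smul (a : O) (c : ℝ) (v : I → ℝ) :
    levelMass h a (c • v) = c * levelMass h a v := by
  simp [levelMass, Finset.mul_sum]

theorem levelMass_of_mem_face {a : O} {x : I → ℝ} (hx : x ∈ face h a) : levelMass h a x = 1 := by
  rw [← hx.1.2]
  refine Finset.sum_congr rfl fun i _ => ?_
  split_ifs with hi
  · rfl
  · exact (hx.2 i hi).symm

theorem levelMass_of_mem_face_of_ne {a b : O} (hab : b ≠ a) {x : I → ℝ} (hx : x ∈ face h a) :
    levelMass h b x = 0 := by
  refine Finset.sum_eq_zero fun i _ => ?_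
  split_ifs with hi
  · exact hx.2 i (hi ▸ hab)
  · rfl

theorem level_eq_iff_levelMass_pos {a : O} {x : effSimplex h} :
    level x = a ↔ 0 < levelMass h a x := by
  constructor
  · rintro rfl
    rw [levelMass_of_mem_face (mem_face_level x)]
    exact one_pos
  · intro hpos
    by_contra hne
    rw [levelMass_of_mem_face_of_ne (Ne.symm hne) (mem_face_level x)] at hpos
    exact lt_irrefl _ hpos

/-- The faces are open in their union, so the level is locally constant. -/
theorem isOpen_level_eq (a : O) : IsOpen {x : effSimplex h | level x = a} := by
  simp only [level_eq_iff_levelMass_pos]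
  exact isOpen_lt continuous_const ((continuous_levelMass a).comp continuous_subtype_val)

theorem eventually_level_eq (x : effSimplex h) : ∀ᶠ z in 𝓝 x, level z = level x :=
  (isOpen_level_eq (level x)).mem_nhds rfl

/-- A function that is given by a measurable function on each of the sets `{l = a}` is
measurable. -/
theorem measurable_of_index [Countable O] {γ Z : Type*} {m : MeasurableSpace γ}
    {mZ : MeasurableSpace Z} {l : γ → O} (hl : ∀ a, MeasurableSet {x | l x = a})
    {g : O → γ → Z} (hg : ∀ a, Measurable (g a)) : Measurable fun x => g (l x) x := by
  intro B hB
  have : (fun x => g (l x) x) ⁻¹' B = ⋃ a, {x | l x = a} ∩ g a ⁻¹' B := by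
    ext x; simp
  rw [this]
  exact MeasurableSet.iUnion fun a => (hl a).inter (hg a hB)

theorem measurableSet_level_eq (a : O) : MeasurableSet {x : effSimplex h | level x = a} :=
  (isOpen_level_eq a).measurableSet

theorem sum_levelMass [Fintype O] (v : I → ℝ) : ∑ b, levelMass h b v = ∑ i, v i := by
  simp only [levelMass]
  rw [Finset.sum_comm]
  simp

theorem opH_mem_face {νfix : O → I → ℝ} (hνfix : ∀ a, νfix a ∈ face h a) {b : O} {v : I → ℝ}
    (hv : ∀ i, h i = b → 0 ≤ v i) : opH h νfix b v ∈ face h b := by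
  unfold opH
  have hnn : 0 ≤ levelMass h b v := Finset.sum_nonneg fun i _ => by
    split_ifs with hi
    exacts [hv i hi, le_rfl]
  split_ifs with h0
  · exact hνfix b
  refine ⟨⟨fun i => ?_, ?_⟩, fun i hi => by simp [hi]⟩
  · dsimp only
    split_ifs with hi
    exacts [div_nonneg (hv i hi) hnn, le_rfl]
  · have : ∀ i, (if h i = b then v i / levelMass h b v else 0)
        = (if h i = b then v i else 0) / levelMass h b v := fun i => by split_ifs <;> simp
    simp only [this]
    rw [← Finset.sum_div]
    exact div_self h0

theorem measurable_opH (νfix : O → I → ℝ) (b : O) : Measurable (opH h νfix b) := by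
  have hm := (continuous_levelMass (h := h) b).measurable
  refine Measurable.ite (measurableSet_eq_fun hm measurable_const) measurable_const ?_
  refine measurable_pi_lambda _ fun i => ?_
  split_ifs
  · exact (measurable_pi_apply i).div hm
  · exact measurable_const

/-- On the face `Δ_b`, the operator `H_b` is the identity. -/
theorem opH_of_mem_face {νfix : O → I → ℝ} {b : O} {x : I → ℝ} (hx : x ∈ face h b) :
    opH h νfix b x = x := by
  unfold opH
  rw [levelMass_of_mem_face hx, if_neg one_ne_zero]
  ext i
  split_ifs with hi
  · simp
  · exact (hx.2 i hi).symm

end Faces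

/-! ### The flow -/

section Flow

variable {I O : Type*} [Fintype I] [DecidableEq O]

/-- The rate matrix of the chain killed when it leaves `h⁻¹(a)`. -/
def killed (Λ : Matrix I I ℝ) (h : I → O) (a : O) : Matrix I I ℝ :=
  Matrix.of fun i j => if h i = a ∧ h j = a then Λ i j else 0

variable {Λ : Matrix I I ℝ} {h : I → O} {a : O}

theorem vecMul_killed {w : I → ℝ} (hw : ∀ i, h i ≠ a → w i = 0) (j : I) :
    (w ᵥ* killed Λ h a) j = if h j = a then (w ᵥ* Λ) j else 0 := by
  simp only [Matrix.vecMul, dotProduct, killed, Matrix.of_apply]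
  split_ifs with hj
  · refine Finset.sum_congr rfl fun i _ => ?_
    by_cases hi : h i = a
    · simp [hi, hj]
    · simp [hw i hi]
  · simp [hj]

theorem sum_vecMul_killed {w : I → ℝ} (hw : ∀ i, h i ≠ a → w i = 0) :
    ∑ j, (w ᵥ* killed Λ h a) j = levelMass h a (w ᵥ* Λ) := by
  simp only [vecMul_killed hw, levelMass]

theorem IsRateMatrix.sum_vecMul (hΛ : IsRateMatrix Λ) (x : I → ℝ) : ∑ j, (x ᵥ* Λ) j = 0 := by
  simp only [Matrix.vecMul, dotProduct]
  rw [Finset.sum_comm]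
  simp [← Finset.mul_sum, hΛ.2]

theorem IsRateMatrix.vecMul_nonneg (hΛ : IsRateMatrix Λ) {x : I → ℝ} (hx : x ∈ face h a) {j : I}
    (hj : h j ≠ a) : 0 ≤ (x ᵥ* Λ) j := by
  refine Finset.sum_nonneg fun i _ => ?_
  by_cases hij : i = j
  · subst hij; simp [hx.2 i hj]
  · exact mul_nonneg (hx.1.1 i) (hΛ.1 i j hij)

variable [DecidableEq I]

variable (Λ h a) in
/-- The solution `x e^{tB}` of the linear equation with the killed rate matrix `B`: the
unnormalised version of the flow. -/
def unnorm (x : I → ℝ) (t : ℝ) : I → ℝ := x ᵥ* NormedSpace.exp (t • killed Λ h a)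

theorem hasDerivAt_unnorm (x : I → ℝ) (t : ℝ) :
    HasDerivAt (unnorm Λ h a x) (unnorm Λ h a x t ᵥ* killed Λ h a) t :=
  hasDerivAt_vecMul_exp _ x t

@[simp]
theorem unnorm_zero (x : I → ℝ) : unnorm Λ h a x 0 = x := by simp [unnorm]

theorem unnorm_add (x : I → ℝ) (s t : ℝ) :
    unnorm Λ h a x (s + t) = unnorm Λ h a (unnorm Λ h a x s) t := by
  rw [unnorm, exp_add_smul, ← Matrix.vecMul_vecMul]; rfl

theorem unnorm_smul (c : ℝ) (x : I → ℝ) (t : ℝ) :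
    unnorm Λ h a (c • x) t = c • unnorm Λ h a x t := Matrix.smul_vecMul _ _ _

theorem continuous_unnorm : Continuous fun p : ℝ × (I → ℝ) => unnorm Λ h a p.2 p.1 :=
  Continuous.matrix_vecMul continuous_snd ((continuous_matrixExp _).comp continuous_fst)

theorem unnorm_support {x : I → ℝ} (hx : ∀ i, h i ≠ a → x i = 0) (t : ℝ) {i : I} (hi : h i ≠ a) :
    unnorm Λ h a x t i = 0 := by
  have hd : ∀ s, HasDerivAt (fun s => unnorm Λ h a x s i) 0 s := fun s => by
    have := (hasDerivAt_pi.1 (hasDerivAt_unnorm (Λ := Λ) (h := h) (a := a) x s)) i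
    have h0 : (unnorm Λ h a x s ᵥ* killed Λ h a) i = 0 := by
      simp [Matrix.vecMul, dotProduct, killed, hi]
    rwa [h0] at this
  have := is_const_of_deriv_eq_zero (fun s => (hd s).differentiableAt) (fun s => (hd s).deriv) t 0
  simpa [hx i hi] using this

theorem killed_offDiag_nonneg (hΛ : IsRateMatrix Λ) (i j : I) (hij : i ≠ j) :
    0 ≤ killed Λ h a i j := by
  simp only [killed, Matrix.of_apply]
  split_ifs
  exacts [hΛ.1 i j hij, le_rfl]

theorem exists_unnorm_ge (hΛ : IsRateMatrix Λ) {x : I → ℝ} (hx : ∀ i, 0 ≤ x i) {t : ℝ}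
    (ht : 0 ≤ t) : ∃ c > 0, ∀ i, c * x i ≤ unnorm Λ h a x t i := by
  obtain ⟨c, hc, hle⟩ := exists_le_exp_of_offDiag_nonneg
    (killed_offDiag_nonneg (h := h) (a := a) hΛ) ht
  refine ⟨c, hc, fun j => ?_⟩
  have : c * x j = ∑ i, x i * (c * (1 : Matrix I I ℝ) i j) := by
    simp [Matrix.one_apply, mul_comm]
  rw [this]
  exact Finset.sum_le_sum fun i _ => mul_le_mul_of_nonneg_left (hle i j) (hx i)

theorem unnorm_nonneg (hΛ : IsRateMatrix Λ) {x : I → ℝ} (hx : ∀ i, 0 ≤ x i) {t : ℝ}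
    (ht : 0 ≤ t) (i : I) : 0 ≤ unnorm Λ h a x t i := by
  obtain ⟨c, hc, hle⟩ := exists_unnorm_ge (h := h) (a := a) hΛ hx ht
  exact (mul_nonneg hc.le (hx i)).trans (hle i)

theorem sum_unnorm_pos (hΛ : IsRateMatrix Λ) {x : I → ℝ} (hx : x ∈ face h a) {t : ℝ}
    (ht : 0 ≤ t) : 0 < ∑ i, unnorm Λ h a x t i := by
  obtain ⟨c, hc, hle⟩ := exists_unnorm_ge (h := h) (a := a) hΛ hx.1.1 ht
  calc 0 < c * ∑ i, x i := by rw [hx.1.2]; linarith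
    _ ≤ _ := by rw [Finset.mul_sum]; exact Finset.sum_le_sum fun i _ => hle i

theorem hasDerivAt_sum_unnorm {x : I → ℝ} (hx : ∀ i, h i ≠ a → x i = 0) (t : ℝ) :
    HasDerivAt (fun t => ∑ i, unnorm Λ h a x t i) (levelMass h a (unnorm Λ h a x t ᵥ* Λ)) t := by
  rw [← sum_vecMul_killed fun i hi => unnorm_support hx t hi]
  exact HasDerivAt.fun_sum fun i _ => (hasDerivAt_pi.1 (hasDerivAt_unnorm x t)) i

variable (Λ h a) in
/-- The normalised solution `x e^{tB} / (x e^{tB} 1)`. -/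
def normFlow (x : I → ℝ) (t : ℝ) : I → ℝ :=
  (∑ i, unnorm Λ h a x t i)⁻¹ • unnorm Λ h a x t

theorem normFlow_mem_face (hΛ : IsRateMatrix Λ) {x : I → ℝ} (hx : x ∈ face h a) {t : ℝ}
    (ht : 0 ≤ t) : normFlow Λ h a x t ∈ face h a := by
  have hpos := sum_unnorm_pos hΛ hx ht
  refine ⟨⟨fun i => ?_, ?_⟩, fun i hi => ?_⟩
  · exact mul_nonneg (inv_nonneg.2 hpos.le) (unnorm_nonneg hΛ hx.1.1 ht i)
  · simp only [normFlow, Pi.smul_apply, smul_eq_mul, ← Finset.mul_sum]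
    exact inv_mul_cancel₀ hpos.ne'
  · simp [normFlow, unnorm_support hx.2 t hi]

theorem isFlowCurve_normFlow (hΛ : IsRateMatrix Λ) {x : I → ℝ} (hx : x ∈ face h a) :
    IsFlowCurve Λ h a x (normFlow Λ h a x) := by
  refine ⟨by simp [normFlow, hx.1.2], fun t ht => HasDerivAt.hasDerivWithinAt ?_⟩
  have hpos := sum_unnorm_pos hΛ hx ht
  set w := unnorm Λ h a x t with hw
  set m := ∑ i, w i with hm
  have hsupp : ∀ i, h i ≠ a → w i = 0 := fun i hi => unnorm_support hx.2 t hi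
  rw [hasDerivAt_pi]
  intro i
  have hd : HasDerivAt (fun t => (∑ i, unnorm Λ h a x t i)⁻¹ * unnorm Λ h a x t i) _ t :=
    ((hasDerivAt_sum_unnorm hx.2 t).fun_inv hpos.ne').mul
      ((hasDerivAt_pi.1 (hasDerivAt_unnorm x t)) i)
  convert! hd using 1
  simp only [vectorField, normFlow, ← hw, ← hm, Matrix.smul_vecMul, levelMass_smul,
    vecMul_killed hsupp, Pi.smul_apply, smul_eq_mul]
  split_ifs <;> field_simp <;> ring

theorem contDiff_vectorField : ContDiff ℝ 1 (vectorField Λ h a) := by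
  have hl : ∀ j, ContDiff ℝ 1 fun y : I → ℝ => (y ᵥ* Λ) j := fun j => by
    simp only [Matrix.vecMul, dotProduct]
    fun_prop
  refine contDiff_pi.2 fun i => ?_
  unfold vectorField levelMass
  refine ContDiff.sub ?_ (ContDiff.mul (ContDiff.sum fun j _ => ?_) (contDiff_apply ℝ ℝ i))
  · split_ifs
    exacts [hl i, contDiff_const]
  · split_ifs
    exacts [hl j, contDiff_const]

theorem IsFlowCurve.eq_normFlow (hΛ : IsRateMatrix Λ) {x : I → ℝ} (hx : x ∈ face h a)
    {y : ℝ → I → ℝ} (hy : IsFlowCurve Λ h a x y) {t : ℝ} (ht : 0 ≤ t) :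
    y t = normFlow Λ h a x t :=
  have hn := isFlowCurve_normFlow hΛ hx
  ode_unique_of_contDiff contDiff_vectorField hy.2 hn.2 (hy.1.trans hn.1.symm) ht

theorem flowCurve_eq (hΛ : IsRateMatrix Λ) {x : I → ℝ} (hx : x ∈ face h a) {t : ℝ} (ht : 0 ≤ t) :
    flowCurve Λ h a x t = normFlow Λ h a x t := by
  have hex : ∃ y, IsFlowCurve Λ h a x y := ⟨_, isFlowCurve_normFlow hΛ hx⟩
  rw [flowCurve, dif_pos hex]
  exact hex.choose_spec.eq_normFlow hΛ hx ht

theorem coe_flow (hΛ : IsRateMatrix Λ) (t : ℝ≥0) (x : effSimplex h) :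
    (flow Λ h t x : I → ℝ) = normFlow Λ h (level x) x t := by
  have hc := flowCurve_eq hΛ (mem_face_level x) t.2
  have hm : flowCurve Λ h (level x) x t ∈ effSimplex h :=
    mem_effSimplex (hc ▸ normFlow_mem_face hΛ (mem_face_level x) t.2)
  rw [flow, dif_pos hm]
  exact hc

theorem coe_flow_of_mem (hΛ : IsRateMatrix Λ) (t : ℝ≥0) {x : effSimplex h}
    (hx : (x : I → ℝ) ∈ face h a) : (flow Λ h t x : I → ℝ) = normFlow Λ h a x t := by
  rw [coe_flow hΛ, level_eq hx]

@[simp]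
theorem level_flow (hΛ : IsRateMatrix Λ) (t : ℝ≥0) (x : effSimplex h) :
    level (flow Λ h t x) = level x :=
  level_eq (by rw [coe_flow hΛ]; exact normFlow_mem_face hΛ (mem_face_level x) t.2)

theorem isFlowCurve_flow (hΛ : IsRateMatrix Λ) {x : effSimplex h} (hx : (x : I → ℝ) ∈ face h a) :
    IsFlowCurve Λ h a x fun t => flow Λ h t.toNNReal x := by
  have heq : ∀ t : ℝ, 0 ≤ t → (flow Λ h t.toNNReal x : I → ℝ) = normFlow Λ h a x t :=
    fun t ht => by rw [coe_flow_of_mem hΛ _ hx, Real.coe_toNNReal t ht]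
  have hn := isFlowCurve_normFlow hΛ hx
  refine ⟨(heq 0 le_rfl).trans hn.1, fun t ht => ?_⟩
  dsimp only
  rw [heq t ht]
  exact (hn.2 t ht).congr (fun s hs => heq s hs) (heq t ht)

theorem flow_zero (hΛ : IsRateMatrix Λ) (x : effSimplex h) : flow Λ h 0 x = x :=
  Subtype.ext (by rw [coe_flow hΛ]; exact (isFlowCurve_normFlow hΛ (mem_face_level x)).1)

theorem flow_add (hΛ : IsRateMatrix Λ) (t s : ℝ≥0) (x : effSimplex h) :
    flow Λ h t (flow Λ h s x) = flow Λ h (t + s) x := by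
  have hpos := (sum_unnorm_pos hΛ (mem_face_level x) s.2).ne'
  refine Subtype.ext ?_
  rw [coe_flow hΛ, level_flow hΛ, coe_flow hΛ, coe_flow hΛ, NNReal.coe_add, add_comm (t : ℝ)]
  simp only [normFlow, unnorm_smul, unnorm_add, Pi.smul_apply, smul_eq_mul, ← Finset.mul_sum,
    mul_inv, inv_inv, smul_smul]
  congr 1
  have hpos : (∑ i, unnorm Λ h (level x) (x : I → ℝ) s i) ≠ 0 := hpos
  field_simp

theorem continuous_flow (hΛ : IsRateMatrix Λ) :
    Continuous fun p : ℝ≥0 × effSimplex h => flow Λ h p.1 p.2 := by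
  rw [continuous_iff_continuousAt]
  rintro ⟨t, x⟩
  rw [Topology.IsInducing.subtypeVal.continuousAt_iff]
  have hu : Continuous fun p : ℝ≥0 × effSimplex h => unnorm Λ h (level x) (p.2 : I → ℝ) p.1 :=
    continuous_unnorm.comp (f := fun p : ℝ≥0 × effSimplex h => ((p.1 : ℝ), (p.2 : I → ℝ)))
      (by fun_prop)
  have hs : Continuous fun p : ℝ≥0 × effSimplex h =>
      ∑ i, unnorm Λ h (level x) (p.2 : I → ℝ) p.1 i :=
    continuous_finsetSum _ fun i _ => (continuous_apply i).comp hu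
  have hc : ContinuousAt (fun p : ℝ≥0 × effSimplex h => normFlow Λ h (level x) (p.2 : I → ℝ) p.1)
      (t, x) :=
    (hs.continuousAt.inv₀ (sum_unnorm_pos hΛ (mem_face_level x) t.2).ne').smul hu.continuousAt
  refine hc.congr ?_
  have : ∀ᶠ p : ℝ≥0 × effSimplex h in 𝓝 (t, x), level p.2 = level x :=
    (continuous_snd.tendsto (t, x)).eventually (eventually_level_eq x)
  filter_upwards [this] with p hp
  simp only [Function.comp, coe_flow hΛ, hp]

/-! ### The jump rate and the transition measure -/

theorem jumpRate_nonneg (hΛ : IsRateMatrix Λ) (x : effSimplex h) : 0 ≤ jumpRate Λ h x := by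
  have hsum := hΛ.sum_vecMul (x : I → ℝ)
  have hle : levelMass h (level x) ((x : I → ℝ) ᵥ* Λ) ≤ ∑ j, ((x : I → ℝ) ᵥ* Λ) j := by
    refine Finset.sum_le_sum fun j _ => ?_
    split_ifs with hj
    exacts [le_rfl, hΛ.vecMul_nonneg (mem_face_level x) hj]
  unfold jumpRate
  linarith

theorem continuous_vecMul_coe : Continuous fun x : effSimplex h => (x : I → ℝ) ᵥ* Λ :=
  Continuous.matrix_vecMul continuous_subtype_val continuous_const

theorem continuous_jumpRate : Continuous (jumpRate Λ h) := by
  rw [continuous_iff_continuousAt]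
  intro x
  have : Continuous fun z : effSimplex h => -levelMass h (level x) ((z : I → ℝ) ᵥ* Λ) :=
    ((continuous_levelMass _).comp continuous_vecMul_coe).neg
  refine this.continuousAt.congr ?_
  filter_upwards [eventually_level_eq x] with z hz
  rw [jumpRate, hz]

/-- The total mass of the unnormalised flow is the survival probability for the jump rate: its
logarithmic derivative is minus the jump rate along the flow. -/
theorem exp_neg_integral_jumpRate (hΛ : IsRateMatrix Λ) (x : effSimplex h) (t : ℝ≥0) :
    Real.exp (-∫ s in (0 : ℝ)..t, jumpRate Λ h (flow Λ h s.toNNReal x)) =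
      ∑ i, unnorm Λ h (level x) x t i := by
  have hx := mem_face_level x
  have hpos : ∀ s : ℝ, 0 ≤ s → 0 < ∑ i, unnorm Λ h (level x) x s i :=
    fun s hs => sum_unnorm_pos hΛ hx hs
  have hcont : Continuous fun s : ℝ => jumpRate Λ h (flow Λ h s.toNNReal x) :=
    continuous_jumpRate.comp ((continuous_flow hΛ).comp
      (continuous_real_toNNReal.prodMk continuous_const))
  have hint := intervalIntegral.integral_eq_sub_of_hasDerivAt (a := 0) (b := (t : ℝ))
    (f := fun s => -Real.log (∑ i, unnorm Λ h (level x) x s i))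
    (f' := fun s => jumpRate Λ h (flow Λ h s.toNNReal x)) (fun s hs => ?_)
    (hcont.intervalIntegrable _ _)
  · rw [hint]
    simp [hx.1.2, Real.exp_log (hpos t t.2)]
  · have hs0 : 0 ≤ s := by
      rw [uIcc_of_le (NNReal.coe_nonneg t)] at hs; exact hs.1
    have hd := ((hasDerivAt_sum_unnorm (Λ := Λ) hx.2 s).log (hpos s hs0).ne').neg
    convert! hd using 1
    rw [jumpRate, level_flow hΛ, coe_flow hΛ, Real.coe_toNNReal s hs0, normFlow,
      Matrix.smul_vecMul, levelMass_smul]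
    field_simp

variable [Fintype O] {νfix : O → I → ℝ} {qfix : O → O → ℝ}

theorem opH_mem_face_of_ne (hΛ : IsRateMatrix Λ) (hνfix : ∀ a, νfix a ∈ face h a)
    {x : effSimplex h} {b : O} (hb : b ≠ level x) :
    opH h νfix b ((x : I → ℝ) ᵥ* Λ) ∈ face h b :=
  opH_mem_face hνfix fun _ hi => hΛ.vecMul_nonneg (mem_face_level x) (hi ▸ hb)

theorem levelMass_vecMul_nonneg (hΛ : IsRateMatrix Λ) {x : effSimplex h} {b : O}
    (hb : b ≠ level x) : 0 ≤ levelMass h b ((x : I → ℝ) ᵥ* Λ) :=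
  Finset.sum_nonneg fun i _ => by
    split_ifs with hi
    exacts [hΛ.vecMul_nonneg (mem_face_level x) (hi ▸ hb), le_rfl]

theorem jumpProb_nonneg (hΛ : IsRateMatrix Λ)
    (hqfix : ∀ a, qfix a ∈ stdSimplex ℝ O ∧ qfix a a = 0) (x : effSimplex h) (b : O) :
    0 ≤ jumpProb Λ h qfix x b := by
  unfold jumpProb
  split_ifs with h0 hb
  · exact (hqfix _).1.1 b
  · exact le_rfl
  · exact div_nonneg (levelMass_vecMul_nonneg hΛ hb) (jumpRate_nonneg hΛ x)

theorem jumpProb_level (hqfix : ∀ a, qfix a ∈ stdSimplex ℝ O ∧ qfix a a = 0) (x : effSimplex h) :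
    jumpProb Λ h qfix x (level x) = 0 := by
  rw [jumpProb, if_pos rfl, (hqfix _).2, ite_self]

theorem sum_jumpProb (hΛ : IsRateMatrix Λ)
    (hqfix : ∀ a, qfix a ∈ stdSimplex ℝ O ∧ qfix a a = 0) (x : effSimplex h) :
    ∑ b, jumpProb Λ h qfix x b = 1 := by
  unfold jumpProb
  split_ifs with h0
  · exact (hqfix _).1.2
  · have hsum := (sum_levelMass (h := h) ((x : I → ℝ) ᵥ* Λ)).trans (hΛ.sum_vecMul x)
    rw [← Finset.add_sum_erase _ _ (Finset.mem_univ (level x))] at hsum ⊢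
    rw [if_pos rfl, zero_add, Finset.sum_congr rfl
      fun b hb => if_neg (Finset.ne_of_mem_erase hb), ← Finset.sum_div, div_eq_one_iff_eq
      (neg_ne_zero.2 h0)]
    linarith

theorem measurable_jumpProb (b : O) : Measurable fun x => jumpProb Λ h qfix x b := by
  have hm : ∀ c, Measurable fun x : effSimplex h => levelMass h c ((x : I → ℝ) ᵥ* Λ) := fun c =>
    ((continuous_levelMass c).comp continuous_vecMul_coe).measurable
  have hg : ∀ c, Measurable fun x : effSimplex h =>
      if levelMass h c ((x : I → ℝ) ᵥ* Λ) = 0 then qfix c b else if b = c then 0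
        else levelMass h b ((x : I → ℝ) ᵥ* Λ) / -levelMass h c ((x : I → ℝ) ᵥ* Λ) := fun c => by
    refine Measurable.ite (measurableSet_eq_fun (hm c) measurable_const) measurable_const ?_
    split_ifs
    exacts [measurable_const, (hm b).div (hm c).neg]
  exact measurable_of_index measurableSet_level_eq hg

theorem transMeasure_apply (x : effSimplex h) {A : Set (effSimplex h)} (hA : MeasurableSet A) :
    transMeasure Λ h νfix qfix x A = ∑ b, ENNReal.ofReal (jumpProb Λ h qfix x b) *
      (Subtype.val '' A).indicator 1 (opH h νfix b ((x : I → ℝ) ᵥ* Λ)) := by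
  have he := MeasurableEmbedding.subtype_coe (measurableSet_effSimplex (h := h))
  rw [transMeasure, he.comap_apply]
  simp only [Measure.coe_finsetSum, Finset.sum_apply, Measure.smul_apply, smul_eq_mul,
    Measure.dirac_apply' _ (he.measurableSet_image' hA)]

theorem isPDPTriple (hΛ : IsRateMatrix Λ) (hνfix : ∀ a, νfix a ∈ face h a)
    (hqfix : ∀ a, qfix a ∈ stdSimplex ℝ O ∧ qfix a a = 0) :
    IsPDPTriple h (flow Λ h) (jumpRate Λ h) (transMeasure Λ h νfix qfix) where
  flow_continuous := continuous_flow hΛ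
  flow_zero := flow_zero hΛ
  flow_add := flow_add hΛ
  flow_invariant a t x hx := by
    rw [coe_flow_of_mem hΛ t hx]
    exact normFlow_mem_face hΛ hx t.2
  rate_nonneg := jumpRate_nonneg hΛ
  rate_measurable := continuous_jumpRate.measurable
  rate_integrable x := by
    have hcont : Continuous fun s : ℝ => jumpRate Λ h (flow Λ h s.toNNReal x) :=
      continuous_jumpRate.comp ((continuous_flow hΛ).comp
        (continuous_real_toNNReal.prodMk continuous_const))
    exact ⟨1, one_pos, (hcont.integrableOn_Icc).mono_set Ioc_subset_Icc_self⟩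
  trans_measurable := by
    refine Measure.measurable_of_measurable_coe _ fun A hA => ?_
    simp only [transMeasure_apply _ hA]
    refine Finset.measurable_fun_sum _ fun b _ => ?_
    refine ((measurable_jumpProb b).ennreal_ofReal).mul ?_
    have hA' := (MeasurableEmbedding.subtype_coe
      (measurableSet_effSimplex (h := h))).measurableSet_image' hA
    exact (measurable_one.indicator hA').comp
      ((measurable_opH νfix b).comp continuous_vecMul_coe.measurable)
  trans_prob x := ⟨by
    rw [transMeasure_apply x MeasurableSet.univ]
    have : ∀ b, ENNReal.ofReal (jumpProb Λ h qfix x b) *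
        (Subtype.val '' (univ : Set (effSimplex h))).indicator 1
          (opH h νfix b ((x : I → ℝ) ᵥ* Λ)) = ENNReal.ofReal (jumpProb Λ h qfix x b) := by
      intro b
      by_cases hb : b = level x
      · simp [hb, jumpProb_level hqfix]
      · have : opH h νfix b ((x : I → ℝ) ᵥ* Λ) ∈ effSimplex h :=
          mem_effSimplex (opH_mem_face_of_ne hΛ hνfix hb)
        rw [indicator_of_mem (by simpa using this)]
        simp
    simp only [this]
    rw [← ENNReal.ofReal_sum_of_nonneg fun b _ => jumpProb_nonneg hΛ hqfix x b,
      sum_jumpProb hΛ hqfix, ENNReal.ofReal_one]⟩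
  trans_self x := by
    rw [transMeasure_apply x (measurableSet_singleton x)]
    refine Finset.sum_eq_zero fun b _ => ?_
    by_cases hb : b = level x
    · simp [hb, jumpProb_level hqfix]
    · have hne : opH h νfix b ((x : I → ℝ) ᵥ* Λ) ≠ x := fun he =>
        hb (level_eq (he ▸ opH_mem_face_of_ne hΛ hνfix hb)).symm
      rw [indicator_of_notMem (by simpa using hne), mul_zero]

/-- The state after a jump of the observation to `b` from the filter state `x`, as a point of the
effective simplex (with the irrelevant value `x` where `H_b[xΛ]` is not a probability vector). -/
def postJump (Λ : Matrix I I ℝ) (h : I → O) (νfix : O → I → ℝ) (b : O) (x : effSimplex h) :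
    effSimplex h :=
  open Classical in
  if hm : opH h νfix b ((x : I → ℝ) ᵥ* Λ) ∈ effSimplex h then ⟨_, hm⟩ else x

theorem coe_postJump (hΛ : IsRateMatrix Λ) (hνfix : ∀ a, νfix a ∈ face h a) {x : effSimplex h}
    {b : O} (hb : b ≠ level x) :
    (postJump Λ h νfix b x : I → ℝ) = opH h νfix b ((x : I → ℝ) ᵥ* Λ) := by
  rw [postJump, dif_pos (mem_effSimplex (opH_mem_face_of_ne hΛ hνfix hb))]

theorem measurable_postJump (b : O) : Measurable (postJump Λ h νfix b) := by
  have hH : Measurable fun x : effSimplex h => opH h νfix b ((x : I → ℝ) ᵥ* Λ) :=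
    (measurable_opH νfix b).comp continuous_vecMul_coe.measurable
  have : (fun x => (postJump Λ h νfix b x : I → ℝ)) = fun x : effSimplex h => open Classical in
      if opH h νfix b ((x : I → ℝ) ᵥ* Λ) ∈ effSimplex h then
        opH h νfix b ((x : I → ℝ) ᵥ* Λ) else (x : I → ℝ) := by
    ext1 x
    unfold postJump
    split_ifs <;> rfl
  refine Measurable.subtype_mk (h := fun x => (postJump Λ h νfix b x).2) ?_
  rw [this]
  exact Measurable.ite (measurableSet_effSimplex.preimage hH) hH measurable_subtype_coe

end Flow

/-! ### Jump times of step paths -/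

/-- Right-continuous paths with left limits for the discrete topology of the state space. -/
structure IsStepPath {α : Type*} (y : ℝ≥0 → α) : Prop where
  right : ∀ t, ∀ᶠ s in 𝓝[≥] t, y s = y t
  left : ∀ t, 0 < t → ∃ c, ∀ᶠ s in 𝓝[<] t, y s = c

theorem IsCadlag.isStepPath {E : Type*} [TopologicalSpace E] [DiscreteTopology E] {f : ℝ≥0 → E}
    (hf : IsCadlag f) : IsStepPath f where
  right t := (hf.1 t).eventually (p := fun x => x = f t) (by simp [nhds_discrete])
  left t ht := by
    obtain ⟨l, hl⟩ := hf.2 t ht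
    exact ⟨l, hl.eventually (p := fun x => x = l) (by simp [nhds_discrete])⟩

theorem IsStepPath.comp {α β : Type*} {y : ℝ≥0 → α} (hy : IsStepPath y) (g : α → β) :
    IsStepPath fun t => g (y t) where
  right t := (hy.right t).mono fun _ hs => congrArg g hs
  left t ht := by
    obtain ⟨c, hc⟩ := hy.left t ht
    exact ⟨g c, hc.mono fun _ hs => congrArg g hs⟩

section JumpTimes

variable {α : Type*} {y : ℝ≥0 → α}

theorem IsStepPath.exists_Ico (hy : IsStepPath y) (t : ℝ≥0) :
    ∃ u, t < u ∧ ∀ s, t ≤ s → s < u → y s = y t := by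
  obtain ⟨u, hu, hsub⟩ := mem_nhdsGE_iff_exists_Ico_subset.1 (hy.right t)
  exact ⟨u, hu, fun s h1 h2 => hsub ⟨h1, h2⟩⟩

theorem jumpTime_le_succ (y : ℝ≥0 → α) (n : ℕ) : jumpTime y n ≤ jumpTime y (n + 1) := by
  refine le_sInf ?_
  rintro _ ⟨t, ht, rfl⟩
  exact ht.1.le

theorem monotone_jumpTime (y : ℝ≥0 → α) : Monotone (jumpTime y) :=
  monotone_nat_of_le_succ (jumpTime_le_succ y)

theorem eq_of_lt_jumpTime_succ {n : ℕ} {t : ℝ≥0} (h1 : jumpTime y n ≤ t)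
    (h2 : (t : ℝ≥0∞) < jumpTime y (n + 1)) : y t = y (jumpTime y n).toNNReal := by
  rcases h1.eq_or_lt with h | h
  · rw [h, ENNReal.toNNReal_coe]
  · by_contra hne
    exact absurd (sInf_le (mem_image_of_mem _ (show t ∈ {t : ℝ≥0 | jumpTime y n < t ∧
      y t ≠ y (jumpTime y n).toNNReal} from ⟨h, hne⟩))) (not_le.2 h2)

variable (hy : IsStepPath y)
include hy

theorem IsStepPath.jumpTime_lt_succ {n : ℕ} (hn : jumpTime y n ≠ ⊤) :
    jumpTime y n < jumpTime y (n + 1) := by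
  lift jumpTime y n to ℝ≥0 using hn with T hT
  obtain ⟨u, hu, hyu⟩ := hy.exists_Ico T
  refine (ENNReal.coe_lt_coe.2 hu).trans_le (le_sInf ?_)
  rintro _ ⟨t, ⟨ht1, ht2⟩, rfl⟩
  rw [← hT, ENNReal.coe_lt_coe] at ht1
  rw [← hT, ENNReal.toNNReal_coe] at ht2
  refine ENNReal.coe_le_coe.2 (not_lt.1 fun hlt => ht2 (hyu t ht1.le hlt))

theorem IsStepPath.apply_jumpTime_succ_ne {n : ℕ} (hn : jumpTime y (n + 1) ≠ ⊤) :
    y (jumpTime y (n + 1)).toNNReal ≠ y (jumpTime y n).toNNReal := by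
  intro heq
  obtain ⟨u, hu, hyu⟩ := hy.exists_Ico (jumpTime y (n + 1)).toNNReal
  have hle : (u : ℝ≥0∞) ≤ jumpTime y (n + 1) := by
    refine le_sInf ?_
    rintro _ ⟨t, ht, rfl⟩
    have hge : jumpTime y (n + 1) ≤ t := sInf_le (mem_image_of_mem _ ht)
    refine ENNReal.coe_le_coe.2 (not_lt.1 fun hlt => ht.2 ?_)
    rw [hyu t ((ENNReal.toNNReal_mono ENNReal.coe_ne_top hge)) hlt, heq]
  rw [← ENNReal.coe_toNNReal hn, ENNReal.coe_le_coe] at hle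
  exact absurd hu (not_lt.2 hle)

/-- The jump times do not accumulate: at a finite accumulation point the path would have no left
limit. -/
theorem IsStepPath.exists_lt_jumpTime_succ (t : ℝ≥0) : ∃ n, (t : ℝ≥0∞) < jumpTime y (n + 1) := by
  by_contra! hle
  have hle' : ∀ n, jumpTime y n ≤ t := fun n => (jumpTime_le_succ y n).trans (hle n)
  have hfin : ∀ n, jumpTime y n ≠ ⊤ := fun n => ((hle' n).trans_lt ENNReal.coe_lt_top).ne
  set s : ℕ → ℝ≥0 := fun n => (jumpTime y n).toNNReal with hs
  have hmono : StrictMono s := strictMono_nat_of_lt_succ fun n =>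
    (ENNReal.toNNReal_lt_toNNReal (hfin n) (hfin _)).2 (hy.jumpTime_lt_succ (hfin n))
  have hbdd : BddAbove (range s) := ⟨t, by
    rintro _ ⟨n, rfl⟩
    exact ENNReal.toNNReal_mono ENNReal.coe_ne_top (hle' n)⟩
  have htend := tendsto_atTop_ciSup hmono.monotone hbdd
  set l := ⨆ n, s n
  have hlt : ∀ n, s n < l := fun n => (hmono n.lt_succ_self).trans_le (le_ciSup hbdd _)
  obtain ⟨c, hc⟩ := hy.left l ((zero_le).trans_lt (hlt 0))
  have htend' : Tendsto s atTop (𝓝[<] l) :=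
    tendsto_nhdsWithin_iff.2 ⟨htend, Eventually.of_forall hlt⟩
  have hev := htend'.eventually hc
  obtain ⟨n, h1, h2⟩ := (hev.and ((tendsto_add_atTop_nat 1).eventually hev)).exists
  exact hy.apply_jumpTime_succ_ne (hfin (n + 1)) (h2.trans h1.symm)

omit hy in
theorem jumpCount_eq {n : ℕ} {t : ℝ≥0} (h1 : jumpTime y n ≤ t)
    (h2 : (t : ℝ≥0∞) < jumpTime y (n + 1)) : jumpCount y t = n := by
  refine IsGreatest.csSup_eq ⟨h1, fun k hk => ?_⟩
  by_contra! hlt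
  exact absurd (h2.trans_le (monotone_jumpTime y hlt)) (not_lt.2 hk)

theorem IsStepPath.exists_jumpTime_mem (t : ℝ≥0) :
    ∃ n, jumpTime y n ≤ t ∧ (t : ℝ≥0∞) < jumpTime y (n + 1) := by
  classical
  have hex := hy.exists_lt_jumpTime_succ t
  refine ⟨Nat.find hex, ?_, Nat.find_spec hex⟩
  rcases hn : Nat.find hex with _ | k
  · exact zero_le
  · exact not_lt.1 (Nat.find_min hex (hn ▸ k.lt_succ_self))

end JumpTimes

/-! ### The paths of the filtering process -/

section FilterPath

variable {I O : Type*} [Fintype I] [DecidableEq I] [DecidableEq O] [Fintype O]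
  {Λ : Matrix I I ℝ} {h : I → O} {νfix : O → I → ℝ} {μ : I → ℝ} {y : ℝ≥0 → O}

theorem filterAtJump_mem_face (hΛ : IsRateMatrix Λ) (hνfix : ∀ a, νfix a ∈ face h a)
    (hμ : ∀ i, 0 ≤ μ i) (hy : IsStepPath y) :
    ∀ n, jumpTime y n ≠ ⊤ → filterAtJump Λ h νfix μ y n ∈ face h (y (jumpTime y n).toNNReal)
  | 0, _ => by
    have : (jumpTime y 0).toNNReal = 0 := rfl
    rw [this]
    exact opH_mem_face hνfix fun i _ => hμ i
  | n + 1, hn => by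
    have hn' : jumpTime y n ≠ ⊤ := ne_top_of_le_ne_top hn (jumpTime_le_succ y n)
    have ih := filterAtJump_mem_face hΛ hνfix hμ hy n hn'
    refine opH_mem_face hνfix fun i hi => ?_
    rw [flowCurve_eq hΛ ih (NNReal.coe_nonneg _)]
    refine hΛ.vecMul_nonneg (normFlow_mem_face hΛ ih (NNReal.coe_nonneg _)) ?_
    rw [hi]
    exact hy.apply_jumpTime_succ_ne hn

theorem filterPath_eq {n : ℕ} {t : ℝ≥0} (h1 : jumpTime y n ≤ t)
    (h2 : (t : ℝ≥0∞) < jumpTime y (n + 1)) :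
    filterPath Λ h νfix μ y t = flowCurve Λ h (y (jumpTime y n).toNNReal)
      (filterAtJump Λ h νfix μ y n) (t - (jumpTime y n).toNNReal : ℝ≥0) := by
  rw [filterPath, jumpCount_eq h1 h2]

theorem filterPath_mem_face (hΛ : IsRateMatrix Λ) (hνfix : ∀ a, νfix a ∈ face h a)
    (hμ : ∀ i, 0 ≤ μ i) (hy : IsStepPath y) (t : ℝ≥0) :
    filterPath Λ h νfix μ y t ∈ face h (y t) := by
  obtain ⟨n, h1, h2⟩ := hy.exists_jumpTime_mem t
  have hm := filterAtJump_mem_face hΛ hνfix hμ hy n (h1.trans_lt ENNReal.coe_lt_top).ne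
  rw [filterPath_eq h1 h2, flowCurve_eq hΛ hm (NNReal.coe_nonneg _), eq_of_lt_jumpTime_succ h1 h2]
  exact normFlow_mem_face hΛ hm (NNReal.coe_nonneg _)

theorem filterPath_jumpTime (hΛ : IsRateMatrix Λ) (hνfix : ∀ a, νfix a ∈ face h a)
    (hμ : ∀ i, 0 ≤ μ i) (hy : IsStepPath y) {n : ℕ} (hn : jumpTime y n ≠ ⊤) :
    filterPath Λ h νfix μ y (jumpTime y n).toNNReal = filterAtJump Λ h νfix μ y n := by
  have hm := filterAtJump_mem_face hΛ hνfix hμ hy n hn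
  rw [filterPath_eq (ENNReal.coe_toNNReal hn).ge
    (by rw [ENNReal.coe_toNNReal hn]; exact hy.jumpTime_lt_succ hn), tsub_self,
    flowCurve_eq hΛ hm (NNReal.coe_nonneg _)]
  exact (isFlowCurve_normFlow hΛ hm).1

/-- A path in the effective simplex that is the filter driven by the step path `y`. -/
structure IsFilterPath (Λ : Matrix I I ℝ) (h : I → O) (νfix : O → I → ℝ) (μ : I → ℝ) (y : ℝ≥0 → O)
    (z : ℝ≥0 → effSimplex h) : Prop where
  rate : IsRateMatrix Λ
  fix : ∀ a, νfix a ∈ face h a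
  init_nonneg : ∀ i, 0 ≤ μ i
  step : IsStepPath y
  eq : ∀ t, (z t : I → ℝ) = filterPath Λ h νfix μ y t

namespace IsFilterPath

variable {z : ℝ≥0 → effSimplex h} (hz : IsFilterPath Λ h νfix μ y z)
include hz

theorem mem_face (t : ℝ≥0) : (z t : I → ℝ) ∈ face h (y t) := by
  rw [hz.eq]
  exact filterPath_mem_face hz.rate hz.fix hz.init_nonneg hz.step t

theorem level_eq (t : ℝ≥0) : level (z t) = y t := FilterPDP.level_eq (hz.mem_face t)

theorem eq_flow {n : ℕ} {t : ℝ≥0} (h1 : jumpTime y n ≤ t)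
    (h2 : (t : ℝ≥0∞) < jumpTime y (n + 1)) :
    z t = flow Λ h (t - (jumpTime y n).toNNReal) (z (jumpTime y n).toNNReal) := by
  have hn : jumpTime y n ≠ ⊤ := (h1.trans_lt ENNReal.coe_lt_top).ne
  refine Subtype.ext ?_
  rw [hz.eq, filterPath_eq h1 h2, coe_flow hz.rate, hz.level_eq, hz.eq,
    filterPath_jumpTime hz.rate hz.fix hz.init_nonneg hz.step hn,
    flowCurve_eq hz.rate (filterAtJump_mem_face hz.rate hz.fix hz.init_nonneg hz.step n hn)
      (NNReal.coe_nonneg _)]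

theorem apply_zero : (z 0 : I → ℝ) = opH h νfix (y 0) μ := by
  rw [hz.eq]
  exact filterPath_jumpTime hz.rate hz.fix hz.init_nonneg hz.step (n := 0) ENNReal.zero_ne_top

theorem eq_postJump {n : ℕ} (hn : jumpTime y (n + 1) ≠ ⊤) :
    z (jumpTime y (n + 1)).toNNReal = postJump Λ h νfix (y (jumpTime y (n + 1)).toNNReal)
      (flow Λ h ((jumpTime y (n + 1)).toNNReal - (jumpTime y n).toNNReal)
        (z (jumpTime y n).toNNReal)) := by
  have hn' : jumpTime y n ≠ ⊤ := ne_top_of_le_ne_top hn (jumpTime_le_succ y n)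
  refine Subtype.ext ?_
  rw [coe_postJump hz.rate hz.fix, coe_flow hz.rate, hz.level_eq, hz.eq, hz.eq,
    filterPath_jumpTime hz.rate hz.fix hz.init_nonneg hz.step hn,
    filterPath_jumpTime hz.rate hz.fix hz.init_nonneg hz.step hn', filterAtJump,
    flowCurve_eq hz.rate (filterAtJump_mem_face hz.rate hz.fix hz.init_nonneg hz.step n hn')
      (NNReal.coe_nonneg _)]
  rw [level_flow hz.rate, hz.level_eq]
  exact hz.step.apply_jumpTime_succ_ne hn

/-- Between two jump times the path is given by a continuous function. -/
theorem exists_continuous (n : ℕ) : ∃ g : ℝ≥0 → effSimplex h, Continuous g ∧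
    ∀ t : ℝ≥0, jumpTime y n ≤ t → (t : ℝ≥0∞) < jumpTime y (n + 1) → z t = g t :=
  ⟨fun t => flow Λ h (t - (jumpTime y n).toNNReal) (z (jumpTime y n).toNNReal),
    (continuous_flow hz.rate).comp
      (f := fun t : ℝ≥0 => (t - (jumpTime y n).toNNReal, z (jumpTime y n).toNNReal))
      ((continuous_id.sub continuous_const).prodMk continuous_const),
    fun _ h1 h2 => hz.eq_flow h1 h2⟩

omit hz in
theorem eventually_lt {c : ℝ≥0∞} {t : ℝ≥0} (ht : (t : ℝ≥0∞) < c) :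
    ∀ᶠ s : ℝ≥0 in 𝓝 t, (s : ℝ≥0∞) < c :=
  (ENNReal.continuous_coe.tendsto t).eventually (gt_mem_nhds ht)

omit hz in
theorem eventually_gt {c : ℝ≥0∞} {t : ℝ≥0} (ht : c < t) :
    ∀ᶠ s : ℝ≥0 in 𝓝 t, c < (s : ℝ≥0∞) :=
  (ENNReal.continuous_coe.tendsto t).eventually (lt_mem_nhds ht)

theorem isCadlag : IsCadlag z := by
  constructor
  · intro t
    obtain ⟨n, h1, h2⟩ := hz.step.exists_jumpTime_mem t
    obtain ⟨g, hg, hzg⟩ := hz.exists_continuous n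
    refine hg.continuousWithinAt.congr_of_eventuallyEq ?_ (hzg t h1 h2)
    filter_upwards [self_mem_nhdsWithin, mem_nhdsWithin_of_mem_nhds (eventually_lt h2)]
      with s hs1 hs2
    exact hzg s (h1.trans (ENNReal.coe_le_coe.2 hs1)) hs2
  · intro t ht
    obtain ⟨n, h1, h2⟩ : ∃ n, jumpTime y n < t ∧ (t : ℝ≥0∞) ≤ jumpTime y (n + 1) := by
      obtain ⟨n, h1, h2⟩ := hz.step.exists_jumpTime_mem t
      rcases h1.lt_or_eq with h | h
      · exact ⟨n, h, h2.le⟩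
      · rcases n with _ | k
        · exact absurd h (ENNReal.coe_pos.2 ht).ne
        · refine ⟨k, h ▸ hz.step.jumpTime_lt_succ ?_, h.ge⟩
          exact ne_top_of_le_ne_top ENNReal.coe_ne_top ((jumpTime_le_succ y k).trans h.le)
    obtain ⟨g, hg, hzg⟩ := hz.exists_continuous n
    refine ⟨g t, (hg.continuousWithinAt (s := Iio t)).tendsto.congr' ?_⟩
    filter_upwards [self_mem_nhdsWithin, mem_nhdsWithin_of_mem_nhds (eventually_gt h1)]
      with s hs1 hs2
    exact (hzg s hs2.le ((ENNReal.coe_lt_coe.2 hs1).trans_le h2)).symm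

theorem not_continuousAt_iff (t : ℝ≥0) :
    ¬ ContinuousAt z t ↔ ∃ n, 1 ≤ n ∧ jumpTime y n = t := by
  constructor
  · intro hnc
    obtain ⟨n, h1, h2⟩ := hz.step.exists_jumpTime_mem t
    obtain ⟨g, hg, hzg⟩ := hz.exists_continuous n
    have key : (∀ᶠ s : ℝ≥0 in 𝓝 t, jumpTime y n ≤ s) → False := fun hev => hnc <| by
      refine hg.continuousAt.congr ?_
      filter_upwards [hev, eventually_lt h2] with s hs1 hs2
      exact (hzg s hs1 hs2).symm
    refine ⟨n, Nat.one_le_iff_ne_zero.2 fun h0 => ?_, by_contra fun hne => ?_⟩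
    · subst h0
      exact key (Eventually.of_forall fun s => zero_le)
    · exact key ((eventually_gt (h1.lt_of_ne hne)).mono fun s hs => hs.le)
  · rintro ⟨n, hn, ht⟩ hc
    obtain ⟨k, rfl⟩ := Nat.exists_eq_succ_of_ne_zero (Nat.one_le_iff_ne_zero.1 hn)
    have hk : jumpTime y (k + 1) ≠ ⊤ := ht ▸ ENNReal.coe_ne_top
    have hlt : jumpTime y k < t :=
      ht ▸ hz.step.jumpTime_lt_succ (ne_top_of_le_ne_top hk (jumpTime_le_succ y k))
    have hlt' : (jumpTime y k).toNNReal < t :=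
      ENNReal.toNNReal_lt_of_lt_coe hlt
    have hev : ∀ᶠ s in 𝓝[<] t, level (z s) = level (z t) :=
      mem_nhdsWithin_of_mem_nhds (hc.eventually (eventually_level_eq (z t)))
    have : (𝓝[<] t).NeBot := nhdsLT_neBot_of_exists_lt ⟨_, hlt'⟩
    obtain ⟨s, ⟨hs1, hs2⟩, hs3⟩ := ((hev.and self_mem_nhdsWithin).and
      (mem_nhdsWithin_of_mem_nhds (eventually_gt hlt))).exists
    rw [hz.level_eq, hz.level_eq, eq_of_lt_jumpTime_succ (n := k) (le_of_lt hs3)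
      (by rw [ht]; exact ENNReal.coe_lt_coe.2 hs2)] at hs1
    have := hz.step.apply_jumpTime_succ_ne hk
    rw [Nat.succ_eq_add_one] at ht
    rw [ht, ENNReal.toNNReal_coe] at this
    exact this hs1.symm

end IsFilterPath

end FilterPath

/-! ### Optional sampling and the martingales of a Markov chain -/

/-- The number of the cell of the grid `ℕ / (m + 1)` that contains `q`. -/
def gridCell (m : ℕ) (q : ℝ≥0) : ℕ := ⌊((m : ℝ≥0) + 1) * q⌋₊

/-- The points of the grid `ℕ / (m + 1)`. -/
def gridPoint (m j : ℕ) : ℝ≥0 := j / ((m : ℝ≥0) + 1)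

/-- The first point of the grid `ℕ / (m + 1)` strictly to the right of `q`. -/
def gridAbove (m : ℕ) (q : ℝ≥0) : ℝ≥0 := gridPoint m (gridCell m q + 1)

theorem measurable_gridCell (m : ℕ) : Measurable (gridCell m) :=
  Nat.measurable_floor.comp (measurable_const.mul measurable_id)

theorem gridCell_eq_iff {m j : ℕ} {q : ℝ≥0} :
    gridCell m q = j ↔ gridPoint m j ≤ q ∧ q < gridPoint m (j + 1) := by
  rw [gridCell, Nat.floor_eq_iff zero_le, gridPoint, gridPoint, div_le_iff₀ (by positivity),
    lt_div_iff₀ (by positivity), mul_comm q, Nat.cast_add, Nat.cast_one]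

theorem gridPoint_mono (m : ℕ) : Monotone (gridPoint m) := fun i j hij => by
  unfold gridPoint
  gcongr

theorem lt_gridAbove (m : ℕ) (q : ℝ≥0) : q < gridAbove m q := (gridCell_eq_iff.1 rfl).2

theorem gridAbove_le (m : ℕ) (q : ℝ≥0) : gridAbove m q ≤ q + 1 / ((m : ℝ≥0) + 1) := by
  have h1 : gridPoint m (gridCell m q) ≤ q := (gridCell_eq_iff.1 rfl).1
  have h2 : gridAbove m q = gridPoint m (gridCell m q) + 1 / ((m : ℝ≥0) + 1) := by
    rw [gridAbove, gridPoint, gridPoint, Nat.cast_add, Nat.cast_one, add_div]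
  rw [h2]
  gcongr

theorem tendsto_gridAbove (q : ℝ≥0) : Tendsto (fun m => gridAbove m q) atTop (𝓝 q) := by
  refine tendsto_of_tendsto_of_tendsto_of_le_of_le tendsto_const_nhds ?_
    (fun m => (lt_gridAbove m q).le) (fun m => gridAbove_le m q)
  have : Tendsto (fun m : ℕ => 1 / ((m : ℝ≥0) + 1)) atTop (𝓝 0) := by
    rw [← NNReal.tendsto_coe]
    simpa using tendsto_one_div_add_atTop_nhds_zero_nat (𝕜 := ℝ)
  simpa using tendsto_const_nhds.add this

theorem measurable_gridAbove_apply {Ω β : Type*} [MeasurableSpace Ω] [MeasurableSpace β]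
    {Z : ℝ≥0 → Ω → β} (hZ : ∀ t, Measurable (Z t)) (m : ℕ) :
    Measurable fun p : ℝ≥0 × Ω => Z (gridAbove m p.1) p.2 := by
  have h1 : Measurable fun p : ℕ × Ω => Z (gridPoint m (p.1 + 1)) p.2 :=
    measurable_from_prod_countable_right fun j => hZ (gridPoint m (j + 1))
  have h2 : Measurable fun p : ℝ≥0 × Ω => (gridCell m p.1, p.2) :=
    ((measurable_gridCell m).comp measurable_fst).prodMk measurable_snd
  exact h1.comp h2

section OptionalSampling

variable {Ω : Type*} [mΩ : MeasurableSpace Ω] {P : Measure Ω} [IsFiniteMeasure P]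
  {F : ℝ≥0 → MeasurableSpace Ω}

/-- Optional sampling for a bounded right-continuous martingale on `[0, K]`, on an event `A` on
which the random time `ρ` is less than `K`. The proof approximates `ρ` from above by grid
points; only `A ∩ {ρ < t} ∈ F t` is needed. -/
theorem setIntegral_optional_sampling (hF : ∀ t, F t ≤ mΩ) (hFmono : Monotone F)
    {N : ℝ≥0 → Ω → ℝ} {K : ℝ≥0} (hN : ∀ t, Measurable (N t)) {C : ℝ}
    (hC : ∀ t ≤ K, ∀ ω, |N t ω| ≤ C)
    (hrc : ∀ ω t, ContinuousWithinAt (fun s => N s ω) (Ici t) t)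
    (hmart : ∀ t ≤ K, ∀ A, MeasurableSet[F t] A → ∫ ω in A, N t ω ∂P = ∫ ω in A, N K ω ∂P)
    {ρ : Ω → ℝ≥0∞} (hρ : Measurable ρ) {A : Set Ω}
    (hA : ∀ t : ℝ≥0, MeasurableSet[F t] (A ∩ {ω | ρ ω < t})) (hAρ : ∀ ω ∈ A, ρ ω < K) :
    ∫ ω in A, N (ρ ω).toNNReal ω ∂P = ∫ ω in A, N K ω ∂P := by
  have hAm : MeasurableSet A := by
    have : A ∩ {ω | ρ ω < K} = A := inter_eq_left.2 hAρ
    have h2 := hA K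
    rw [this] at h2
    exact hF K _ h2
  set k : ℕ → Ω → ℕ := fun m ω => gridCell m (ρ ω).toNNReal with hk
  have hkm : ∀ m, Measurable (k m) := fun m =>
    (measurable_gridCell m).comp hρ.ennreal_toNNReal
  set r : ℕ → Ω → ℝ≥0 := fun m ω => min K (gridAbove m (ρ ω).toNNReal) with hr
  have hNr : ∀ m, Measurable fun ω => N (r m ω) ω := fun m => by
    have h1 : Measurable fun p : ℝ≥0 × Ω => N (min K (gridAbove m p.1)) p.2 :=
      measurable_gridAbove_apply (Z := fun t => N (min K t)) (fun t => hN (min K t)) m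
    have h2 : Measurable fun ω => ((ρ ω).toNNReal, ω) := hρ.ennreal_toNNReal.prodMk measurable_id
    have h3 := h1.comp h2
    simp only [hr]
    exact h3
  have hbound : ∀ m ω, ‖N (r m ω) ω‖ ≤ C := fun m ω => hC _ (min_le_left _ _) ω
  have hint : ∀ m, Integrable (fun ω => N (r m ω) ω) P := fun m =>
    Integrable.of_bound (hNr m).aestronglyMeasurable C (Eventually.of_forall (hbound m))
  have hintK : Integrable (N K) P :=
    Integrable.of_bound (hN K).aestronglyMeasurable C (Eventually.of_forall (hC K le_rfl))
  -- on each cell of the grid the approximating time is constant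
  have hgrid : ∀ m, ∫ ω in A, N (r m ω) ω ∂P = ∫ ω in A, N K ω ∂P := by
    intro m
    set B : ℕ → Set Ω := fun j => A ∩ {ω | k m ω = j} with hB
    have hBm : ∀ j, MeasurableSet (B j) := fun j =>
      hAm.inter (hkm m (measurableSet_singleton j))
    have hdisj : Pairwise (Function.onFun Disjoint B) := fun i j hij =>
      Set.disjoint_left.2 fun ω h1 h2 => hij (h1.2.symm.trans h2.2)
    have hU : A = ⋃ j, B j := by ext ω; simp [hB]
    have hBF : ∀ j : ℕ, MeasurableSet[F (min K (gridPoint m (j + 1)))] (B j) := by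
      intro j
      have hle : min K (gridPoint m j) ≤ min K (gridPoint m (j + 1)) := by
        exact min_le_min_left _ (gridPoint_mono m j.le_succ)
      have heq : B j = (A ∩ {ω | ρ ω < (min K (gridPoint m (j + 1)) : ℝ≥0)}) \
          (A ∩ {ω | ρ ω < (min K (gridPoint m j) : ℝ≥0)}) := by
        ext ω
        simp only [hB, mem_inter_iff, Set.mem_sdiff, mem_ofPred_eq, hk]
        by_cases hω : ω ∈ A
        · have hK := hAρ ω hω
          lift ρ ω to ℝ≥0 using (hK.trans ENNReal.coe_lt_top).ne with q
          have hK' : q < K := ENNReal.coe_lt_coe.1 hK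
          simp only [hω, true_and, ENNReal.toNNReal_coe, ENNReal.coe_lt_coe, lt_min_iff, hK',
            not_lt]
          rw [gridCell_eq_iff, and_comm]
        · simp [hω]
      rw [heq]
      exact (hA _).diff (hFmono hle _ (hA _))
    rw [hU, integral_iUnion hBm hdisj (hint m).integrableOn,
      integral_iUnion hBm hdisj hintK.integrableOn]
    refine tsum_congr fun j => ?_
    rw [← hmart _ (min_le_left _ _) _ (hBF j)]
    refine setIntegral_congr_fun (hBm j) fun ω hω => ?_
    have : k m ω = j := hω.2
    simp only [hr, gridAbove, ← this, hk]
  have hlim : Tendsto (fun m => ∫ ω in A, N (r m ω) ω ∂P) atTop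
      (𝓝 (∫ ω in A, N (ρ ω).toNNReal ω ∂P)) := by
    refine tendsto_integral_of_dominated_convergence (fun _ => C)
      (fun m => (hNr m).aestronglyMeasurable) (integrable_const C)
      (fun m => Eventually.of_forall (hbound m)) ?_
    filter_upwards [ae_restrict_mem hAm] with ω hω
    have hK := hAρ ω hω
    have hK' : (ρ ω).toNNReal < K := ENNReal.toNNReal_lt_of_lt_coe hK
    refine (hrc ω _).tendsto.comp (tendsto_nhdsWithin_iff.2 ⟨?_, Eventually.of_forall fun m => ?_⟩)
    · have := (tendsto_const_nhds (x := K)).min (tendsto_gridAbove (ρ ω).toNNReal)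
      rwa [min_eq_right hK'.le] at this
    · exact le_min hK'.le (lt_gridAbove m _).le
  simp only [hgrid] at hlim
  exact tendsto_nhds_unique hlim tendsto_const_nhds

end OptionalSampling

section MarkovStep

variable {Ω I : Type*} [mΩ : MeasurableSpace Ω] [MeasurableSpace I]
  [DiscreteMeasurableSpace I] {X : ℝ≥0 → Ω → I}

theorem naturalSigma_mono : Monotone (naturalSigma X) := fun _ _ hst =>
  biSup_mono fun _ hr => le_trans hr hst

theorem naturalSigma_le (hX : ∀ t, Measurable (X t)) (t : ℝ≥0) : naturalSigma X t ≤ mΩ :=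
  iSup₂_le fun s _ => (hX s).comap_le

theorem measurableSet_naturalSigma {s t : ℝ≥0} (hst : s ≤ t) (B : Set I) :
    MeasurableSet[naturalSigma X t] {ω | X s ω ∈ B} :=
  (le_iSup₂ (f := fun s (_ : s ∈ Iic t) => MeasurableSpace.comap (X s) inferInstance) s hst) _
    ⟨B, MeasurableSet.of_discrete, rfl⟩

variable [Fintype I]

/-- A process with right-continuous step paths is jointly measurable. -/
theorem measurable_uncurry_step (hX : ∀ t, Measurable (X t))
    (hstep : ∀ ω, IsStepPath fun t => X t ω) :
    Measurable fun p : ℝ≥0 × Ω => X p.1 p.2 := by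
  let _ : TopologicalSpace I := ⊥
  have : DiscreteTopology I := ⟨rfl⟩
  refine measurable_of_tendsto_metrizable (f := fun (m : ℕ) (p : ℝ≥0 × Ω) =>
    X (gridAbove m p.1) p.2) (measurable_gridAbove_apply hX) (tendsto_pi_nhds.2 fun p => ?_)
  refine tendsto_nhds_of_eventually_eq ?_
  have : Tendsto (fun m => gridAbove m p.1) atTop (𝓝[≥] p.1) :=
    tendsto_nhdsWithin_iff.2 ⟨tendsto_gridAbove p.1,
      Eventually.of_forall fun m => (lt_gridAbove m p.1).le⟩
  exact this.eventually ((hstep p.2).right p.1)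

/-- `X` is, under `P`, a Markov process with generator `Λ` for its natural filtration, and all its
paths are step paths. -/
structure IsMarkovStep [DecidableEq I] (P : Measure Ω) (X : ℝ≥0 → Ω → I) (Λ : Matrix I I ℝ) :
    Prop where
  measurable : ∀ t, Measurable (X t)
  step : ∀ ω, IsStepPath fun t => X t ω
  markov : ∀ (t s : ℝ≥0) (f : I → ℝ),
    P[fun ω => f (X (t + s) ω) | naturalSigma X t] =ᵐ[P]
      fun ω => (NormedSpace.exp ((s : ℝ) • Λ) *ᵥ f) (X t ω)

variable [DecidableEq I] {P : Measure Ω} [IsProbabilityMeasure P] {Λ : Matrix I I ℝ}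

theorem integrable_comp_discrete (f : I → ℝ) {Z : Ω → I} (hZ : Measurable Z) :
    Integrable (fun ω => f (Z ω)) P := by
  obtain ⟨C, hC⟩ := (finite_range fun i => ‖f i‖).bddAbove
  exact Integrable.of_bound ((measurable_of_finite f).comp hZ).aestronglyMeasurable C
    (Eventually.of_forall fun ω => hC ⟨_, rfl⟩)

theorem setIntegral_comp_discrete (f : I → ℝ) {Z : Ω → I} (hZ : Measurable Z) (A : Set Ω) :
    ∫ ω in A, f (Z ω) ∂P = (fun i => P.real (A ∩ {ω | Z ω = i})) ⬝ᵥ f := by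
  have h1 : ∀ ω, f (Z ω) = ∑ i, {ω | Z ω = i}.indicator (fun _ => f i) ω := fun ω => by
    simp [indicator_apply]
  have hm : ∀ i, MeasurableSet {ω | Z ω = i} := fun i => hZ (measurableSet_singleton i)
  simp only [h1]
  rw [integral_finsetSum _ fun i _ => ((integrable_const _).indicator (hm i))]
  refine Finset.sum_congr rfl fun i _ => ?_
  rw [setIntegral_indicator (hm i), setIntegral_const, smul_eq_mul]

namespace IsMarkovStep

variable (hX : IsMarkovStep P X Λ)
include hX

theorem setIntegral_shift {t : ℝ≥0} {A : Set Ω} (hA : MeasurableSet[naturalSigma X t] A)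
    (s : ℝ≥0) (f : I → ℝ) :
    ∫ ω in A, f (X (t + s) ω) ∂P =
      ((fun i => P.real (A ∩ {ω | X t ω = i})) ᵥ* NormedSpace.exp ((s : ℝ) • Λ)) ⬝ᵥ f := by
  have hle := naturalSigma_le hX.measurable t
  rw [← setIntegral_condExp hle (integrable_comp_discrete f (hX.measurable _)) hA,
    setIntegral_congr_ae (hle _ hA) ((hX.markov t s f).mono fun ω hω _ => hω),
    setIntegral_comp_discrete _ (hX.measurable t), Matrix.dotProduct_mulVec]

theorem measurable_uncurry : Measurable fun p : ℝ≥0 × Ω => X p.1 p.2 :=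
  measurable_uncurry_step hX.measurable hX.step

theorem measurable_at {τ : Ω → ℝ≥0} (hτ : Measurable τ) : Measurable fun ω => X (τ ω) ω :=
  hX.measurable_uncurry.comp (hτ.prodMk measurable_id)

theorem measurable_real_uncurry (g : I → ℝ) :
    Measurable fun p : ℝ × Ω => g (X p.1.toNNReal p.2) :=
  (measurable_of_finite g).comp (hX.measurable_uncurry.comp
    ((measurable_real_toNNReal.comp measurable_fst).prodMk measurable_snd))

theorem intervalIntegrable (g : I → ℝ) (ω : Ω) (a b : ℝ) :
    IntervalIntegrable (fun s : ℝ => g (X s.toNNReal ω)) volume a b := by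
  obtain ⟨C, hC⟩ := (finite_range fun i => ‖g i‖).bddAbove
  refine (intervalIntegrable_const (c := C)).mono_fun
    ((hX.measurable_real_uncurry g).comp
      (measurable_id.prodMk measurable_const)).aestronglyMeasurable
    (Eventually.of_forall fun s => (hC ⟨_, rfl⟩).trans (le_abs_self C))

/-- Under the generator `Λ`, the process `f(X_t) - ∫₀ᵗ (Λf)(X_s) ds` is a martingale. -/
theorem setIntegral_martingale (f : I → ℝ) {s t : ℝ≥0} (hst : s ≤ t) {A : Set Ω}
    (hA : MeasurableSet[naturalSigma X s] A) :
    ∫ ω in A, (f (X s ω) - ∫ r in (0 : ℝ)..s, (Λ *ᵥ f) (X r.toNNReal ω)) ∂P =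
      ∫ ω in A, (f (X t ω) - ∫ r in (0 : ℝ)..t, (Λ *ᵥ f) (X r.toNNReal ω)) ∂P := by
  obtain ⟨d, rfl⟩ := exists_add_of_le hst
  set g := Λ *ᵥ f with hg
  have hAm := naturalSigma_le hX.measurable s _ hA
  set c : I → ℝ := fun i => P.real (A ∩ {ω | X s ω = i}) with hc
  have hgm := hX.measurable_real_uncurry g
  obtain ⟨C, hC⟩ := (finite_range fun i => ‖g i‖).bddAbove
  have hint : ∀ a b : ℝ, Integrable (Function.uncurry fun (ω : Ω) (r : ℝ) => g (X r.toNNReal ω))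
      ((P.restrict A).prod (volume.restrict (Ioc a b))) := fun a b =>
    Integrable.of_bound (hgm.comp measurable_swap).aestronglyMeasurable C
      (Eventually.of_forall fun p => hC ⟨_, rfl⟩)
  have hintP : ∀ a b : ℝ, a ≤ b → Integrable (fun ω => ∫ r in a..b, g (X r.toNNReal ω))
      (P.restrict A) := fun a b hab => by
    simp only [intervalIntegral.integral_of_le hab]
    exact (hint a b).integral_prod_left
  have hsd : (s : ℝ) ≤ (s + d : ℝ≥0) := NNReal.coe_le_coe.2 hst
  -- the increment of the integral, by Fubini's theorem and the Markov property
  have hfub : ∫ ω in A, (∫ r in (s : ℝ)..(s + d : ℝ≥0), g (X r.toNNReal ω)) ∂P =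
      ∫ r in (0 : ℝ)..d, (c ᵥ* NormedSpace.exp (r • Λ)) ⬝ᵥ g := by
    have hswap := integral_integral_swap (hint (s : ℝ) (s + d : ℝ≥0))
    simp only [intervalIntegral.integral_of_le hsd]
    rw [hswap, ← intervalIntegral.integral_of_le hsd]
    have hshift := intervalIntegral.integral_comp_add_left (a := 0) (b := (d : ℝ))
      (fun r : ℝ => ∫ ω in A, g (X r.toNNReal ω) ∂P) (s : ℝ)
    rw [add_zero, ← NNReal.coe_add] at hshift
    rw [← hshift]
    refine intervalIntegral.integral_congr fun r hr => ?_
    rw [uIcc_of_le (NNReal.coe_nonneg d)] at hr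
    have hr' : ((s : ℝ) + r).toNNReal = s + r.toNNReal := by
      rw [Real.toNNReal_add (NNReal.coe_nonneg s) hr.1, Real.toNNReal_coe]
    have := hX.setIntegral_shift hA r.toNNReal g
    rw [Real.coe_toNNReal r hr.1] at this
    simp only [hr', this, hc]
  have hder : ∀ r : ℝ, HasDerivAt (fun r : ℝ => (c ᵥ* NormedSpace.exp (r • Λ)) ⬝ᵥ f)
      ((c ᵥ* NormedSpace.exp (r • Λ)) ⬝ᵥ g) r := fun r => by
    rw [hg, Matrix.dotProduct_mulVec]
    exact HasDerivAt.fun_sum fun i _ =>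
      ((hasDerivAt_pi.1 (hasDerivAt_vecMul_exp Λ c r)) i).mul_const (f i)
  have hftc := intervalIntegral.integral_eq_sub_of_hasDerivAt (a := 0) (b := (d : ℝ))
    (fun r _ => hder r) (Continuous.intervalIntegrable (by
      refine Continuous.dotProduct (Continuous.matrix_vecMul continuous_const
        (continuous_matrixExp Λ)) continuous_const) _ _)
  have hfX : ∀ t, Integrable (fun ω => f (X t ω)) (P.restrict A) := fun t =>
    (integrable_comp_discrete f (hX.measurable t)).integrableOn
  rw [integral_sub (hfX s) (hintP 0 s (NNReal.coe_nonneg _)),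
    integral_sub (hfX (s + d)) (hintP 0 (s + d : ℝ≥0) (NNReal.coe_nonneg _)),
    hX.setIntegral_shift hA d f, setIntegral_comp_discrete f (hX.measurable s)]
  have hsplit : ∫ ω in A, (∫ r in (0 : ℝ)..(s + d : ℝ≥0), g (X r.toNNReal ω)) ∂P =
      ∫ ω in A, (∫ r in (0 : ℝ)..s, g (X r.toNNReal ω)) ∂P +
        ∫ ω in A, (∫ r in (s : ℝ)..(s + d : ℝ≥0), g (X r.toNNReal ω)) ∂P := by
    rw [← integral_add (hintP _ _ (NNReal.coe_nonneg s)) (hintP _ _ hsd)]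
    congr 1 with ω
    exact (intervalIntegral.integral_add_adjacent_intervals (hX.intervalIntegrable _ _ _ _)
      (hX.intervalIntegrable _ _ _ _)).symm
  rw [hsplit, hfub, hftc]
  simp only [zero_smul, NormedSpace.exp_zero, Matrix.vecMul_one]
  ring

end IsMarkovStep

end MarkovStep

/-! ### The past of a random time -/

section Past

variable {Ω : Type*} [mΩ : MeasurableSpace Ω] {F : ℝ≥0 → MeasurableSpace Ω}

/-- `A` belongs to the `σ`-algebra `F_{ρ+}` of the past of the random time `ρ`, restricted to
`{ρ < ∞}`: the event `A ∩ {ρ < t}` is known at time `t`, for every `t`. -/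
def IsPast (F : ℝ≥0 → MeasurableSpace Ω) (ρ : Ω → ℝ≥0∞) (A : Set Ω) : Prop :=
  ∀ t : ℝ≥0, MeasurableSet[F t] (A ∩ {ω | ρ ω < t})

/-- The events in the past of `ρ` form a `σ`-algebra if `{ρ < t}` is known at time `t`. -/
@[reducible]
def pastSigma (F : ℝ≥0 → MeasurableSpace Ω) (ρ : Ω → ℝ≥0∞) (hρ : IsPast F ρ univ) :
    MeasurableSpace Ω where
  MeasurableSet' := IsPast F ρ
  measurableSet_empty t := by simp
  measurableSet_compl A hA t := by
    have : Aᶜ ∩ {ω | ρ ω < t} = (univ ∩ {ω | ρ ω < t}) \ (A ∩ {ω | ρ ω < t}) := by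
      ext ω; simp; tauto
    rw [this]
    exact (hρ t).diff (hA t)
  measurableSet_iUnion A hA t := by
    rw [iUnion_inter]
    exact MeasurableSet.iUnion fun n => hA n t

variable {I : Type*} [MeasurableSpace I] [DiscreteMeasurableSpace I] {X : ℝ≥0 → Ω → I}
  {ρ : Ω → ℝ≥0∞} {A : Set Ω}

/-- The value of a right-continuous step process at a random time belongs to the past of that
time: it is read off from the values at the points of a countable dense set just after it. -/
theorem IsPast.inter_value (hstep : ∀ ω, IsStepPath fun t => X t ω)
    (hA : IsPast (naturalSigma X) ρ A) (B : Set I) :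
    IsPast (naturalSigma X) ρ (A ∩ {ω | X (ρ ω).toNNReal ω ∈ B}) := by
  intro t
  obtain ⟨S, hSc, hSd⟩ := TopologicalSpace.exists_countable_dense ℝ≥0
  have heq : A ∩ {ω | X (ρ ω).toNNReal ω ∈ B} ∩ {ω | ρ ω < t} =
      ⋃ r ∈ S ∩ Iio t, ((A ∩ {ω | ρ ω < r}) \
        ⋃ q ∈ S ∩ Iio r, (A ∩ {ω | ρ ω < q}) ∩ {ω | X q ω ∈ B}ᶜ) := by
    ext ω
    simp only [mem_inter_iff, mem_ofPred_eq, mem_iUnion, Set.mem_sdiff, mem_compl_iff, exists_prop,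
      mem_Iio, not_exists, not_and, not_not]
    constructor
    · rintro ⟨⟨hωA, hB⟩, hlt⟩
      lift ρ ω to ℝ≥0 using (hlt.trans ENNReal.coe_lt_top).ne with q₀
      rw [ENNReal.coe_lt_coe] at hlt
      rw [ENNReal.toNNReal_coe] at hB
      obtain ⟨u, hu, hXu⟩ := (hstep ω).exists_Ico q₀
      obtain ⟨r, hrS, hr1, hr2⟩ := hSd.exists_between (lt_min hlt hu)
      refine ⟨r, ⟨hrS, hr2.trans_le (min_le_left _ _)⟩, ⟨hωA, ENNReal.coe_lt_coe.2 hr1⟩, ?_⟩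
      rintro q ⟨-, hq⟩ ⟨-, hq'⟩
      rw [hXu q (ENNReal.coe_lt_coe.1 hq').le (hq.trans (hr2.trans_le (min_le_right _ _)))]
      exact hB
    · rintro ⟨r, ⟨hrS, hrt⟩, ⟨hωA, hρr⟩, hall⟩
      lift ρ ω to ℝ≥0 using (hρr.trans ENNReal.coe_lt_top).ne with q₀
      rw [ENNReal.coe_lt_coe] at hρr ⊢
      obtain ⟨u, hu, hXu⟩ := (hstep ω).exists_Ico q₀
      obtain ⟨q, hqS, hq1, hq2⟩ := hSd.exists_between (lt_min hρr hu)
      refine ⟨⟨hωA, ?_⟩, hρr.trans hrt⟩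
      rw [ENNReal.toNNReal_coe, ← hXu q hq1.le (hq2.trans_le (min_le_right _ _))]
      exact hall q ⟨hqS, hq2.trans_le (min_le_left _ _)⟩ ⟨hωA, ENNReal.coe_lt_coe.2 hq1⟩
  rw [heq]
  refine MeasurableSet.biUnion (hSc.mono inter_subset_left) fun r hr => ?_
  refine naturalSigma_mono hr.2.le _ ((hA r).diff ?_)
  refine MeasurableSet.biUnion (hSc.mono inter_subset_left) fun q hq => ?_
  exact naturalSigma_mono hq.2.le _
    ((hA q).inter (measurableSet_naturalSigma le_rfl B).compl)

variable {O : Type*} [Finite O] {h : I → O}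

/-- The jump times of the observation `Y = h(X)`. -/
def obsTime (X : ℝ≥0 → Ω → I) (h : I → O) (n : ℕ) (ω : Ω) : ℝ≥0∞ :=
  jumpTime (fun t => h (X t ω)) n

/-- The signal at the jump times of the observation (with the value at time `0` if there is no
such jump). -/
def signalAt (X : ℝ≥0 → Ω → I) (h : I → O) (n : ℕ) (ω : Ω) : I :=
  X (obsTime X h n ω).toNNReal ω

/-- The information carried by the first `n` jump times of the observation and the values of the
observation at these times and at time `0`. -/
@[reducible]
def obsSigma (X : ℝ≥0 → Ω → I) (h : I → O) : ℕ → MeasurableSpace Ω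
  | 0 => MeasurableSpace.comap (fun ω => h (signalAt X h 0 ω)) ⊤
  | n + 1 => obsSigma X h n ⊔ MeasurableSpace.comap (obsTime X h (n + 1)) inferInstance ⊔
      MeasurableSpace.comap (fun ω => h (signalAt X h (n + 1) ω)) ⊤

theorem isPast_obsTime_succ (hstep : ∀ ω, IsStepPath fun t => X t ω) {n : ℕ}
    (hA : IsPast (naturalSigma X) (obsTime X h n) A) :
    IsPast (naturalSigma X) (obsTime X h (n + 1)) A := by
  intro t
  obtain ⟨S, hSc, hSd⟩ := TopologicalSpace.exists_countable_dense ℝ≥0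
  have heq : A ∩ {ω | obsTime X h (n + 1) ω < t} = ⋃ r ∈ S ∩ Iio t, ⋃ b : O,
      ((A ∩ {ω | X (obsTime X h n ω).toNNReal ω ∈ h ⁻¹' {b}}) ∩ {ω | obsTime X h n ω < r}) ∩
        {ω | X r ω ∈ (h ⁻¹' {b})ᶜ} := by
    ext ω
    simp only [mem_inter_iff, mem_ofPred_eq, mem_iUnion, exists_prop, mem_Iio, mem_preimage,
      mem_singleton_iff, mem_compl_iff]
    constructor
    · rintro ⟨hωA, hlt⟩
      obtain ⟨_, ⟨u, ⟨hu1, hu2⟩, rfl⟩, hut⟩ := sInf_lt_iff.1 hlt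
      obtain ⟨v, hv, hXv⟩ := (hstep ω).exists_Ico u
      obtain ⟨r, hrS, hr1, hr2⟩ := hSd.exists_between (lt_min (ENNReal.coe_lt_coe.1 hut) hv)
      refine ⟨r, ⟨hrS, hr2.trans_le (min_le_left _ _)⟩, _, ⟨⟨⟨hωA, rfl⟩,
        hu1.trans (ENNReal.coe_lt_coe.2 hr1)⟩, ?_⟩⟩
      rw [hXv r hr1.le (hr2.trans_le (min_le_right _ _))]
      exact hu2
    · rintro ⟨r, ⟨hrS, hrt⟩, b, ⟨⟨⟨hωA, hb⟩, hlt⟩, hne⟩⟩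
      have hmem : r ∈ {s : ℝ≥0 | jumpTime (fun t => h (X t ω)) n < s ∧ h (X s ω) ≠
          h (X (jumpTime (fun t => h (X t ω)) n).toNNReal ω)} :=
        ⟨hlt, fun he => hne (he.trans hb)⟩
      exact ⟨hωA, (sInf_le (mem_image_of_mem _ hmem)).trans_lt (ENNReal.coe_lt_coe.2 hrt)⟩
  rw [heq]
  refine MeasurableSet.biUnion (hSc.mono inter_subset_left) fun r hr => ?_
  refine naturalSigma_mono hr.2.le _ (MeasurableSet.iUnion fun b => ?_)
  exact (hA.inter_value hstep _ r).inter (measurableSet_naturalSigma le_rfl _)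

theorem isPast_obsTime_univ (hstep : ∀ ω, IsStepPath fun t => X t ω) :
    ∀ n, IsPast (naturalSigma X) (obsTime X h n) univ
  | 0 => fun t => by
    have : obsTime X h 0 = fun _ => 0 := rfl
    simp only [this, univ_inter]
    exact MeasurableSet.const _
  | n + 1 => isPast_obsTime_succ hstep (isPast_obsTime_univ hstep n)

theorem isPast_lt (hρ : IsPast (naturalSigma X) ρ univ) (c : ℝ≥0∞) :
    IsPast (naturalSigma X) ρ {ω | ρ ω < c} := by
  intro t
  rcases lt_or_ge c t with hc | hc
  · lift c to ℝ≥0 using (hc.trans ENNReal.coe_lt_top).ne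
    have : {ω | ρ ω < c} ∩ {ω | ρ ω < t} = univ ∩ {ω | ρ ω < c} := by
      ext ω
      simpa using fun hω => lt_trans hω hc
    rw [this]
    exact naturalSigma_mono (ENNReal.coe_lt_coe.1 hc).le _ (hρ c)
  · have : {ω | ρ ω < c} ∩ {ω | ρ ω < t} = univ ∩ {ω | ρ ω < t} := by
      ext ω
      simpa using fun hω => lt_of_lt_of_le hω hc
    rw [this]
    exact hρ t

/-- The observed information up to the `n`-th jump belongs to the past of the `n`-th jump time. -/
theorem isPast_of_obsSigma (hstep : ∀ ω, IsStepPath fun t => X t ω) (n : ℕ)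
    (hA : MeasurableSet[obsSigma X h n] A) : IsPast (naturalSigma X) (obsTime X h n) A := by
  suffices hle : ∀ n, obsSigma X h n ≤
      pastSigma (naturalSigma X) (obsTime X h n) (isPast_obsTime_univ hstep n) from hle n _ hA
  have hval : ∀ n, MeasurableSpace.comap (fun ω => h (signalAt X h n ω)) ⊤ ≤
      pastSigma (naturalSigma X) (obsTime X h n) (isPast_obsTime_univ hstep n) := by
    rintro n _ ⟨B, -, rfl⟩
    have := (isPast_obsTime_univ (h := h) hstep n).inter_value hstep (h ⁻¹' B)
    rwa [univ_inter] at this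
  intro n
  induction n with
  | zero => exact hval 0
  | succ n ih =>
    refine sup_le (sup_le (ih.trans fun A hA => isPast_obsTime_succ hstep hA) ?_) (hval (n + 1))
    refine Measurable.comap_le ?_
    exact measurable_of_Iio (mδ := pastSigma _ _ (isPast_obsTime_univ hstep (n + 1))) fun c =>
      isPast_lt (isPast_obsTime_univ hstep (n + 1)) c

theorem measurable_obsTime (hX : ∀ t, Measurable (X t)) (hstep : ∀ ω, IsStepPath fun t => X t ω)
    (n : ℕ) : Measurable (obsTime X h n) := by
  have hlt : ∀ t : ℝ≥0, MeasurableSet {ω | obsTime X h n ω < t} := fun t => by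
    have := naturalSigma_le hX t _ (isPast_obsTime_univ (h := h) hstep n t)
    rwa [univ_inter] at this
  refine measurable_of_Iio fun c => ?_
  rcases eq_or_ne c ⊤ with rfl | hc
  · have : obsTime X h n ⁻¹' Iio ⊤ = ⋃ k : ℕ, {ω | obsTime X h n ω < (k : ℝ≥0)} := by
      ext ω
      simp only [mem_preimage, mem_Iio, mem_iUnion, mem_ofPred_eq]
      refine ⟨fun hω => ?_, fun ⟨k, hk⟩ => hk.trans ENNReal.coe_lt_top⟩
      obtain ⟨k, hk⟩ := ENNReal.exists_nat_gt hω.ne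
      exact ⟨k, by simpa using hk⟩
    rw [this]
    exact MeasurableSet.iUnion fun k => hlt k
  · lift c to ℝ≥0 using hc
    exact hlt c

end Past

/-! ### Dynkin's formula -/

namespace IsMarkovStep

variable {Ω I : Type*} [mΩ : MeasurableSpace Ω] [Fintype I] [MeasurableSpace I]
  [DiscreteMeasurableSpace I] {X : ℝ≥0 → Ω → I} [DecidableEq I] {P : Measure Ω}
  [IsProbabilityMeasure P] {Λ : Matrix I I ℝ} (hX : IsMarkovStep P X Λ)
include hX

/-- Optional sampling for the martingale `f(X_t) - ∫₀ᵗ (Λf)(X_s) ds`. -/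
theorem setIntegral_martingale_stopped (f : I → ℝ) {K : ℝ≥0} {ρ : Ω → ℝ≥0∞} (hρ : Measurable ρ)
    {A : Set Ω} (hA : IsPast (naturalSigma X) ρ A) (hAρ : ∀ ω ∈ A, ρ ω < K) :
    ∫ ω in A, (f (X (ρ ω).toNNReal ω) -
        ∫ r in (0 : ℝ)..(ρ ω).toNNReal, (Λ *ᵥ f) (X r.toNNReal ω)) ∂P =
      ∫ ω in A, (f (X K ω) - ∫ r in (0 : ℝ)..K, (Λ *ᵥ f) (X r.toNNReal ω)) ∂P := by
  set g := Λ *ᵥ f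
  obtain ⟨Cf, hCf⟩ := (finite_range fun i => ‖f i‖).bddAbove
  obtain ⟨Cg, hCg⟩ := (finite_range fun i => ‖g i‖).bddAbove
  refine setIntegral_optional_sampling (N := fun t ω => f (X t ω) -
    ∫ r in (0 : ℝ)..t, g (X r.toNNReal ω)) (C := Cf + |Cg| * K) (naturalSigma_le hX.measurable)
    naturalSigma_mono (fun t => ?_) (fun t ht ω => ?_) (fun ω t => ?_)
    (fun t ht A hA => hX.setIntegral_martingale f ht hA) hρ hA hAρ
  · refine ((measurable_of_finite f).comp (hX.measurable t)).sub ?_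
    simp only [intervalIntegral.integral_of_le (NNReal.coe_nonneg t)]
    exact (StronglyMeasurable.integral_prod_right (f := fun ω (r : ℝ) => g (X r.toNNReal ω))
      ((hX.measurable_real_uncurry g).comp measurable_swap).stronglyMeasurable).measurable
  · refine (abs_sub _ _).trans (add_le_add (hCf ⟨_, rfl⟩) ?_)
    have := intervalIntegral.norm_integral_le_of_norm_le_const (a := 0) (b := (t : ℝ)) (C := |Cg|)
      (f := fun r : ℝ => g (X r.toNNReal ω))
      fun r _ => (hCg ⟨X r.toNNReal ω, rfl⟩).trans (le_abs_self Cg)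
    rw [sub_zero, abs_of_nonneg (NNReal.coe_nonneg t)] at this
    exact this.trans (mul_le_mul_of_nonneg_left (NNReal.coe_le_coe.2 ht) (abs_nonneg _))
  · refine ContinuousWithinAt.sub ?_ ?_
    · exact continuousWithinAt_const.congr_of_eventuallyEq
        (((hX.step ω).right t).mono fun s hs => congrArg f hs) rfl
    · have hc := intervalIntegral.continuous_primitive
        (f := fun r : ℝ => g (X r.toNNReal ω)) (fun a b => hX.intervalIntegrable g ω a b) 0
      exact (hc.comp NNReal.continuous_coe).continuousWithinAt

/-- Dynkin's formula between the random times `τ` and `min σ (τ + t)`. -/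
theorem dynkin (f : I → ℝ) {τ σ : Ω → ℝ≥0∞} (hτ : Measurable τ) (hσ : Measurable σ)
    (hτσ : ∀ ω, τ ω ≤ σ ω) {A : Set Ω} (hAm : MeasurableSet A) (hA : IsPast (naturalSigma X) τ A)
    (hA' : IsPast (naturalSigma X) σ A) {L : ℝ≥0} (hL : ∀ ω ∈ A, τ ω < L) (t : ℝ≥0) :
    ∫ ω in A, f (X (min (σ ω) (τ ω + t)).toNNReal ω) ∂P =
      ∫ ω in A, f (X (τ ω).toNNReal ω) ∂P +
        ∫ s in (0 : ℝ)..t, ∫ ω in A, {ω | τ ω + s.toNNReal < σ ω}.indicator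
          (fun ω => (Λ *ᵥ f) (X ((τ ω).toNNReal + s.toNNReal) ω)) ω ∂P := by
  set g := Λ *ᵥ f with hg
  obtain ⟨C, hC⟩ := (finite_range fun i => ‖g i‖).bddAbove
  set ρ : Ω → ℝ≥0∞ := fun ω => min (σ ω) (τ ω + t) with hρdef
  have hρ : Measurable ρ := hσ.min (hτ.add_const _)
  have hAρ : IsPast (naturalSigma X) ρ A := by
    intro u
    have heq : A ∩ {ω | ρ ω < u} = (A ∩ {ω | σ ω < u}) ∪ (A ∩ {ω | τ ω < (u - t : ℝ≥0)}) := by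
      rw [← inter_union_distrib_left]
      congr 1
      ext ω
      simp only [hρdef, mem_ofPred_eq, mem_union, min_lt_iff, ENNReal.coe_sub, lt_tsub_iff_right]
    rw [heq]
    exact (hA' u).union (naturalSigma_mono tsub_le_self _ (hA (u - t)))
  have hL1 : ∀ ω ∈ A, τ ω < (L + t : ℝ≥0) := fun ω hω =>
    (hL ω hω).trans_le (ENNReal.coe_le_coe.2 le_self_add)
  have hL2 : ∀ ω ∈ A, ρ ω < (L + t : ℝ≥0) := fun ω hω => by
    rw [ENNReal.coe_add]
    exact (min_le_right _ _).trans_lt (ENNReal.add_lt_add_right ENNReal.coe_ne_top (hL ω hω))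
  have hbetween := (hX.setIntegral_martingale_stopped f hρ hAρ hL2).trans
    (hX.setIntegral_martingale_stopped f hτ hA hL1).symm
  -- integrability of the terms
  have hfi : ∀ {θ : Ω → ℝ≥0∞}, Measurable θ →
      Integrable (fun ω => f (X (θ ω).toNNReal ω)) (P.restrict A) := fun hθ =>
    (integrable_comp_discrete f (hX.measurable_at hθ.ennreal_toNNReal)).integrableOn
  have hmeas : Measurable fun p : Ω × ℝ => {p : Ω × ℝ | τ p.1 + p.2.toNNReal < σ p.1}.indicator
      (fun p => g (X ((τ p.1).toNNReal + p.2.toNNReal) p.1)) p := by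
    have h1 : Measurable fun p : Ω × ℝ => ((τ p.1).toNNReal + p.2.toNNReal, p.1) :=
      ((hτ.comp measurable_fst).ennreal_toNNReal.add
        (measurable_real_toNNReal.comp measurable_snd)).prodMk measurable_fst
    refine ((measurable_of_finite g).comp (hX.measurable_uncurry.comp h1)).indicator ?_
    exact measurableSet_lt ((hτ.comp measurable_fst).add
      (measurable_real_toNNReal.comp measurable_snd).coe_nnreal_ennreal) (hσ.comp measurable_fst)
  have hint : Integrable (Function.uncurry fun (ω : Ω) (s : ℝ) =>
      {ω | τ ω + s.toNNReal < σ ω}.indicator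
        (fun ω => g (X ((τ ω).toNNReal + s.toNNReal) ω)) ω)
      ((P.restrict A).prod (volume.restrict (Ioc 0 (t : ℝ)))) := by
    refine Integrable.of_bound hmeas.aestronglyMeasurable C (Eventually.of_forall fun p => ?_)
    exact (norm_indicator_le_norm_self (fun ω => g (X ((τ ω).toNNReal + p.2.toNNReal) ω)) p.1).trans
      (hC ⟨_, rfl⟩)
  -- the pathwise identity for the increments of the integral
  have hpath : ∀ ω ∈ A, (∫ r in (0 : ℝ)..(ρ ω).toNNReal, g (X r.toNNReal ω)) -
      (∫ r in (0 : ℝ)..(τ ω).toNNReal, g (X r.toNNReal ω)) =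
      ∫ s in Ioc 0 (t : ℝ), {ω | τ ω + s.toNNReal < σ ω}.indicator
        (fun ω => g (X ((τ ω).toNNReal + s.toNNReal) ω)) ω := by
    intro ω hω
    have hτtop : τ ω ≠ ⊤ := ((hL ω hω).trans ENNReal.coe_lt_top).ne
    have hρtop : ρ ω ≠ ⊤ := ((hL2 ω hω).trans ENNReal.coe_lt_top).ne
    have hle : (τ ω).toNNReal ≤ (ρ ω).toNNReal :=
      ENNReal.toNNReal_mono hρtop (le_min (hτσ ω) le_self_add)
    obtain ⟨d, hd⟩ := exists_add_of_le hle
    rw [intervalIntegral.integral_interval_sub_left (hX.intervalIntegrable _ _ _ _)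
      (hX.intervalIntegrable _ _ _ _)]
    have hshift := intervalIntegral.integral_comp_add_left (a := 0) (b := (d : ℝ))
      (fun r : ℝ => g (X r.toNNReal ω)) ((τ ω).toNNReal : ℝ)
    rw [add_zero, ← NNReal.coe_add, ← hd] at hshift
    rw [← hshift, intervalIntegral.integral_of_le (NNReal.coe_nonneg d)]
    -- up to the endpoint, `s ≤ d` means that `τ + s` comes before `σ` and not after `τ + t`
    have hmin : ∀ s : ℝ, 0 < s → ((s < d → s ≤ t ∧ τ ω + s.toNNReal < σ ω) ∧
        (s ≤ t → τ ω + s.toNNReal < σ ω → s ≤ d)) := by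
      intro s hs
      have hρd : ρ ω = τ ω + d := by
        rw [← ENNReal.coe_toNNReal hρtop, hd, ENNReal.coe_add, ENNReal.coe_toNNReal hτtop]
      constructor
      · intro hsd
        have h1 : τ ω + s.toNNReal < ρ ω := by
          rw [hρd]
          exact ENNReal.add_lt_add_left hτtop
            (ENNReal.coe_lt_coe.2 ((Real.toNNReal_lt_iff_lt_coe hs.le).2 hsd))
        refine ⟨?_, h1.trans_le (min_le_left _ _)⟩
        have h2 := h1.trans_le (min_le_right _ _)
        rw [ENNReal.add_lt_add_iff_left hτtop, ENNReal.coe_lt_coe,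
          Real.toNNReal_lt_iff_lt_coe hs.le] at h2
        exact h2.le
      · intro hst hsσ
        have h1 : τ ω + s.toNNReal ≤ ρ ω := by
          refine le_min hsσ.le ?_
          gcongr
          exact Real.toNNReal_le_iff_le_coe.2 hst
        rw [hρd, ENNReal.add_le_add_iff_left hτtop, ENNReal.coe_le_coe,
          Real.toNNReal_le_iff_le_coe] at h1
        exact h1
    have hS : MeasurableSet {s : ℝ | τ ω + s.toNNReal < σ ω} :=
      measurableSet_lt (measurable_const.add measurable_real_toNNReal.coe_nnreal_ennreal)
        measurable_const
    have hind : ∀ s : ℝ, {ω | τ ω + s.toNNReal < σ ω}.indicator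
        (fun ω => g (X ((τ ω).toNNReal + s.toNNReal) ω)) ω =
        {s : ℝ | τ ω + s.toNNReal < σ ω}.indicator
          (fun s => g (X ((τ ω).toNNReal + s.toNNReal) ω)) s := fun s => by
      simp only [indicator_apply, mem_ofPred_eq]
    simp only [hind]
    rw [setIntegral_indicator hS]
    have hae : (Ioc 0 (t : ℝ) ∩ {s : ℝ | τ ω + s.toNNReal < σ ω} : Set ℝ) =ᵐ[volume]
        Ioc 0 (d : ℝ) := by
      have h1 : (Ioc 0 (t : ℝ) ∩ {s : ℝ | τ ω + s.toNNReal < σ ω} : Set ℝ) ⊆ Ioc 0 (d : ℝ) :=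
        fun s hs => ⟨hs.1.1, (hmin s hs.1.1).2 hs.1.2 hs.2⟩
      have h2 : Ioo 0 (d : ℝ) ⊆ (Ioc 0 (t : ℝ) ∩ {s : ℝ | τ ω + s.toNNReal < σ ω} : Set ℝ) :=
        fun s hs => ⟨⟨hs.1, ((hmin s hs.1).1 hs.2).1⟩, ((hmin s hs.1).1 hs.2).2⟩
      exact (LE.le.eventuallyLE h1).antisymm
        (Ioo_ae_eq_Ioc.symm.le.trans (LE.le.eventuallyLE h2))
    rw [setIntegral_congr_set hae]
    refine setIntegral_congr_fun measurableSet_Ioc fun s hs => ?_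
    rw [Real.toNNReal_add (NNReal.coe_nonneg _) hs.1.le, Real.toNNReal_coe]
  have hbddint : ∀ {θ : Ω → ℝ≥0∞}, Measurable θ → (∀ ω ∈ A, θ ω < (L + t : ℝ≥0)) →
      Integrable (fun ω => ∫ r in (0 : ℝ)..(θ ω).toNNReal, g (X r.toNNReal ω))
        (P.restrict A) := by
    intro θ hθ hθL
    refine Integrable.of_bound ?_ (|C| * (L + t : ℝ≥0)) ?_
    · refine Measurable.aestronglyMeasurable ?_
      have : ∀ ω, ∫ r in (0 : ℝ)..(θ ω).toNNReal, g (X r.toNNReal ω) =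
          ∫ r, {p : Ω × ℝ | p.2 ∈ Ioc 0 ((θ p.1).toNNReal : ℝ)}.indicator
            (fun p => g (X p.2.toNNReal p.1)) (ω, r) := fun ω => by
        rw [intervalIntegral.integral_of_le (NNReal.coe_nonneg _),
          ← integral_indicator measurableSet_Ioc]
        rfl
      simp only [this]
      refine (StronglyMeasurable.integral_prod_right (f := fun ω r =>
        {p : Ω × ℝ | p.2 ∈ Ioc 0 ((θ p.1).toNNReal : ℝ)}.indicator
            (fun p => g (X p.2.toNNReal p.1)) (ω, r)) ?_).measurable
      refine Measurable.stronglyMeasurable (Measurable.indicator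
        ((hX.measurable_real_uncurry g).comp measurable_swap) ?_)
      exact (measurableSet_lt measurable_const measurable_snd).inter (measurableSet_le
        measurable_snd (hθ.comp measurable_fst).ennreal_toNNReal.coe_nnreal_real)
    · filter_upwards [ae_restrict_mem hAm] with ω hω
      have := intervalIntegral.norm_integral_le_of_norm_le_const (a := 0)
        (b := ((θ ω).toNNReal : ℝ)) (C := |C|) (f := fun r : ℝ => g (X r.toNNReal ω))
        fun r _ => (hC ⟨X r.toNNReal ω, rfl⟩).trans (le_abs_self C)
      rw [sub_zero, abs_of_nonneg (NNReal.coe_nonneg _)] at this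
      refine this.trans (mul_le_mul_of_nonneg_left (NNReal.coe_le_coe.2 ?_) (abs_nonneg _))
      exact (ENNReal.toNNReal_lt_of_lt_coe (hθL ω hω)).le
  rw [integral_sub (hfi hρ) (hbddint hρ hL2), integral_sub (hfi hτ) (hbddint hτ hL1)] at hbetween
  have hdiff : ∫ ω in A, (∫ r in (0 : ℝ)..(ρ ω).toNNReal, g (X r.toNNReal ω)) ∂P -
      ∫ ω in A, (∫ r in (0 : ℝ)..(τ ω).toNNReal, g (X r.toNNReal ω)) ∂P =
      ∫ s in (0 : ℝ)..t, ∫ ω in A, {ω | τ ω + s.toNNReal < σ ω}.indicator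
          (fun ω => g (X ((τ ω).toNNReal + s.toNNReal) ω)) ω ∂P := by
    rw [← integral_sub (hbddint hρ hL2) (hbddint hτ hL1),
      setIntegral_congr_fun hAm hpath, integral_integral_swap hint,
      intervalIntegral.integral_of_le (NNReal.coe_nonneg t)]
  linarith

end IsMarkovStep

/-! ### The law of the next jump of the observation -/

namespace IsMarkovStep

variable {Ω I O : Type*} [mΩ : MeasurableSpace Ω] [Fintype I] [MeasurableSpace I]
  [DiscreteMeasurableSpace I] {X : ℝ≥0 → Ω → I} [DecidableEq I] {P : Measure Ω}
  [IsProbabilityMeasure P] {Λ : Matrix I I ℝ} [Finite O] [DecidableEq O] {h : I → O}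

/-- The joint law, on the event `A`, of no jump of the observation in the time `s` after its `n`-th
jump and the position of the signal at the end of this time. -/
def survivalLaw (P : Measure Ω) (X : ℝ≥0 → Ω → I) (h : I → O) (n : ℕ) (A : Set Ω) (s : ℝ≥0)
    (j : I) : ℝ :=
  P.real (A ∩ {ω | obsTime X h n ω + s < obsTime X h (n + 1) ω} ∩
    {ω | X ((obsTime X h n ω).toNNReal + s) ω = j})

variable (hX : IsMarkovStep P X Λ)
include hX

theorem isStepPath_obs (ω : Ω) : IsStepPath fun t => h (X t ω) := (hX.step ω).comp h

theorem measurable_obsTime (n : ℕ) : Measurable (obsTime X h n) :=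
  FilterPDP.measurable_obsTime hX.measurable hX.step n

theorem measurable_signalAt (n : ℕ) : Measurable (signalAt X h n) :=
  hX.measurable_at (hX.measurable_obsTime n).ennreal_toNNReal

theorem measurableSet_survival (n : ℕ) (s : ℝ≥0) :
    MeasurableSet {ω | obsTime X h n ω + s < obsTime X h (n + 1) ω} :=
  measurableSet_lt ((hX.measurable_obsTime n).add_const _) (hX.measurable_obsTime (n + 1))

theorem measurable_after (n : ℕ) (s : ℝ≥0) :
    Measurable fun ω => X ((obsTime X h n ω).toNNReal + s) ω :=
  hX.measurable_at ((hX.measurable_obsTime n).ennreal_toNNReal.add_const s)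

theorem measurable_survivalLaw {A : Set Ω} (hA : MeasurableSet A) (n : ℕ) (j : I) :
    Measurable fun s : ℝ => survivalLaw P X h n A s.toNNReal j := by
  have h1 : Measurable fun p : Ω × ℝ => ((obsTime X h n p.1).toNNReal + p.2.toNNReal, p.1) :=
    (((hX.measurable_obsTime n).comp measurable_fst).ennreal_toNNReal.add
      (measurable_real_toNNReal.comp measurable_snd)).prodMk measurable_fst
  have hE : MeasurableSet {p : Ω × ℝ | (p.1 ∈ A ∧ obsTime X h n p.1 + p.2.toNNReal <
      obsTime X h (n + 1) p.1) ∧ X ((obsTime X h n p.1).toNNReal + p.2.toNNReal) p.1 = j} := by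
    refine ((measurable_fst hA).inter (measurableSet_lt (((hX.measurable_obsTime n).comp
      measurable_fst).add (measurable_real_toNNReal.comp measurable_snd).coe_nnreal_ennreal)
      ((hX.measurable_obsTime (n + 1)).comp measurable_fst))).inter ?_
    exact (hX.measurable_uncurry.comp h1) (measurableSet_singleton j)
  exact (measurable_measure_prodMk_right hE).ennreal_toReal

/-- Dynkin's formula between a jump of the observation and the minimum of the next jump and a
fixed time later. -/
theorem dynkin_obs (n : ℕ) {A : Set Ω} (hAm : MeasurableSet A)
    (hA : IsPast (naturalSigma X) (obsTime X h n) A) {L : ℝ≥0}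
    (hL : ∀ ω ∈ A, obsTime X h n ω < L) (t : ℝ≥0) (f : I → ℝ) :
    ∫ ω in A, f (X (min (obsTime X h (n + 1) ω) (obsTime X h n ω + t)).toNNReal ω) ∂P =
      (fun i => P.real (A ∩ {ω | signalAt X h n ω = i})) ⬝ᵥ f +
        ∫ s in (0 : ℝ)..t, (survivalLaw P X h n A s.toNNReal ᵥ* Λ) ⬝ᵥ f := by
  rw [hX.dynkin f (hX.measurable_obsTime n) (hX.measurable_obsTime (n + 1))
    (fun ω => jumpTime_le_succ _ n) hAm hA (isPast_obsTime_succ hX.step hA) hL t]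
  congr 1
  · exact setIntegral_comp_discrete f (hX.measurable_signalAt n) A
  · refine intervalIntegral.integral_congr fun s _ => ?_
    rw [setIntegral_indicator (hX.measurableSet_survival n _),
      setIntegral_comp_discrete _ (hX.measurable_after n _), Matrix.dotProduct_mulVec]
    rfl

variable {n : ℕ} {a : O} {A : Set Ω} (hAm : MeasurableSet A)
  (hA : IsPast (naturalSigma X) (obsTime X h n) A) (hAa : ∀ ω ∈ A, h (signalAt X h n ω) = a)
  {L : ℝ≥0} (hL : ∀ ω ∈ A, obsTime X h n ω < L)

omit [MeasurableSpace I] [DiscreteMeasurableSpace I] [Finite O] [IsProbabilityMeasure P] hX in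
theorem apply_after_eq {ω : Ω} (hω : obsTime X h n ω ≠ ⊤) {s : ℝ≥0}
    (hs : obsTime X h n ω + s < obsTime X h (n + 1) ω) :
    h (X ((obsTime X h n ω).toNNReal + s) ω) = h (signalAt X h n ω) := by
  have hcoe : (((obsTime X h n ω).toNNReal + s : ℝ≥0) : ℝ≥0∞) = obsTime X h n ω + s := by
    rw [ENNReal.coe_add, ENNReal.coe_toNNReal hω]
  refine eq_of_lt_jumpTime_succ (y := fun t => h (X t ω)) (n := n) ?_ ?_
  · rw [hcoe]; exact le_self_add
  · rw [hcoe]; exact hs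

omit [MeasurableSpace I] [DiscreteMeasurableSpace I] [Finite O] [IsProbabilityMeasure P] hX in
include hAa in
theorem measureReal_signalAt_eq_zero {j : I} (hj : h j ≠ a) :
    P.real (A ∩ {ω | signalAt X h n ω = j}) = 0 := by
  have : A ∩ {ω | signalAt X h n ω = j} = ∅ := by
    refine eq_empty_of_forall_notMem fun ω ⟨h1, h2⟩ => hj ?_
    rw [← hAa ω h1, show signalAt X h n ω = j from h2]
  rw [this, measureReal_empty]

include hAa hL

theorem survivalLaw_eq_zero {s : ℝ≥0} {j : I} (hj : h j ≠ a) :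
    survivalLaw P X h n A s j = 0 := by
  have : A ∩ {ω | obsTime X h n ω + s < obsTime X h (n + 1) ω} ∩
      {ω | X ((obsTime X h n ω).toNNReal + s) ω = j} = ∅ := by
    refine eq_empty_of_forall_notMem fun ω ⟨⟨hωA, h1⟩, h2⟩ => hj ?_
    have := apply_after_eq ((hL ω hωA).trans ENNReal.coe_lt_top).ne h1
    rwa [show X ((obsTime X h n ω).toNNReal + s) ω = j from h2, hAa ω hωA] at this
  rw [survivalLaw, this, measureReal_empty]

include hAm hA

/-- Until the next jump of the observation, the law of the signal solves the linear equation with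
the killed rate matrix. -/
theorem survivalLaw_eq_unnorm (t : ℝ≥0) :
    survivalLaw P X h n A t =
      unnorm Λ h a (fun i => P.real (A ∩ {ω | signalAt X h n ω = i})) t := by
  set c : I → ℝ := fun i => P.real (A ∩ {ω | signalAt X h n ω = i}) with hc
  set U : ℝ → I → ℝ := fun s => survivalLaw P X h n A s.toNNReal with hU
  -- Dynkin's formula for the indicator of `i`: at the next jump of the observation, the signal
  -- leaves the level set, so this function vanishes there
  have hUi : ∀ i, h i = a → ∀ t : ℝ≥0, U t i = c i + ∫ s in (0 : ℝ)..t, (U s ᵥ* Λ) i := by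
    intro i hi t
    have hd := hX.dynkin_obs n hAm hA hL t (Pi.single i 1)
    simp only [dotProduct_single_one] at hd
    rw [← hd]
    have hpt : ∀ ω ∈ A, (Pi.single i (1 : ℝ) : I → ℝ)
        (X (min (obsTime X h (n + 1) ω) (obsTime X h n ω + t)).toNNReal ω) =
        ({ω | obsTime X h n ω + t < obsTime X h (n + 1) ω} ∩
          {ω | X ((obsTime X h n ω).toNNReal + t) ω = i}).indicator (fun _ => (1 : ℝ)) ω := by
      intro ω hω
      have hfin : obsTime X h n ω ≠ ⊤ := ((hL ω hω).trans ENNReal.coe_lt_top).ne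
      by_cases hlt : obsTime X h n ω + t < obsTime X h (n + 1) ω
      · rw [min_eq_right hlt.le, ENNReal.toNNReal_add hfin ENNReal.coe_ne_top,
          ENNReal.toNNReal_coe]
        simp [indicator_apply, hlt, Pi.single_apply]
      · rw [indicator_of_notMem (fun hmem => hlt hmem.1), min_eq_left (not_lt.1 hlt)]
        have hfin' : obsTime X h (n + 1) ω ≠ ⊤ :=
          ne_top_of_le_ne_top (ENNReal.add_ne_top.2 ⟨hfin, ENNReal.coe_ne_top⟩) (not_lt.1 hlt)
        have hne := (hX.isStepPath_obs (h := h) ω).apply_jumpTime_succ_ne hfin'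
        refine Pi.single_eq_of_ne (fun he => hne ?_) _
        have h1 := hAa ω hω
        unfold obsTime at he
        rw [he, hi]
        exact h1.symm
    have hms : MeasurableSet ({ω | obsTime X h n ω + t < obsTime X h (n + 1) ω} ∩
        {ω | X ((obsTime X h n ω).toNNReal + t) ω = i}) :=
      (hX.measurableSet_survival n t).inter
        (hX.measurable_after n t (measurableSet_singleton i))
    rw [setIntegral_congr_fun hAm hpt, setIntegral_indicator hms, setIntegral_const, smul_eq_mul,
      mul_one, hU]
    simp only [Real.toNNReal_coe, survivalLaw, inter_assoc]
  have hUz : ∀ s i, h i ≠ a → U s i = 0 := fun s i hi =>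
    hX.survivalLaw_eq_zero hAa hL hi
  have hint : ∀ i, ∀ r s : ℝ, IntervalIntegrable (fun s => (U s ᵥ* Λ) i) volume r s := by
    intro i r s
    have heq : (fun s => (U s ᵥ* Λ) i) = ∑ j, fun s => U s j * Λ j i := by
      ext s
      simp [Matrix.vecMul, dotProduct]
    rw [heq]
    refine IntervalIntegrable.sum _ fun j _ => IntervalIntegrable.mul_const ?_ _
    refine (intervalIntegrable_const (c := (1 : ℝ))).mono_fun
      (hX.measurable_survivalLaw hAm n j).aestronglyMeasurable (Eventually.of_forall fun s => ?_)
    have h0 : 0 ≤ U s j := measureReal_nonneg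
    have h1 : U s j ≤ 1 := measureReal_le_one
    simpa [abs_of_nonneg h0] using h1
  have hcz : ∀ i, h i ≠ a → c i = 0 := fun i hi => measureReal_signalAt_eq_zero hAa hi
  -- the integral equation makes `U` continuous, and hence differentiable
  have hUcont : Continuous U := by
    refine continuous_pi fun i => ?_
    by_cases hi : h i = a
    · have heq : (fun s => U s i) = fun s : ℝ =>
          c i + ∫ r in (0 : ℝ)..(s.toNNReal : ℝ), (U r ᵥ* Λ) i := by
        ext s
        rw [← hUi i hi s.toNNReal]
        simp only [hU, Real.toNNReal_coe]
      rw [heq]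
      exact continuous_const.add ((intervalIntegral.continuous_primitive (hint i) 0).comp
        (NNReal.continuous_coe.comp continuous_real_toNNReal))
    · simp only [hUz _ i hi]
      exact continuous_const
  have hderiv : ∀ t, 0 ≤ t → HasDerivWithinAt U (U t ᵥ* killed Λ h a) (Ici 0) t := by
    intro t ht
    rw [hasDerivWithinAt_pi]
    intro i
    rw [vecMul_killed (hUz t)]
    split_ifs with hi
    · have hcont : Continuous fun s => (U s ᵥ* Λ) i :=
        (continuous_apply i).comp (Continuous.matrix_vecMul hUcont continuous_const)
      have hprim : HasDerivAt (fun t => c i + ∫ s in (0 : ℝ)..t, (U s ᵥ* Λ) i)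
          ((U t ᵥ* Λ) i) t :=
        (intervalIntegral.integral_hasDerivAt_right (hint i 0 t)
          hcont.stronglyMeasurable.stronglyMeasurableAtFilter hcont.continuousAt).const_add (c i)
      exact hprim.hasDerivWithinAt.congr (fun s hs => hUi i hi ⟨s, hs⟩) (hUi i hi ⟨t, ht⟩)
    · simp only [hUz _ i hi]
      exact hasDerivWithinAt_const t _ _
  have hsol := linear_ode_solution (killed Λ h a) hderiv (NNReal.coe_nonneg t)
  have hU0 : U 0 = c := by
    ext i
    by_cases hi : h i = a
    · simpa using hUi i hi 0
    · rw [hUz 0 i hi, hcz i hi]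
  rw [hU0] at hsol
  rw [unnorm, ← hsol]
  simp [hU]

/-- The joint law of the next jump of the observation and the position of the signal after it. -/
theorem measureReal_next_jump (t : ℝ≥0) {j : I} (hj : h j ≠ a) :
    P.real (A ∩ {ω | obsTime X h (n + 1) ω ≤ obsTime X h n ω + t ∧ signalAt X h (n + 1) ω = j}) =
      ∫ s in (0 : ℝ)..t,
        (unnorm Λ h a (fun i => P.real (A ∩ {ω | signalAt X h n ω = i})) s ᵥ* Λ) j := by
  -- the signal is in `j`, outside the level set, only if the observation has jumped
  have hd := hX.dynkin_obs n hAm hA hL t (Pi.single j 1)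
  simp only [dotProduct_single_one] at hd
  have hcj := measureReal_signalAt_eq_zero (P := P) hAa hj
  have hpt : ∀ ω ∈ A, (Pi.single j (1 : ℝ) : I → ℝ)
      (X (min (obsTime X h (n + 1) ω) (obsTime X h n ω + t)).toNNReal ω) =
      {ω | obsTime X h (n + 1) ω ≤ obsTime X h n ω + t ∧
        signalAt X h (n + 1) ω = j}.indicator (fun _ => (1 : ℝ)) ω := by
    intro ω hω
    have hfin : obsTime X h n ω ≠ ⊤ := ((hL ω hω).trans ENNReal.coe_lt_top).ne
    by_cases hlt : obsTime X h n ω + t < obsTime X h (n + 1) ω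
    · rw [indicator_of_notMem (fun hmem => absurd hlt (not_lt.2 hmem.1)), min_eq_right hlt.le,
        ENNReal.toNNReal_add hfin ENNReal.coe_ne_top, ENNReal.toNNReal_coe]
      refine Pi.single_eq_of_ne (fun he => hj ?_) _
      rw [← he, apply_after_eq hfin hlt, hAa ω hω]
    · rw [min_eq_left (not_lt.1 hlt)]
      simp [indicator_apply, not_lt.1 hlt, Pi.single_apply, signalAt]
  have hms : MeasurableSet {ω | obsTime X h (n + 1) ω ≤ obsTime X h n ω + t ∧
      signalAt X h (n + 1) ω = j} :=
    (measurableSet_le (hX.measurable_obsTime (n + 1))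
      ((hX.measurable_obsTime n).add_const _)).inter
      (hX.measurable_signalAt (n + 1) (measurableSet_singleton j))
  rw [hcj, zero_add, setIntegral_congr_fun hAm hpt, setIntegral_indicator hms, setIntegral_const,
    smul_eq_mul, mul_one] at hd
  rw [hd]
  refine intervalIntegral.integral_congr fun s hs => ?_
  rw [uIcc_of_le (NNReal.coe_nonneg t)] at hs
  rw [hX.survivalLaw_eq_unnorm hAm hA hAa hL, Real.coe_toNNReal s hs.1]

end IsMarkovStep

/-! ### Exit rates of the signal from a level set -/

section ExitRate

variable {I O : Type*} [Fintype I] [DecidableEq I] [DecidableEq O] {Λ : Matrix I I ℝ} {h : I → O}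

/-- The rate at which the signal jumps to `j` outside the current level set, if its conditional law
is `x`. -/
def exitRate (Λ : Matrix I I ℝ) (h : I → O) (j : I) (x : effSimplex h) : ℝ :=
  if h j = level x then 0 else ((x : I → ℝ) ᵥ* Λ) j

theorem exitRate_nonneg (hΛ : IsRateMatrix Λ) (j : I) (x : effSimplex h) :
    0 ≤ exitRate Λ h j x := by
  unfold exitRate
  split_ifs with hj
  exacts [le_rfl, hΛ.vecMul_nonneg (mem_face_level x) hj]

theorem sum_exitRate (hΛ : IsRateMatrix Λ) (x : effSimplex h) :
    ∑ j, exitRate Λ h j x = jumpRate Λ h x := by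
  have hsum := hΛ.sum_vecMul (x : I → ℝ)
  have hterm : ∀ j, exitRate Λ h j x =
      ((x : I → ℝ) ᵥ* Λ) j - if h j = level x then ((x : I → ℝ) ᵥ* Λ) j else 0 := fun j => by
    unfold exitRate
    split_ifs <;> simp
  simp only [hterm]
  rw [Finset.sum_sub_distrib, hsum, zero_sub]
  rfl

variable [Fintype O]

theorem measurable_exitRate (j : I) : Measurable (exitRate Λ h j) := by
  refine measurable_of_index measurableSet_level_eq
    (g := fun a (x : effSimplex h) => if h j = a then 0 else ((x : I → ℝ) ᵥ* Λ) j) fun a => ?_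
  split_ifs
  exacts [measurable_const, ((continuous_apply j).comp continuous_vecMul_coe).measurable]

/-- The probability that the signal jumps to `j`, given that it leaves the current level set and
that its conditional law is `x` (zero if it cannot leave). -/
def exitProb (Λ : Matrix I I ℝ) (h : I → O) (j : I) (x : effSimplex h) : ℝ :=
  exitRate Λ h j x / jumpRate Λ h x

theorem exitProb_nonneg (hΛ : IsRateMatrix Λ) (j : I) (x : effSimplex h) :
    0 ≤ exitProb Λ h j x :=
  div_nonneg (exitRate_nonneg hΛ j x) (jumpRate_nonneg hΛ x)

theorem measurable_exitProb (j : I) : Measurable (exitProb Λ h j) :=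
  (measurable_exitRate j).div continuous_jumpRate.measurable

theorem jumpRate_mul_exitProb (hΛ : IsRateMatrix Λ) (j : I) (x : effSimplex h) :
    jumpRate Λ h x * exitProb Λ h j x = exitRate Λ h j x := by
  rcases eq_or_ne (jumpRate Λ h x) 0 with h0 | h0
  · have hs := sum_exitRate hΛ x
    rw [h0, Finset.sum_eq_zero_iff_of_nonneg fun i _ => exitRate_nonneg hΛ i x] at hs
    rw [h0, zero_mul, hs j (Finset.mem_univ j)]
  · exact mul_div_cancel₀ _ h0

/-- The conditional law after a jump to `b` averages to the law of the exit point. -/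
theorem sum_exitProb_mul_opH (hΛ : IsRateMatrix Λ) {νfix : O → I → ℝ} (x : effSimplex h) (i : I) :
    ∑ j, (if h j = h i then exitProb Λ h j x * opH h νfix (h i) ((x : I → ℝ) ᵥ* Λ) i else 0) =
      exitProb Λ h i x := by
  by_cases hi : h i = level x
  · have : ∀ j, (if h j = h i then
        exitProb Λ h j x * opH h νfix (h i) ((x : I → ℝ) ᵥ* Λ) i else 0) = 0 := fun j => by
      split_ifs with hj
      · rw [exitProb, exitRate, if_pos (hj.trans hi), zero_div, zero_mul]
      · rfl
    simp only [this, Finset.sum_const_zero]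
    rw [exitProb, exitRate, if_pos hi, zero_div]
  · have hnn : ∀ j, h j = h i → 0 ≤ ((x : I → ℝ) ᵥ* Λ) j := fun j hj =>
      hΛ.vecMul_nonneg (mem_face_level x) (hj ▸ hi)
    have hterm : ∀ j, (if h j = h i then
        exitProb Λ h j x * opH h νfix (h i) ((x : I → ℝ) ᵥ* Λ) i else 0) =
        (if h j = h i then ((x : I → ℝ) ᵥ* Λ) j else 0) *
          (opH h νfix (h i) ((x : I → ℝ) ᵥ* Λ) i / jumpRate Λ h x) := fun j => by
      split_ifs with hj
      · rw [exitProb, exitRate, if_neg (fun he => hi (hj ▸ he))]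
        ring
      · rw [zero_mul]
    simp only [hterm]
    rw [← Finset.sum_mul]
    change levelMass h (h i) ((x : I → ℝ) ᵥ* Λ) * _ = _
    rw [exitProb, exitRate, if_neg hi, opH]
    split_ifs with h0
    · have hz : ((x : I → ℝ) ᵥ* Λ) i = 0 := by
        rw [levelMass, Finset.sum_eq_zero_iff_of_nonneg fun j _ => by
          split_ifs with hj
          exacts [hnn j hj, le_rfl]] at h0
        simpa using h0 i (Finset.mem_univ i)
      rw [h0, hz, zero_mul, zero_div]
    · simp only [if_true]
      field_simp

theorem transMeasure_eq_sum_exitProb (hΛ : IsRateMatrix Λ) {νfix : O → I → ℝ}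
    (hνfix : ∀ a, νfix a ∈ face h a) (qfix : O → O → ℝ) {x : effSimplex h}
    (hx : jumpRate Λ h x ≠ 0) {A : Set (effSimplex h)} (hA : MeasurableSet A) :
    transMeasure Λ h νfix qfix x A = ∑ j, ENNReal.ofReal (exitProb Λ h j x) *
      A.indicator 1 (postJump Λ h νfix (h j) x) := by
  have hx' : levelMass h (level x) ((x : I → ℝ) ᵥ* Λ) ≠ 0 := fun h0 => hx (by simp [jumpRate, h0])
  rw [transMeasure_apply x hA, ← Finset.sum_fiberwise Finset.univ h]
  refine Finset.sum_congr rfl fun b _ => ?_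
  have hfib : ∑ j with h j = b, ENNReal.ofReal (exitProb Λ h j x) *
      A.indicator 1 (postJump Λ h νfix (h j) x) =
      ENNReal.ofReal (∑ j with h j = b, exitProb Λ h j x) *
        A.indicator 1 (postJump Λ h νfix b x) := by
    rw [ENNReal.ofReal_sum_of_nonneg fun j _ => exitProb_nonneg hΛ j x, Finset.sum_mul]
    refine Finset.sum_congr rfl fun j hj => ?_
    rw [(Finset.mem_filter.1 hj).2]
  rw [hfib]
  by_cases hb : b = level x
  · have h1 : jumpProb Λ h qfix x b = 0 := by rw [jumpProb, if_neg hx', if_pos hb]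
    have h2 : ∑ j with h j = b, exitProb Λ h j x = 0 := Finset.sum_eq_zero fun j hj => by
      rw [exitProb, exitRate, if_pos ((Finset.mem_filter.1 hj).2.trans hb), zero_div]
    rw [h1, h2, ENNReal.ofReal_zero, zero_mul, zero_mul]
  · have h1 : jumpProb Λ h qfix x b = ∑ j with h j = b, exitProb Λ h j x := by
      rw [jumpProb, if_neg hx', if_neg hb, levelMass, Finset.sum_filter]
      change _ / jumpRate Λ h x = _
      rw [Finset.sum_div]
      refine Finset.sum_congr rfl fun j _ => ?_
      split_ifs with hj
      · rw [exitProb, exitRate, if_neg (fun he => hb (hj ▸ he))]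
      · exact zero_div _
    rw [h1]
    rw [← coe_postJump hΛ hνfix hb]
    by_cases hm : postJump Λ h νfix b x ∈ A
    · rw [indicator_of_mem hm, indicator_of_mem (mem_image_of_mem _ hm)]
      rfl
    · rw [indicator_of_notMem hm, indicator_of_notMem]
      rwa [Subtype.val_injective.mem_set_image]

end ExitRate

/-! ### Disintegration with respect to a density -/

/-- If the law of `(π, S)` on the event `C` has, on rectangles, the density `p` with respect to the
product of the law of `π` and Lebesgue measure, then it has this density. -/
theorem lintegral_eq_lintegral_density {Ω Ω' : Type*} {mΩ : MeasurableSpace Ω}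
    {mΩ' : MeasurableSpace Ω'} {P : Measure Ω} [IsFiniteMeasure P] {π : Ω → Ω'}
    (hπ : Measurable π) {S : Ω → ℝ} (hS : Measurable S) {C : Set Ω}
    {p : Ω' × ℝ → ℝ≥0∞} (hp : Measurable p)
    (H : ∀ A : Set Ω', MeasurableSet A → ∀ t : ℝ,
      P (π ⁻¹' A ∩ {ω | S ω ≤ t} ∩ C) = ∫⁻ ω in π ⁻¹' A, ∫⁻ s in Iic t, p (π ω, s) ∂volume ∂P)
    {g : Ω' × ℝ → ℝ≥0∞} (hg : Measurable g) :
    ∫⁻ ω in C, g (π ω, S ω) ∂P = ∫⁻ ω, ∫⁻ s, p (π ω, s) * g (π ω, s) ∂volume ∂P := by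
  set M₁ : Measure (Ω' × ℝ) := (P.restrict C).map fun ω => (π ω, S ω) with hM₁
  set M₂ : Measure (Ω' × ℝ) := ((P.map π).prod volume).withDensity p with hM₂
  have hπS : Measurable fun ω => (π ω, S ω) := hπ.prodMk hS
  have hrect : ∀ A : Set Ω', MeasurableSet A → ∀ t : ℝ, M₁ (A ×ˢ Iic t) = M₂ (A ×ˢ Iic t) := by
    intro A hA t
    rw [hM₁, Measure.map_apply hπS (hA.prod measurableSet_Iic),
      Measure.restrict_apply (hπS (hA.prod measurableSet_Iic)), hM₂,
      withDensity_apply _ (hA.prod measurableSet_Iic), ← Measure.prod_restrict,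
      lintegral_prod _ hp.aemeasurable, setLIntegral_map hA hp.lintegral_prod_right' hπ]
    exact H A hA t
  have heq : M₁ = M₂ := by
    refine Measure.ext_prod fun {A B} hA hB => ?_
    have hms : MeasurableSet (A ×ˢ (univ : Set ℝ)) := hA.prod MeasurableSet.univ
    have hs : ∀ M : Measure (Ω' × ℝ), ∀ B : Set ℝ, MeasurableSet B →
        ((M.restrict (A ×ˢ univ)).map Prod.snd) B = M (A ×ˢ B) := fun M B hB => by
      rw [Measure.map_apply measurable_snd hB, Measure.restrict_apply (measurable_snd hB)]
      congr 1
      ext ⟨x, y⟩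
      simp [and_comm]
    have hext : (M₁.restrict (A ×ˢ univ)).map Prod.snd =
        (M₂.restrict (A ×ˢ univ)).map Prod.snd := by
      refine Measure.ext_of_Iic _ _ fun t => ?_
      rw [hs M₁ _ measurableSet_Iic, hs M₂ _ measurableSet_Iic, hrect A hA t]
    rw [← hs M₁ B hB, ← hs M₂ B hB, hext]
  have h1 : ∫⁻ ω in C, g (π ω, S ω) ∂P = ∫⁻ x, g x ∂M₁ := (lintegral_map hg hπS).symm
  rw [h1, heq, hM₂, lintegral_withDensity_eq_lintegral_mul _ hp hg,
    lintegral_prod _ (hp.mul hg).aemeasurable, lintegral_map (hp.mul hg).lintegral_prod_right' hπ]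
  rfl

/-- Two measures that agree on a sub-`σ`-algebra give the same integrals of the functions that are
measurable with respect to it. -/
theorem lintegral_eq_of_trim {Ω : Type*} {m mΩ : MeasurableSpace Ω} (hm : m ≤ mΩ)
    {μ₁ μ₂ : Measure Ω} (hμ : ∀ A, MeasurableSet[m] A → μ₁ A = μ₂ A) {g : Ω → ℝ≥0∞}
    (hg : Measurable[m] g) : ∫⁻ ω, g ω ∂μ₁ = ∫⁻ ω, g ω ∂μ₂ := by
  have : μ₁.trim hm = μ₂.trim hm := @Measure.ext _ m _ _ fun A hA => by
    rw [trim_measurableSet_eq hm hA, trim_measurableSet_eq hm hA, hμ A hA]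
  rw [← lintegral_trim hm hg, ← lintegral_trim hm hg, this]

/-! ### The filter at the jump times of the observation -/

section ObsSigma

variable {Ω I O : Type*} [mΩ : MeasurableSpace Ω] [MeasurableSpace I]
  [DiscreteMeasurableSpace I] {X : ℝ≥0 → Ω → I} {h : I → O}

/-- The information carried by the observation up to its `n`-th jump, and by the time of the next
jump. -/
@[reducible]
def obsSigmaNext (X : ℝ≥0 → Ω → I) (h : I → O) (n : ℕ) : MeasurableSpace Ω :=
  obsSigma X h n ⊔ MeasurableSpace.comap (obsTime X h (n + 1)) inferInstance

theorem obsSigma_le_next (n : ℕ) : obsSigma X h n ≤ obsSigmaNext X h n := le_sup_left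

theorem obsSigmaNext_le_succ (n : ℕ) : obsSigmaNext X h n ≤ obsSigma X h (n + 1) := le_sup_left

theorem obsSigma_mono : Monotone (obsSigma X h) :=
  monotone_nat_of_le_succ fun n => (obsSigma_le_next n).trans (obsSigmaNext_le_succ n)

theorem measurable_obsTime_next (n : ℕ) :
    Measurable[obsSigmaNext X h n] (obsTime X h (n + 1)) :=
  Measurable.mono (comap_measurable _) le_sup_right le_rfl

theorem measurable_obsTime_obsSigma (n : ℕ) : Measurable[obsSigma X h n] (obsTime X h n) := by
  cases n with
  | zero => exact measurable_const
  | succ n => exact (measurable_obsTime_next n).mono (obsSigmaNext_le_succ n) le_rfl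

theorem measurableSet_obs_eq (n : ℕ) (B : Set O) :
    MeasurableSet[obsSigma X h n] {ω | h (signalAt X h n ω) ∈ B} := by
  have : MeasurableSpace.comap (fun ω => h (signalAt X h n ω)) ⊤ ≤ obsSigma X h n := by
    cases n with
    | zero => exact le_rfl
    | succ n => exact le_sup_right
  exact this _ ⟨B, trivial, rfl⟩

end ObsSigma

section JumpDensity

variable {I O : Type*} [Fintype I] [DecidableEq I] [Fintype O] [DecidableEq O] {Λ : Matrix I I ℝ}
  {h : I → O}

theorem effSimplex_nonneg (x : effSimplex h) (i : I) : 0 ≤ (x : I → ℝ) i := (mem_face_level x).1.1 i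

theorem effSimplex_le_one (x : effSimplex h) (i : I) : (x : I → ℝ) i ≤ 1 := by
  have hx := (mem_face_level x).1
  rw [← hx.2]
  exact Finset.single_le_sum (f := fun i => (x : I → ℝ) i) (fun j _ => hx.1 j) (Finset.mem_univ i)

/-- The density of a jump at time `s` to `j`, when the filter starts in `x`, is the survival
probability times the exit rate along the flow. -/
theorem unnorm_vecMul_eq (hΛ : IsRateMatrix Λ) (x : effSimplex h) (s : ℝ≥0) {j : I}
    (hj : h j ≠ level x) : (unnorm Λ h (level x) x s ᵥ* Λ) j =
      (∑ i, unnorm Λ h (level x) x s i) * exitRate Λ h j (flow Λ h s x) := by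
  have hpos := (sum_unnorm_pos hΛ (mem_face_level x) (NNReal.coe_nonneg s)).ne'
  rw [exitRate, level_flow hΛ, if_neg hj, coe_flow hΛ, normFlow, Matrix.smul_vecMul, Pi.smul_apply,
    smul_eq_mul, mul_inv_cancel_left₀ hpos]

/-- The density of a jump after the time `s` to the point `j`, when the filter starts in `x`. -/
def jumpDensity (Λ : Matrix I I ℝ) (j : I) (x : effSimplex h) (s : ℝ) : ℝ :=
  (∑ i, unnorm Λ h (level x) x s i) * exitRate Λ h j (flow Λ h s.toNNReal x)

theorem jumpDensity_nonneg (hΛ : IsRateMatrix Λ) (j : I) (x : effSimplex h) {s : ℝ} (hs : 0 ≤ s) :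
    0 ≤ jumpDensity Λ j x s :=
  mul_nonneg (sum_unnorm_pos hΛ (mem_face_level x) hs).le (exitRate_nonneg hΛ j _)

theorem measurable_jumpDensity (hΛ : IsRateMatrix Λ) (j : I) :
    Measurable fun p : effSimplex h × ℝ => jumpDensity Λ j p.1 p.2 := by
  refine Measurable.mul ?_ ?_
  · refine measurable_of_index (l := fun p : effSimplex h × ℝ => level p.1)
      (g := fun a (p : effSimplex h × ℝ) => ∑ i, unnorm Λ h a p.1 p.2 i)
      (fun a => measurable_fst (measurableSet_level_eq a)) fun a => Continuous.measurable ?_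
    have hu : Continuous fun p : effSimplex h × ℝ => unnorm Λ h a p.1 p.2 :=
      continuous_unnorm.comp (f := fun p : effSimplex h × ℝ => (p.2, (p.1 : I → ℝ)))
        (by fun_prop)
    exact continuous_finsetSum _ fun i _ => (continuous_apply i).comp hu
  · exact (measurable_exitRate j).comp ((continuous_flow hΛ).measurable.comp
      ((measurable_real_toNNReal.comp measurable_snd).prodMk measurable_fst))

end JumpDensity

theorem measurable_flow_comp {Ω I O : Type*} {m : MeasurableSpace Ω} [Fintype I] [DecidableEq I]
    [Fintype O] [DecidableEq O] {Λ : Matrix I I ℝ} {h : I → O} (hΛ : IsRateMatrix Λ)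
    {S : Ω → ℝ≥0} (hS : Measurable S) {x : Ω → effSimplex h} (hx : Measurable x) :
    Measurable fun ω => flow Λ h (S ω) (x ω) :=
  (continuous_flow hΛ).measurable.comp (hS.prodMk hx)

theorem measurable_toNNReal_sub {Ω : Type*} {m : MeasurableSpace Ω} {S T : Ω → ℝ≥0∞}
    (hS : Measurable S) (hT : Measurable T) :
    Measurable fun ω => (S ω).toNNReal - (T ω).toNNReal :=
  hS.ennreal_toNNReal.sub hT.ennreal_toNNReal

section FilterProcess

variable {Ω I O : Type*} [mΩ : MeasurableSpace Ω] [Fintype I] [DecidableEq I] [MeasurableSpace I]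
  [DiscreteMeasurableSpace I] [Fintype O] [DecidableEq O]

/-- `Z` is the filtering process for the Markov process `X` with initial law `μ`, observed through
`h`. -/
structure IsFilterProcess (P : Measure Ω) (X : ℝ≥0 → Ω → I) (Λ : Matrix I I ℝ) (h : I → O)
    (νfix : O → I → ℝ) (μ : effSimplex h) (Z : ℝ≥0 → Ω → effSimplex h) : Prop where
  rate : IsRateMatrix Λ
  fix : ∀ a, νfix a ∈ face h a
  markov : IsMarkovStep P X Λ
  initial : ∀ i, P.real {ω | X 0 ω = i} = (μ : I → ℝ) i
  path : ∀ ω, IsFilterPath Λ h νfix μ (fun t => h (X t ω)) fun t => Z t ω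

/-- The state of the filter at the `n`-th jump of the observation (`μ` if there is no such jump). -/
def postState (X : ℝ≥0 → Ω → I) (h : I → O) (μ : effSimplex h) (Z : ℝ≥0 → Ω → effSimplex h)
    (n : ℕ) (ω : Ω) : effSimplex h :=
  atTime Z μ (obsTime X h n) ω

/-- The state of the filter just before the jump `n + 1` of the observation. -/
def preState (Λ : Matrix I I ℝ) (h : I → O) (X : ℝ≥0 → Ω → I) (μ : effSimplex h)
    (Z : ℝ≥0 → Ω → effSimplex h) (n : ℕ) (ω : Ω) : effSimplex h :=
  flow Λ h ((obsTime X h (n + 1) ω).toNNReal - (obsTime X h n ω).toNNReal)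
    (postState X h μ Z n ω)

namespace IsFilterProcess

variable {P : Measure Ω} [IsProbabilityMeasure P] {Λ : Matrix I I ℝ} {h : I → O}
  {νfix : O → I → ℝ} {μ : effSimplex h} {X : ℝ≥0 → Ω → I} {Z : ℝ≥0 → Ω → effSimplex h}
  (hZ : IsFilterProcess P X Λ h νfix μ Z)
include hZ

theorem obsSigma_le (n : ℕ) : obsSigma X h n ≤ mΩ := by
  have hV : ∀ n, MeasurableSpace.comap (fun ω => h (signalAt X h n ω)) ⊤ ≤ mΩ := by
    rintro n _ ⟨B, -, rfl⟩
    exact hZ.markov.measurable_signalAt n (MeasurableSet.of_discrete (s := h ⁻¹' B))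
  induction n with
  | zero => exact hV 0
  | succ n ih =>
    exact sup_le (sup_le ih (hZ.markov.measurable_obsTime (n + 1)).comap_le) (hV (n + 1))

theorem obsSigmaNext_le (n : ℕ) : obsSigmaNext X h n ≤ mΩ :=
  (obsSigmaNext_le_succ n).trans (hZ.obsSigma_le (n + 1))

theorem level_postState {n : ℕ} {ω : Ω} (hω : obsTime X h n ω ≠ ⊤) :
    level (postState X h μ Z n ω) = h (signalAt X h n ω) := by
  rw [postState, atTime, if_neg hω]
  exact (hZ.path ω).level_eq _

theorem level_preState {n : ℕ} {ω : Ω} (hω : obsTime X h n ω ≠ ⊤) :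
    level (preState Λ h X μ Z n ω) = h (signalAt X h n ω) := by
  rw [preState, level_flow hZ.rate, hZ.level_postState hω]

theorem coe_postState_zero (ω : Ω) :
    (postState X h μ Z 0 ω : I → ℝ) = opH h νfix (h (signalAt X h 0 ω)) μ := by
  rw [postState, atTime, if_neg (show obsTime X h 0 ω ≠ ⊤ from ENNReal.zero_ne_top)]
  exact (hZ.path ω).apply_zero

theorem postState_succ {n : ℕ} {ω : Ω} (hω : obsTime X h (n + 1) ω ≠ ⊤) :
    postState X h μ Z (n + 1) ω =
      postJump Λ h νfix (h (signalAt X h (n + 1) ω)) (preState Λ h X μ Z n ω) := by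
  have hn : obsTime X h n ω ≠ ⊤ := ne_top_of_le_ne_top hω (jumpTime_le_succ _ n)
  rw [postState, atTime, if_neg hω, preState, postState, atTime, if_neg hn]
  exact (hZ.path ω).eq_postJump hω

theorem measurable_preState_of {m : MeasurableSpace Ω} {n : ℕ}
    (h0 : Measurable[m] (obsTime X h n)) (h1 : Measurable[m] (obsTime X h (n + 1)))
    (h2 : Measurable[m] (postState X h μ Z n)) : Measurable[m] (preState Λ h X μ Z n) :=
  measurable_flow_comp (IsFilterProcess.rate (mΩ := mΩ) hZ) (measurable_toNNReal_sub h1 h0) h2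

/-- The filter at the `n`-th jump time is a function of the observed jumps. -/
theorem measurable_postState (n : ℕ) : Measurable[obsSigma X h n] (postState X h μ Z n) := by
  induction n with
  | zero =>
    refine Measurable.subtype_mk (f := fun ω => (postState X h μ Z 0 ω : I → ℝ))
      (h := fun ω => (postState X h μ Z 0 ω).2) ?_
    simp only [hZ.coe_postState_zero]
    exact measurable_of_index (l := fun ω => h (signalAt X h 0 ω))
      (g := fun b _ => opH h νfix b μ) (fun b => measurableSet_obs_eq 0 {b})
      fun b => measurable_const
  | succ n ih =>
    have hpre : Measurable[obsSigma X h (n + 1)] (preState Λ h X μ Z n) :=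
      hZ.measurable_preState_of
        ((measurable_obsTime_obsSigma n).mono (obsSigma_mono n.le_succ) le_rfl)
        (measurable_obsTime_obsSigma (n + 1)) (ih.mono (obsSigma_mono n.le_succ) le_rfl)
    have hpost : Measurable[obsSigma X h (n + 1)] fun ω =>
        postJump Λ h νfix (h (signalAt X h (n + 1) ω)) (preState Λ h X μ Z n ω) :=
      measurable_of_index (l := fun ω => h (signalAt X h (n + 1) ω))
        (g := fun b ω => postJump Λ h νfix b (preState Λ h X μ Z n ω))
        (fun b => measurableSet_obs_eq (n + 1) {b}) fun b => (measurable_postJump b).comp hpre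
    have heq : postState X h μ Z (n + 1) = fun ω =>
        open Classical in if obsTime X h (n + 1) ω = ⊤ then μ else
          postJump Λ h νfix (h (signalAt X h (n + 1) ω)) (preState Λ h X μ Z n ω) := by
      ext1 ω
      by_cases hω : obsTime X h (n + 1) ω = ⊤
      · rw [if_pos hω, postState, atTime, if_pos hω]
      · rw [if_neg hω, hZ.postState_succ hω]
    rw [heq]
    exact Measurable.ite (measurable_obsTime_obsSigma (n + 1) (measurableSet_singleton ⊤))
      measurable_const hpost

theorem measurable_preState (n : ℕ) : Measurable[obsSigmaNext X h n] (preState Λ h X μ Z n) :=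
  hZ.measurable_preState_of
    ((measurable_obsTime_obsSigma n).mono (obsSigma_le_next n) le_rfl)
    (measurable_obsTime_next n) ((hZ.measurable_postState n).mono (obsSigma_le_next n) le_rfl)

theorem measurable_postState' (n : ℕ) : Measurable (postState X h μ Z n) :=
  (hZ.measurable_postState n).mono (hZ.obsSigma_le n) le_rfl

theorem measurableSet_finite (n : ℕ) : MeasurableSet[obsSigma X h n] {ω | obsTime X h n ω < ⊤} :=
  measurable_obsTime_obsSigma n measurableSet_Iio

/-- Two measures that agree on the observed events on which the `n`-th jump time is bounded and the
observation at that time is constant agree on all observed events with finite `n`-th jump time. -/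
theorem measure_eq_of_pieces (n : ℕ) {μ₁ μ₂ : Measure Ω}
    (H : ∀ A, MeasurableSet[obsSigma X h n] A → ∀ (L : ℝ≥0) (a : O),
      (∀ ω ∈ A, obsTime X h n ω < L) → (∀ ω ∈ A, h (signalAt X h n ω) = a) → μ₁ A = μ₂ A)
    {A : Set Ω} (hA : MeasurableSet[obsSigma X h n] A) (hfin : ∀ ω ∈ A, obsTime X h n ω < ⊤) :
    μ₁ A = μ₂ A := by
  have hle := hZ.obsSigma_le n
  set B : ℕ × O → Set Ω := fun k => A ∩ {ω | ⌊(obsTime X h n ω).toNNReal⌋₊ = k.1} ∩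
    {ω | h (signalAt X h n ω) ∈ ({k.2} : Set O)} with hB
  have hBm : ∀ k, MeasurableSet[obsSigma X h n] (B k) := fun k =>
    (hA.inter ((Nat.measurable_floor.comp (measurable_obsTime_obsSigma n).ennreal_toNNReal)
      (measurableSet_singleton k.1))).inter (measurableSet_obs_eq n {k.2})
  have hU : A = ⋃ k, B k := by
    ext ω
    simp [hB]
  have hdisj : Pairwise (Function.onFun Disjoint B) := fun k l hkl =>
    Set.disjoint_left.2 fun ω h1 h2 => hkl (Prod.ext (h1.1.2.symm.trans h2.1.2)
      ((mem_singleton_iff.1 h1.2).symm.trans (mem_singleton_iff.1 h2.2)))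
  rw [hU, measure_iUnion hdisj fun k => hle _ (hBm k),
    measure_iUnion hdisj fun k => hle _ (hBm k)]
  refine tsum_congr fun k => H _ (hBm k) (k.1 + 1) k.2 (fun ω hω => ?_) fun ω hω => hω.2
  have h1 : ⌊(obsTime X h n ω).toNNReal⌋₊ = k.1 := hω.1.2
  rw [← ENNReal.coe_toNNReal (hfin ω hω.1.1).ne, ENNReal.coe_lt_coe, ← h1]
  exact Nat.lt_floor_add_one _

theorem integrable_coe (n : ℕ) :
    Integrable (fun ω => (postState X h μ Z n ω : I → ℝ)) P := by
  refine Integrable.of_eval fun i => ?_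
  refine Integrable.of_bound ((measurable_pi_apply i).comp
    (measurable_subtype_coe.comp (hZ.measurable_postState' n))).aestronglyMeasurable 1
    (Eventually.of_forall fun ω => ?_)
  rw [Real.norm_of_nonneg (effSimplex_nonneg _ i)]
  exact effSimplex_le_one _ i

/-- The statement that `Z` at the `n`-th jump time is the conditional law of the signal given the
observed jumps. -/
def IsCondLaw (P : Measure Ω) (X : ℝ≥0 → Ω → I) (h : I → O) (μ : effSimplex h)
    (Z : ℝ≥0 → Ω → effSimplex h) (n : ℕ) : Prop :=
  ∀ A, MeasurableSet[obsSigma X h n] A → (∀ ω ∈ A, obsTime X h n ω < ⊤) → ∀ i,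
    P (A ∩ {ω | signalAt X h n ω = i}) =
      ∫⁻ ω in A, ENNReal.ofReal ((postState X h μ Z n ω : I → ℝ) i) ∂P

variable {n : ℕ} (hn : IsCondLaw P X h μ Z n)
include hn

/-- Linear functionals of the conditional law of the signal. -/
theorem linearMap_law_eq {A : Set Ω} (hA : MeasurableSet[obsSigma X h n] A)
    (hfin : ∀ ω ∈ A, obsTime X h n ω < ⊤) (l : (I → ℝ) →ₗ[ℝ] ℝ) :
    l (fun i => P.real (A ∩ {ω | signalAt X h n ω = i})) =
      ∫ ω in A, l (postState X h μ Z n ω) ∂P := by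
  have hint := (hZ.integrable_coe n).integrableOn (s := A)
  have h1 := (LinearMap.toContinuousLinearMap l).integral_comp_comm hint
  have h2 : (fun i => P.real (A ∩ {ω | signalAt X h n ω = i})) =
      ∫ ω in A, (postState X h μ Z n ω : I → ℝ) ∂P := by
    ext i
    rw [eval_integral fun i => Integrable.eval hint i, measureReal_def, hn A hA hfin i,
      ← integral_eq_lintegral_of_nonneg_ae (Eventually.of_forall fun ω => effSimplex_nonneg _ i)
        (Integrable.eval hint i).aestronglyMeasurable]
  rw [h2]
  exact h1.symm

theorem measure_eq_lintegral_linearMap {A : Set Ω} (hA : MeasurableSet[obsSigma X h n] A)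
    (hfin : ∀ ω ∈ A, obsTime X h n ω < ⊤) (l : (I → ℝ) →ₗ[ℝ] ℝ)
    (hl : ∀ ω ∈ A, 0 ≤ l (postState X h μ Z n ω)) {C : Set Ω}
    (hC : P.real C = l (fun i => P.real (A ∩ {ω | signalAt X h n ω = i}))) :
    P C = ∫⁻ ω in A, ENNReal.ofReal (l (postState X h μ Z n ω)) ∂P := by
  have hint := (hZ.integrable_coe n).integrableOn (s := A)
  rw [← ofReal_measureReal (measure_ne_top P C), hC, hZ.linearMap_law_eq hn hA hfin l,
    ofReal_integral_eq_lintegral_ofReal]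
  · exact (LinearMap.toContinuousLinearMap l).integrable_comp hint
  · filter_upwards [ae_restrict_mem (hZ.obsSigma_le n _ hA)] with ω hω using hl ω hω

/-- The law of the sojourn time, given the observed jumps. -/
theorem measure_sojourn {A : Set Ω} (hA : MeasurableSet[obsSigma X h n] A)
    (hfin : ∀ ω ∈ A, obsTime X h n ω < ⊤) (t : ℝ≥0) :
    P (A ∩ {ω | obsTime X h n ω + t < obsTime X h (n + 1) ω}) =
      ∫⁻ ω in A, ENNReal.ofReal (∑ i, unnorm Λ h (level (postState X h μ Z n ω))
        (postState X h μ Z n ω) t i) ∂P := by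
  have hS := hZ.markov.measurableSet_survival (h := h) n t
  have key := hZ.measure_eq_of_pieces n
    (μ₁ := P.restrict {ω | obsTime X h n ω + t < obsTime X h (n + 1) ω})
    (μ₂ := P.withDensity fun ω => ENNReal.ofReal (∑ i, unnorm Λ h
      (level (postState X h μ Z n ω)) (postState X h μ Z n ω) t i)) ?_ hA hfin
  · rwa [Measure.restrict_apply (hZ.obsSigma_le n _ hA),
      withDensity_apply _ (hZ.obsSigma_le n _ hA)] at key
  intro A hA L a hL ha
  have hAm := hZ.obsSigma_le n _ hA
  have hfin : ∀ ω ∈ A, obsTime X h n ω < ⊤ := fun ω hω => (hL ω hω).trans ENNReal.coe_lt_top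
  rw [Measure.restrict_apply hAm, withDensity_apply _ hAm]
  -- with the level fixed, the integrand is a linear functional of the filter
  let l : (I → ℝ) →ₗ[ℝ] ℝ :=
    { toFun := fun x => ∑ i, unnorm Λ h a x t i
      map_add' := fun x y => by
        simp only [unnorm, Matrix.add_vecMul, Pi.add_apply, Finset.sum_add_distrib]
      map_smul' := fun c x => by
        simp only [unnorm, Matrix.smul_vecMul, Pi.smul_apply, ← Finset.smul_sum]
        rfl }
  have hlev : ∀ ω ∈ A, level (postState X h μ Z n ω) = a := fun ω hω => by
    rw [hZ.level_postState (hfin ω hω).ne, ha ω hω]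
  rw [hZ.measure_eq_lintegral_linearMap hn hA hfin l]
  · refine setLIntegral_congr_fun hAm fun ω hω => ?_
    simp only [hlev ω hω]
    rfl
  · intro ω hω
    exact Finset.sum_nonneg fun i _ =>
      unnorm_nonneg hZ.rate (fun i => effSimplex_nonneg _ i) (NNReal.coe_nonneg t) i
  · have hpast := isPast_of_obsSigma hZ.markov.step n hA
    change _ = ∑ i, unnorm Λ h a _ t i
    rw [← hZ.markov.survivalLaw_eq_unnorm hAm hpast ha hL t]
    have := setIntegral_comp_discrete (P := P) (fun _ => (1 : ℝ))
      (hZ.markov.measurable_after (h := h) n t)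
      (A ∩ {ω | obsTime X h n ω + t < obsTime X h (n + 1) ω})
    rw [setIntegral_const, smul_eq_mul, mul_one] at this
    rw [this]
    simp [dotProduct, IsMarkovStep.survivalLaw]

/-- The joint law of the next sojourn time and the position of the signal after it, given the
observed jumps. -/
theorem measure_next_jump {A : Set Ω} (hA : MeasurableSet[obsSigma X h n] A)
    (hfin : ∀ ω ∈ A, obsTime X h n ω < ⊤) (t : ℝ≥0) (j : I) :
    P (A ∩ {ω | obsTime X h (n + 1) ω ≤ obsTime X h n ω + t ∧ signalAt X h (n + 1) ω = j}) =
      ∫⁻ ω in A, ∫⁻ s in Ioc 0 (t : ℝ),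
        ENNReal.ofReal (jumpDensity Λ j (postState X h μ Z n ω) s) ∂volume ∂P := by
  have hS : MeasurableSet {ω | obsTime X h (n + 1) ω ≤ obsTime X h n ω + t ∧
      signalAt X h (n + 1) ω = j} :=
    (measurableSet_le (hZ.markov.measurable_obsTime (n + 1))
      ((hZ.markov.measurable_obsTime n).add_const _)).inter
      (hZ.markov.measurable_signalAt (n + 1) (measurableSet_singleton j))
  have key := hZ.measure_eq_of_pieces n
    (μ₁ := P.restrict {ω | obsTime X h (n + 1) ω ≤ obsTime X h n ω + t ∧
      signalAt X h (n + 1) ω = j})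
    (μ₂ := P.withDensity fun ω => ∫⁻ s in Ioc 0 (t : ℝ),
        ENNReal.ofReal (jumpDensity Λ j (postState X h μ Z n ω) s)) ?_ hA hfin
  · rwa [Measure.restrict_apply (hZ.obsSigma_le n _ hA),
      withDensity_apply _ (hZ.obsSigma_le n _ hA)] at key
  intro A hA L a hL ha
  have hAm := hZ.obsSigma_le n _ hA
  have hfin : ∀ ω ∈ A, obsTime X h n ω < ⊤ := fun ω hω => (hL ω hω).trans ENNReal.coe_lt_top
  rw [Measure.restrict_apply hAm, withDensity_apply _ hAm]
  have hlev : ∀ ω ∈ A, level (postState X h μ Z n ω) = a := fun ω hω => by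
    rw [hZ.level_postState (hfin ω hω).ne, ha ω hω]
  by_cases hj : h j = a
  · -- the observation changes its value at a jump, so both sides vanish
    have hempty : A ∩ {ω | obsTime X h (n + 1) ω ≤ obsTime X h n ω + t ∧
        signalAt X h (n + 1) ω = j} = ∅ := by
      refine eq_empty_of_forall_notMem fun ω ⟨hω, h1, h2⟩ => ?_
      have hfin' : obsTime X h (n + 1) ω ≠ ⊤ := ne_top_of_le_ne_top
        (ENNReal.add_ne_top.2 ⟨(hfin ω hω).ne, ENNReal.coe_ne_top⟩) h1
      refine (hZ.path ω).step.apply_jumpTime_succ_ne hfin' ?_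
      exact ((congrArg h h2).trans hj).trans (ha ω hω).symm
    rw [hempty, measure_empty]
    refine (setLIntegral_eq_zero hAm fun ω hω => ?_).symm
    have : ∀ s, jumpDensity Λ j (postState X h μ Z n ω) s = 0 := fun s => by
      rw [jumpDensity, exitRate, level_flow hZ.rate, hlev ω hω, if_pos hj, mul_zero]
    simp [this]
  have hcont : ∀ x : I → ℝ, Continuous fun s : ℝ => (unnorm Λ h a x s ᵥ* Λ) j := fun x =>
    (continuous_apply j).comp (Continuous.matrix_vecMul
      (continuous_unnorm.comp (continuous_id.prodMk continuous_const)) continuous_const)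
  have hii : ∀ x : I → ℝ, IntervalIntegrable (fun s : ℝ => (unnorm Λ h a x s ᵥ* Λ) j) volume 0 t :=
    fun x => (hcont x).intervalIntegrable _ _
  let l : (I → ℝ) →ₗ[ℝ] ℝ :=
    { toFun := fun x => ∫ s in (0 : ℝ)..t, (unnorm Λ h a x s ᵥ* Λ) j
      map_add' := fun x y => by
        rw [← intervalIntegral.integral_add (hii x) (hii y)]
        simp only [unnorm, Matrix.add_vecMul, Pi.add_apply]
      map_smul' := fun c x => by
        rw [RingHom.id_apply, ← intervalIntegral.integral_smul]
        simp only [unnorm, Matrix.smul_vecMul, Pi.smul_apply] }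
  have hdens : ∀ ω ∈ A, ∀ s : ℝ, 0 ≤ s →
      (unnorm Λ h a (postState X h μ Z n ω) s ᵥ* Λ) j =
        jumpDensity Λ j (postState X h μ Z n ω) s := fun ω hω s hs => by
    have := unnorm_vecMul_eq hZ.rate (postState X h μ Z n ω) s.toNNReal
      (j := j) (by rwa [hlev ω hω])
    rw [Real.coe_toNNReal s hs, hlev ω hω] at this
    rw [jumpDensity, hlev ω hω, this]
  have hlint : ∀ ω ∈ A, l (postState X h μ Z n ω) =
      ∫ s in Ioc 0 (t : ℝ), jumpDensity Λ j (postState X h μ Z n ω) s := fun ω hω => by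
    change ∫ s in (0 : ℝ)..t, _ = _
    rw [intervalIntegral.integral_of_le (NNReal.coe_nonneg t)]
    exact setIntegral_congr_fun measurableSet_Ioc fun s hs => hdens ω hω s hs.1.le
  rw [hZ.measure_eq_lintegral_linearMap hn hA hfin l]
  · refine setLIntegral_congr_fun hAm fun ω hω => ?_
    rw [hlint ω hω, ofReal_integral_eq_lintegral_ofReal]
    · have := (hii (postState X h μ Z n ω : I → ℝ)).1
      exact this.congr_fun (fun s hs => hdens ω hω s hs.1.le) measurableSet_Ioc
    · filter_upwards [ae_restrict_mem measurableSet_Ioc] with s hs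
      exact jumpDensity_nonneg hZ.rate j _ hs.1.le
  · intro ω hω
    rw [hlint ω hω]
    exact setIntegral_nonneg measurableSet_Ioc fun s hs =>
      jumpDensity_nonneg hZ.rate j _ hs.1.le
  · exact hZ.markov.measureReal_next_jump hAm (isPast_of_obsSigma hZ.markov.step n hA) ha hL t hj

end IsFilterProcess

end FilterProcess

/-! ### The exit distribution given the sojourn time -/

/-- The events of `m ⊔ σ(T)` are the sections of the graph of `T`. -/
theorem exists_eq_graph_of_sup_comap {Ω β : Type*} {m : MeasurableSpace Ω} {mβ : MeasurableSpace β}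
    {T : Ω → β} {D : Set Ω} (hD : MeasurableSet[m ⊔ MeasurableSpace.comap T mβ] D) :
    ∃ B : Set (Ω × β), MeasurableSet B ∧ D = {ω | (ω, T ω) ∈ B} := by
  have h1 := MeasurableSpace.comap_prodMk (fun ω : Ω => ω) T (mβ := m) (mγ := mβ)
  rw [show MeasurableSpace.comap (fun ω : Ω => ω) m = m from MeasurableSpace.comap_id] at h1
  rw [← h1] at hD
  obtain ⟨B, hB, rfl⟩ := hD
  exact ⟨B, hB, rfl⟩

/-- If, given the past `π`, the pair of the sojourn time `T' - T` and the exit point `J` has the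
density `d` with respect to Lebesgue measure times counting measure, then the law of `J`, given the
past and `T'`, has the weights `ψ j` that are proportional to `d j`. -/
theorem measure_exit_of_density {Ω Ω' E ι : Type*} {mΩ : MeasurableSpace Ω}
    {mΩ' : MeasurableSpace Ω'} [MeasurableSpace E] [Fintype ι] {P : Measure Ω} [IsFiniteMeasure P]
    {π : Ω → Ω'} (hπ : Measurable π) {T : Ω' → ℝ≥0∞} (hT : Measurable T) {x : Ω' → E}
    (hx : Measurable x) {T' : Ω → ℝ≥0∞} (hT' : Measurable T')
    (hlt : ∀ ω, T' ω ≠ ⊤ → T (π ω) < T' ω) {J : Ω → ι} (hJ : ∀ j, MeasurableSet {ω | J ω = j})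
    {d ψ : ι → E × ℝ → ℝ≥0∞} (hd : ∀ j, Measurable (d j)) (hψ : ∀ j, Measurable (ψ j))
    (hdψ : ∀ j e s, 0 < s → (∑ k, d k (e, s)) * ψ j (e, s) = d j (e, s))
    (H : ∀ A, MeasurableSet A → (∀ y ∈ A, T y < ⊤) → ∀ (t : ℝ≥0) (j : ι),
      P (π ⁻¹' A ∩ {ω | T' ω ≤ T (π ω) + t ∧ J ω = j}) =
        ∫⁻ ω in π ⁻¹' A, ∫⁻ s in Ioc 0 (t : ℝ), d j (x (π ω), s) ∂volume ∂P)
    {B : Set (Ω' × ℝ≥0∞)} (hB : MeasurableSet B) (j : ι) :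
    P ({ω | (π ω, T' ω) ∈ B} ∩ {ω | T' ω < ⊤} ∩ {ω | J ω = j}) =
      ∫⁻ ω in {ω | (π ω, T' ω) ∈ B} ∩ {ω | T' ω < ⊤},
        ψ j (x (π ω), (T' ω).toReal - (T (π ω)).toReal) ∂P := by
  set S : Ω → ℝ := fun ω => (T' ω).toReal - (T (π ω)).toReal with hSdef
  have hS : Measurable S := hT'.ennreal_toReal.sub (hT.comp hπ).ennreal_toReal
  have hF : MeasurableSet {ω | T' ω < ⊤} := hT' measurableSet_Iio
  set C : ι → Set Ω := fun j => {ω | T' ω < ⊤} ∩ {ω | J ω = j} with hC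
  have hCm : ∀ j, MeasurableSet (C j) := fun j => hF.inter (hJ j)
  have hxs : Measurable fun z : Ω' × ℝ => (x z.1, z.2) :=
    (hx.comp measurable_fst).prodMk measurable_snd
  set U : Set (Ω' × ℝ) := {z | T z.1 < ⊤ ∧ 0 < z.2} with hU
  have hUm : MeasurableSet U :=
    ((hT.comp measurable_fst) measurableSet_Iio).inter (measurable_snd measurableSet_Ioi)
  set p : ι → Ω' × ℝ → ℝ≥0∞ := fun j => U.indicator fun z => d j (x z.1, z.2) with hp
  have hpm : ∀ j, Measurable (p j) := fun j => ((hd j).comp hxs).indicator hUm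
  have hSpos : ∀ ω, T' ω < ⊤ → 0 < S ω := fun ω hω =>
    sub_pos.2 ((ENNReal.toReal_lt_toReal (hlt ω hω.ne).ne_top hω.ne).2 (hlt ω hω.ne))
  have hTS : ∀ ω, T' ω < ⊤ → T (π ω) + ENNReal.ofReal (S ω) = T' ω := fun ω hω => by
    rw [hSdef, ENNReal.ofReal_sub _ ENNReal.toReal_nonneg, ENNReal.ofReal_toReal hω.ne,
      ENNReal.ofReal_toReal (hlt ω hω.ne).ne_top, add_tsub_cancel_of_le (hlt ω hω.ne).le]
  -- the density on half-lines of sojourn times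
  have hdens : ∀ j, ∀ A : Set Ω', MeasurableSet A → ∀ t : ℝ,
      P (π ⁻¹' A ∩ {ω | S ω ≤ t} ∩ C j) =
        ∫⁻ ω in π ⁻¹' A, ∫⁻ s in Iic t, p j (π ω, s) ∂volume ∂P := by
    intro j A hA t
    have hin : ∀ ω, ∫⁻ s in Iic t, p j (π ω, s) =
        (π ⁻¹' {y | T y < ⊤}).indicator (fun ω => ∫⁻ s in Ioc 0 t, d j (x (π ω), s)) ω := by
      intro ω
      by_cases hω : T (π ω) < ⊤
      · rw [indicator_of_mem (show ω ∈ π ⁻¹' {y | T y < ⊤} from hω), ← Ioi_inter_Iic,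
          ← setLIntegral_indicator measurableSet_Ioi]
        refine lintegral_congr fun s => ?_
        by_cases hs : 0 < s
        · rw [hp, indicator_of_mem (show s ∈ Ioi (0 : ℝ) from hs)]
          exact indicator_of_mem (show (π ω, s) ∈ U from ⟨hω, hs⟩) _
        · rw [hp, indicator_of_notMem (show s ∉ Ioi (0 : ℝ) from hs)]
          exact indicator_of_notMem (fun hm : (π ω, s) ∈ U => hs hm.2) _
      · rw [indicator_of_notMem (show ω ∉ π ⁻¹' {y | T y < ⊤} from hω)]
        refine (lintegral_congr fun s => ?_).trans lintegral_zero
        exact indicator_of_notMem (fun hm : (π ω, s) ∈ U => hω hm.1) _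
    have hTm : MeasurableSet {y | T y < ⊤} := hT measurableSet_Iio
    simp only [hin]
    rw [setLIntegral_indicator (hπ hTm)]
    rcases lt_or_ge t 0 with ht | ht
    · have h1 : π ⁻¹' A ∩ {ω | S ω ≤ t} ∩ C j = ∅ :=
        eq_empty_of_forall_notMem fun ω hω =>
          absurd ((hSpos ω hω.2.1).trans_le (show S ω ≤ t from hω.1.2)) ht.not_gt
      simp [h1, Ioc_eq_empty ht.not_gt]
    · lift t to ℝ≥0 using ht
      rw [← preimage_inter, inter_comm {y | T y < ⊤} A, ← H _ (hA.inter hTm) (fun y hy => hy.2) t j]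
      congr 1
      ext ω
      have hiff : T' ω < ⊤ → (S ω ≤ t ↔ T' ω ≤ T (π ω) + t) := fun hf => by
        rw [← hTS ω hf, ENNReal.add_le_add_iff_left (hlt ω hf.ne).ne_top,
          ← ENNReal.ofReal_coe_nnreal]
        exact (ENNReal.ofReal_le_ofReal_iff (NNReal.coe_nonneg t)).symm
      constructor
      · rintro ⟨⟨hωA, hSt⟩, hf, hJω⟩
        exact ⟨⟨hωA, (hlt ω hf.ne).trans hf⟩, (hiff hf).1 hSt, hJω⟩
      · rintro ⟨⟨hωA, hTf⟩, hle, hJω⟩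
        have hf : T' ω < ⊤ := hle.trans_lt
          (ENNReal.add_lt_top.2 ⟨show T (π ω) < ⊤ from hTf, ENNReal.coe_lt_top⟩)
        exact ⟨⟨hωA, (hiff hf).2 hle⟩, hf, hJω⟩
  set D : Set Ω := {ω | (π ω, T' ω) ∈ B} with hD
  have hDm : MeasurableSet D := (hπ.prodMk hT') hB
  -- the event in terms of the past and the sojourn time
  set B' : Set (Ω' × ℝ) := {z | (z.1, T z.1 + ENNReal.ofReal z.2) ∈ B} with hB'
  have hBm' : MeasurableSet B' := (measurable_fst.prodMk
    ((hT.comp measurable_fst).add measurable_snd.ennreal_ofReal)) hB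
  have hDB : ∀ ω, T' ω < ⊤ → ((π ω, S ω) ∈ B' ↔ ω ∈ D) := fun ω hω => by
    change (π ω, T (π ω) + ENNReal.ofReal (S ω)) ∈ B ↔ _
    rw [hTS ω hω]
    rfl
  have hψx : Measurable fun z : Ω' × ℝ => ψ j (x z.1, z.2) := (hψ j).comp hxs
  have hsplit : {ω | T' ω < ⊤} = ⋃ k, C k := by
    ext ω
    simp [hC]
  have hCdisj : Pairwise (Function.onFun Disjoint C) := fun k l hkl =>
    Set.disjoint_left.2 fun ω h1 h2 => hkl ((show J ω = k from h1.2).symm.trans h2.2)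
  have hleft : P (D ∩ {ω | T' ω < ⊤} ∩ {ω | J ω = j}) =
      ∫⁻ ω in C j, B'.indicator 1 (π ω, S ω) ∂P := by
    have h1 : ∀ ω ∈ C j, B'.indicator (1 : Ω' × ℝ → ℝ≥0∞) (π ω, S ω) = D.indicator 1 ω := by
      intro ω hω
      by_cases hωD : ω ∈ D
      · rw [indicator_of_mem hωD, indicator_of_mem ((hDB ω hω.1).2 hωD)]
        rfl
      · rw [indicator_of_notMem hωD, indicator_of_notMem (mt (hDB ω hω.1).1 hωD)]
    rw [setLIntegral_congr_fun (hCm j) h1, lintegral_indicator_one hDm,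
      Measure.restrict_apply hDm, inter_assoc]
  have hright : ∫⁻ ω in D ∩ {ω | T' ω < ⊤}, ψ j (x (π ω), S ω) ∂P =
      ∑ k, ∫⁻ ω in C k, B'.indicator (fun z => ψ j (x z.1, z.2)) (π ω, S ω) ∂P := by
    rw [← tsum_fintype (L := .unconditional ι), ← lintegral_iUnion hCm hCdisj, ← hsplit,
      ← setLIntegral_indicator hDm]
    refine setLIntegral_congr_fun hF fun ω hω => ?_
    by_cases hωD : ω ∈ D
    · rw [indicator_of_mem hωD, indicator_of_mem ((hDB ω hω).2 hωD)]
    · rw [indicator_of_notMem hωD, indicator_of_notMem (mt (hDB ω hω).1 hωD)]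
  have hgm : Measurable (B'.indicator fun z => ψ j (x z.1, z.2)) := hψx.indicator hBm'
  have hmeas : ∀ k, Measurable fun z => p k z * B'.indicator (fun z => ψ j (x z.1, z.2)) z :=
    fun k => (hpm k).mul hgm
  -- both sides are integrals of densities, which agree since `ψ j` is the share of `d j` in
  -- the total density
  rw [hleft, hright, lintegral_eq_lintegral_density hπ hS (hpm j) (hdens j)
    (measurable_one.indicator hBm')]
  simp only [fun k => lintegral_eq_lintegral_density hπ hS (hpm k) (hdens k) hgm]
  have hmeas' : ∀ k, Measurable fun ω => ∫⁻ s : ℝ, p k (π ω, s) *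
      B'.indicator (fun z => ψ j (x z.1, z.2)) (π ω, s) := fun k =>
    ((hmeas k).lintegral_prod_right').comp hπ
  rw [← lintegral_finsetSum _ fun k _ => hmeas' k]
  refine lintegral_congr fun ω => ?_
  have hmeas'' : ∀ k, Measurable fun s : ℝ => p k (π ω, s) *
      B'.indicator (fun z => ψ j (x z.1, z.2)) (π ω, s) := fun k =>
    (hmeas k).comp measurable_prodMk_left
  rw [← lintegral_finsetSum _ fun k _ => hmeas'' k]
  refine lintegral_congr fun s => ?_
  rw [← Finset.sum_mul]
  by_cases hs : (π ω, s) ∈ U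
  · simp only [hp, indicator_of_mem hs]
    by_cases hb : (π ω, s) ∈ B'
    · rw [indicator_of_mem hb, indicator_of_mem hb, hdψ j _ _ hs.2, Pi.one_apply, mul_one]
    · rw [indicator_of_notMem hb, indicator_of_notMem hb, mul_zero, mul_zero]
  · simp only [hp, indicator_of_notMem hs, Finset.sum_const_zero, zero_mul]

namespace IsFilterProcess

variable {Ω I O : Type*} [mΩ : MeasurableSpace Ω] [Fintype I] [DecidableEq I] [MeasurableSpace I]
  [DiscreteMeasurableSpace I] [Fintype O] [DecidableEq O] {P : Measure Ω} [IsProbabilityMeasure P]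
  {Λ : Matrix I I ℝ} {h : I → O} {νfix : O → I → ℝ} {μ : effSimplex h} {X : ℝ≥0 → Ω → I}
  {Z : ℝ≥0 → Ω → effSimplex h} (hZ : IsFilterProcess P X Λ h νfix μ Z)
include hZ

theorem measurableSet_signalAt (n : ℕ) (j : I) : MeasurableSet {ω | signalAt X h n ω = j} :=
  hZ.markov.measurable_signalAt n (measurableSet_singleton j)

theorem measurableSet_finite_next (n : ℕ) :
    MeasurableSet[obsSigmaNext X h n] {ω | obsTime X h (n + 1) ω < ⊤} :=
  measurable_obsTime_next n measurableSet_Iio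

variable {n : ℕ} (hn : IsCondLaw P X h μ Z n)
include hn

/-- The law of the signal after a jump, given the observed jumps up to the previous one and the
time of the jump. -/
theorem measure_next_signal {D : Set Ω} (hD : MeasurableSet[obsSigmaNext X h n] D) (j : I) :
    P (D ∩ {ω | obsTime X h (n + 1) ω < ⊤} ∩ {ω | signalAt X h (n + 1) ω = j}) =
      ∫⁻ ω in D ∩ {ω | obsTime X h (n + 1) ω < ⊤},
        ENNReal.ofReal (exitProb Λ h j (preState Λ h X μ Z n ω)) ∂P := by
  obtain ⟨B, hB, rfl⟩ := exists_eq_graph_of_sup_comap (m := obsSigma X h n) hD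
  have key := measure_exit_of_density (mΩ' := obsSigma X h n) (P := P) (π := fun ω => ω)
    (measurable_id'' (hZ.obsSigma_le n)) (measurable_obsTime_obsSigma n)
    (hZ.measurable_postState n) (hZ.markov.measurable_obsTime (n + 1))
    (fun ω hω => (hZ.path ω).step.jumpTime_lt_succ
      (ne_top_of_le_ne_top hω (jumpTime_le_succ _ n))) (J := signalAt X h (n + 1))
    (hZ.measurableSet_signalAt (n + 1))
    (d := fun j p => ENNReal.ofReal (jumpDensity Λ j p.1 p.2))
    (ψ := fun j p => ENNReal.ofReal (exitProb Λ h j (flow Λ h p.2.toNNReal p.1)))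
    (fun j => (measurable_jumpDensity hZ.rate j).ennreal_ofReal)
    (fun j => ((measurable_exitProb j).comp (measurable_flow_comp hZ.rate
      (measurable_real_toNNReal.comp measurable_snd) measurable_fst)).ennreal_ofReal) ?_
    (fun A hA hfin t j => hZ.measure_next_jump hn hA hfin t j) hB j
  · rw [key]
    refine setLIntegral_congr_fun ?_ fun ω _ => ?_
    · exact (hZ.obsSigmaNext_le n _ hD).inter
        (hZ.obsSigmaNext_le n _ (hZ.measurableSet_finite_next n))
    · rw [preState]
      rfl
  · intro j x s hs
    rw [← ENNReal.ofReal_sum_of_nonneg fun k _ => jumpDensity_nonneg hZ.rate k x hs.le,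
      ← ENNReal.ofReal_mul (Finset.sum_nonneg fun k _ => jumpDensity_nonneg hZ.rate k x hs.le)]
    simp only [jumpDensity]
    rw [← Finset.mul_sum, sum_exitRate hZ.rate, mul_assoc, jumpRate_mul_exitProb hZ.rate]

/-- The preceding identity, with functions in place of events. -/
theorem lintegral_next_signal {f : Ω → ℝ≥0∞} (hf : Measurable[obsSigmaNext X h n] f) (j : I) :
    ∫⁻ ω in {ω | obsTime X h (n + 1) ω < ⊤} ∩ {ω | signalAt X h (n + 1) ω = j}, f ω ∂P =
      ∫⁻ ω in {ω | obsTime X h (n + 1) ω < ⊤},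
        ENNReal.ofReal (exitProb Λ h j (preState Λ h X μ Z n ω)) * f ω ∂P := by
  have hle := hZ.obsSigmaNext_le n
  have hw : Measurable fun ω => ENNReal.ofReal (exitProb Λ h j (preState Λ h X μ Z n ω)) :=
    ((measurable_exitProb j).comp
      ((hZ.measurable_preState n).mono hle le_rfl)).ennreal_ofReal
  have h1 := lintegral_eq_of_trim hle (μ₁ := P.restrict ({ω | obsTime X h (n + 1) ω < ⊤} ∩
    {ω | signalAt X h (n + 1) ω = j}))
    (μ₂ := (P.restrict {ω | obsTime X h (n + 1) ω < ⊤}).withDensity fun ω =>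
       ENNReal.ofReal (exitProb Λ h j (preState Λ h X μ Z n ω))) (fun D hD => ?_) hf
  · rw [h1, lintegral_withDensity_eq_lintegral_mul _ hw (hf.mono hle le_rfl)]
    rfl
  · rw [Measure.restrict_apply (hle _ hD), withDensity_apply _ (hle _ hD),
      Measure.restrict_restrict (hle _ hD), ← inter_assoc, hZ.measure_next_signal hn hD]

/-- The observation almost surely does not jump from a state of the filter with jump rate zero. -/
theorem jumpRate_preState_ne_zero :
    ∀ᵐ ω ∂P, obsTime X h (n + 1) ω < ⊤ → jumpRate Λ h (preState Λ h X μ Z n ω) ≠ 0 := by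
  have hD : MeasurableSet[obsSigmaNext X h n] {ω | jumpRate Λ h (preState Λ h X μ Z n ω) = 0} :=
    (continuous_jumpRate.measurable.comp (hZ.measurable_preState n)) (measurableSet_singleton 0)
  have h0 : ∀ j, P ({ω | jumpRate Λ h (preState Λ h X μ Z n ω) = 0} ∩
      {ω | obsTime X h (n + 1) ω < ⊤} ∩ {ω | signalAt X h (n + 1) ω = j}) = 0 := fun j => by
    rw [hZ.measure_next_signal hn hD]
    refine setLIntegral_eq_zero (hZ.obsSigmaNext_le n _
      (hD.inter (hZ.measurableSet_finite_next n))) fun ω hω => ?_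
    rw [exitProb, show jumpRate Λ h (preState Λ h X μ Z n ω) = 0 from hω.1, div_zero]
    exact ENNReal.ofReal_zero
  have h1 := measure_iUnion_null h0
  refine measure_mono_null (fun ω hω => ?_) h1
  have hω' : ¬ (obsTime X h (n + 1) ω < ⊤ → jumpRate Λ h (preState Λ h X μ Z n ω) ≠ 0) := hω
  push Not at hω'
  exact mem_iUnion.2 ⟨signalAt X h (n + 1) ω, ⟨hω'.2, hω'.1⟩, rfl⟩

omit hn in
theorem signalAt_succ_ne {ω : Ω} (hω : obsTime X h (n + 1) ω < ⊤) :
    h (signalAt X h (n + 1) ω) ≠ level (preState Λ h X μ Z n ω) := by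
  rw [hZ.level_preState (ne_top_of_le_ne_top hω.ne (jumpTime_le_succ _ n))]
  exact (hZ.path ω).step.apply_jumpTime_succ_ne hω.ne

end IsFilterProcess

/-! ### The filter is the conditional law of the signal -/

namespace IsFilterProcess

variable {Ω I O : Type*} [mΩ : MeasurableSpace Ω] [Fintype I] [DecidableEq I] [MeasurableSpace I]
  [DiscreteMeasurableSpace I] [Fintype O] [DecidableEq O] {P : Measure Ω} [IsProbabilityMeasure P]
  {Λ : Matrix I I ℝ} {h : I → O} {νfix : O → I → ℝ} {μ : effSimplex h} {X : ℝ≥0 → Ω → I}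
  {Z : ℝ≥0 → Ω → effSimplex h} (hZ : IsFilterProcess P X Λ h νfix μ Z)
include hZ

/-- The signal starts in the level set that carries its initial law. -/
theorem level_initial : ∀ᵐ ω ∂P, h (signalAt X h 0 ω) = level μ := by
  have h0 : ∀ i, h i ≠ level μ → P {ω | X 0 ω = i} = 0 := fun i hi => by
    have h1 := hZ.initial i
    rw [(mem_face_level μ).2 i hi] at h1
    exact (measureReal_eq_zero_iff).1 h1
  have h1 : ∀ᵐ ω ∂P, ∀ i, h i ≠ level μ → X 0 ω ≠ i := by
    rw [ae_all_iff]
    intro i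
    by_cases hi : h i = level μ
    · exact Eventually.of_forall fun ω h' => absurd hi h'
    · have h2 : ∀ᵐ ω ∂P, X 0 ω ≠ i := measure_mono_null (fun ω hω => not_not.1 hω) (h0 i hi)
      exact h2.mono fun ω hω _ => hω
  filter_upwards [h1] with ω hω
  by_contra hne
  exact hω _ hne rfl

theorem postState_zero : ∀ᵐ ω ∂P, postState X h μ Z 0 ω = μ := by
  filter_upwards [hZ.level_initial] with ω hω
  refine Subtype.ext ?_
  rw [hZ.coe_postState_zero, hω, opH_of_mem_face (mem_face_level μ)]

theorem isCondLaw_zero : IsCondLaw P X h μ Z 0 := by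
  rintro _ ⟨B, -, rfl⟩ - i
  have hm : MeasurableSet ((fun ω => h (signalAt X h 0 ω)) ⁻¹' B) :=
    hZ.obsSigma_le 0 _ ⟨B, trivial, rfl⟩
  have hrhs : ∫⁻ ω in (fun ω => h (signalAt X h 0 ω)) ⁻¹' B,
      ENNReal.ofReal ((postState X h μ Z 0 ω : I → ℝ) i) ∂P =
      ENNReal.ofReal ((μ : I → ℝ) i) * P ((fun ω => h (signalAt X h 0 ω)) ⁻¹' B) := by
    rw [← setLIntegral_const]
    refine lintegral_congr_ae (ae_restrict_of_ae ?_)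
    filter_upwards [hZ.postState_zero] with ω hω
    rw [hω]
  have hone : P {ω | signalAt X h 0 ω = i} = ENNReal.ofReal ((μ : I → ℝ) i) := by
    rw [← hZ.initial i, ofReal_measureReal]
    rfl
  rw [hrhs]
  -- the observation at time `0` is almost surely constant
  by_cases hB : level μ ∈ B
  · have h1 : ((fun ω => h (signalAt X h 0 ω)) ⁻¹' B) =ᵐ[P] univ := by
      rw [eventuallyEq_univ]
      filter_upwards [hZ.level_initial] with ω hω
      change h (signalAt X h 0 ω) ∈ B
      rwa [hω]
    rw [measure_congr h1, measure_univ, mul_one, ← hone]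
    refine measure_congr ?_
    have h2 := h1.inter (EventuallyEq.refl (ae P) {ω | signalAt X h 0 ω = i})
    rwa [univ_inter] at h2
  · have h1 : P ((fun ω => h (signalAt X h 0 ω)) ⁻¹' B) = 0 := by
      have : ∀ᵐ ω ∂P, ω ∉ (fun ω => h (signalAt X h 0 ω)) ⁻¹' B := by
        filter_upwards [hZ.level_initial] with ω hω hmem
        exact hB (hω ▸ hmem)
      exact measure_eq_zero_iff_ae_notMem.2 this
    rw [h1, mul_zero]
    exact measure_mono_null inter_subset_left h1

theorem coe_postState_succ {n : ℕ} {ω : Ω} (hω : obsTime X h (n + 1) ω < ⊤) :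
    (postState X h μ Z (n + 1) ω : I → ℝ) = opH h νfix (h (signalAt X h (n + 1) ω))
      ((preState Λ h X μ Z n ω : I → ℝ) ᵥ* Λ) := by
  rw [hZ.postState_succ hω.ne, coe_postJump hZ.rate hZ.fix (hZ.signalAt_succ_ne hω)]

/-- The conditional law of the signal propagates through a jump of the observation: this is Bayes'
formula. -/
theorem IsCondLaw.succ {n : ℕ} (hn : IsCondLaw P X h μ Z n) : IsCondLaw P X h μ Z (n + 1) := by
  intro A hA hfin i
  have hlenext := hZ.obsSigmaNext_le n
  have hAm : MeasurableSet A := hZ.obsSigma_le (n + 1) _ hA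
  have hA' : MeasurableSet[obsSigmaNext X h n ⊔
    MeasurableSpace.comap (fun ω => h (signalAt X h (n + 1) ω)) ⊤] A := hA
  obtain ⟨B, hB, hAB⟩ := exists_eq_graph_of_sup_comap (mβ := ⊤) (m := obsSigmaNext X h n) hA'
  -- the part of `A` on which the observation jumps to `h i` is determined before the jump
  set D : Set Ω := {ω | (ω, h i) ∈ B} with hD
  have hDm : MeasurableSet[obsSigmaNext X h n] D := by
    let _ : MeasurableSpace Ω := obsSigmaNext X h n
    let _ : MeasurableSpace O := ⊤
    exact measurable_prodMk_right hB
  have hF : MeasurableSet {ω | obsTime X h (n + 1) ω < ⊤} :=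
    hlenext _ (hZ.measurableSet_finite_next n)
  have hAD : ∀ j, h j = h i → A ∩ {ω | signalAt X h (n + 1) ω = j} =
      D ∩ ({ω | obsTime X h (n + 1) ω < ⊤} ∩ {ω | signalAt X h (n + 1) ω = j}) := by
    intro j hj
    ext ω
    have hmem : signalAt X h (n + 1) ω = j → (ω ∈ A ↔ ω ∈ D) := fun hω => by
      rw [hAB, hD]
      change (ω, h (signalAt X h (n + 1) ω)) ∈ B ↔ (ω, h i) ∈ B
      rw [hω, hj]
    constructor
    · rintro ⟨h1, h2⟩
      exact ⟨(hmem h2).1 h1, hfin ω h1, h2⟩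
    · rintro ⟨h1, -, h2⟩
      exact ⟨(hmem h2).2 h1, h2⟩
  set g : Ω → ℝ := fun ω => opH h νfix (h i) ((preState Λ h X μ Z n ω : I → ℝ) ᵥ* Λ) i with hg
  have hgm : Measurable[obsSigmaNext X h n] g :=
    (measurable_pi_apply i).comp ((measurable_opH νfix (h i)).comp
      (continuous_vecMul_coe.measurable.comp (hZ.measurable_preState n)))
  set f : Ω → ℝ≥0∞ := D.indicator fun ω => ENNReal.ofReal (g ω) with hf
  have hfm : Measurable[obsSigmaNext X h n] f := by
    let _ : MeasurableSpace Ω := obsSigmaNext X h n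
    exact hgm.ennreal_ofReal.indicator hDm
  have hw : ∀ j, Measurable fun ω => ENNReal.ofReal (exitProb Λ h j (preState Λ h X μ Z n ω)) :=
    fun j => ((measurable_exitProb j).comp
      ((hZ.measurable_preState n).mono hlenext le_rfl)).ennreal_ofReal
  have hsplit : A = ⋃ j, A ∩ {ω | signalAt X h (n + 1) ω = j} := by
    ext ω
    simp
  have hdisj : Pairwise (Function.onFun Disjoint
      fun j => A ∩ {ω | signalAt X h (n + 1) ω = j}) := fun k l hkl =>
    Set.disjoint_left.2 fun ω h1 h2 =>
      hkl ((show signalAt X h (n + 1) ω = k from h1.2).symm.trans h2.2)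
  have hterm : ∀ j, ∫⁻ ω in A ∩ {ω | signalAt X h (n + 1) ω = j},
      ENNReal.ofReal ((postState X h μ Z (n + 1) ω : I → ℝ) i) ∂P =
      ∫⁻ ω in {ω | obsTime X h (n + 1) ω < ⊤}, (if h j = h i then
        ENNReal.ofReal (exitProb Λ h j (preState Λ h X μ Z n ω)) * f ω else 0) ∂P := by
    intro j
    have hm : MeasurableSet (A ∩ {ω | signalAt X h (n + 1) ω = j}) :=
      hAm.inter (hZ.measurableSet_signalAt (n + 1) j)
    split_ifs with hj
    · rw [← hZ.lintegral_next_signal hn hfm, hAD j hj, hf,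
        setLIntegral_indicator (hlenext _ hDm)]
      refine setLIntegral_congr_fun (hAD j hj ▸ hm) fun ω hω => ?_
      have h2 : signalAt X h (n + 1) ω = j := hω.2.2
      simp only [hg]
      rw [hZ.coe_postState_succ hω.2.1, h2, hj]
    · rw [lintegral_zero]
      refine setLIntegral_eq_zero hm fun ω hω => ?_
      have h2 : signalAt X h (n + 1) ω = j := hω.2
      have h3 := hZ.signalAt_succ_ne (hfin ω hω.1)
      rw [h2] at h3
      rw [hZ.coe_postState_succ (hfin ω hω.1), h2,
        (opH_mem_face_of_ne hZ.rate hZ.fix h3).2 i (Ne.symm hj), ENNReal.ofReal_zero]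
      rfl
  calc P (A ∩ {ω | signalAt X h (n + 1) ω = i})
      = ∫⁻ ω in D ∩ {ω | obsTime X h (n + 1) ω < ⊤},
          ENNReal.ofReal (exitProb Λ h i (preState Λ h X μ Z n ω)) ∂P := by
        rw [hAD i rfl, ← inter_assoc, hZ.measure_next_signal hn hDm]
    _ = ∫⁻ ω in {ω | obsTime X h (n + 1) ω < ⊤}, ∑ j, (if h j = h i then
        ENNReal.ofReal (exitProb Λ h j (preState Λ h X μ Z n ω)) * f ω else 0) ∂P := by
        rw [← setLIntegral_indicator (hlenext _ hDm)]
        refine lintegral_congr fun ω => ?_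
        by_cases hω : ω ∈ D
        · -- either there is no exit to `j`, or `H` gives a probability vector
          have hnn : ∀ j, 0 ≤ if h j = h i then
              exitProb Λ h j (preState Λ h X μ Z n ω) * g ω else 0 := fun j => by
            split_ifs with hj
            · by_cases hi : h i = level (preState Λ h X μ Z n ω)
              · rw [exitProb, exitRate, if_pos (hj.trans hi), zero_div, zero_mul]
              · exact mul_nonneg (exitProb_nonneg hZ.rate j _)
                  ((opH_mem_face_of_ne hZ.rate hZ.fix hi).1.1 i)
            · exact le_rfl
          simp only [hf, indicator_of_mem hω]
          rw [← sum_exitProb_mul_opH hZ.rate (νfix := νfix) _ i,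
            ENNReal.ofReal_sum_of_nonneg fun j _ => hnn j]
          refine Finset.sum_congr rfl fun j _ => ?_
          split_ifs
          exacts [ENNReal.ofReal_mul (exitProb_nonneg hZ.rate j _), ENNReal.ofReal_zero]
        · simp [hf, indicator_of_notMem hω]
    _ = ∑ j, ∫⁻ ω in A ∩ {ω | signalAt X h (n + 1) ω = j},
          ENNReal.ofReal ((postState X h μ Z (n + 1) ω : I → ℝ) i) ∂P := by
        rw [lintegral_finsetSum]
        · exact Finset.sum_congr rfl fun j _ => (hterm j).symm
        · intro j _
          split_ifs
          exacts [(hw j).mul (hfm.mono hlenext le_rfl), measurable_const]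
    _ = _ := by
        rw [← tsum_fintype (L := .unconditional I), ← lintegral_iUnion
          (fun j => hAm.inter (hZ.measurableSet_signalAt (n + 1) j)) hdisj, ← hsplit]

theorem isCondLaw (n : ℕ) : IsCondLaw P X h μ Z n := by
  induction n with
  | zero => exact hZ.isCondLaw_zero
  | succ n ih => exact IsCondLaw.succ hZ ih

/-- The law of the filter after a jump, given the observed jumps up to the previous one and the
time of the jump. -/
theorem measure_postState_succ {n : ℕ} (qfix : O → O → ℝ) {D : Set Ω}
    (hD : MeasurableSet[obsSigmaNext X h n] D) {A : Set (effSimplex h)} (hA : MeasurableSet A) :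
    P (D ∩ {ω | obsTime X h (n + 1) ω < ⊤ ∧ postState X h μ Z (n + 1) ω ∈ A}) =
      ∫⁻ ω in D ∩ {ω | obsTime X h (n + 1) ω < ⊤},
        transMeasure Λ h νfix qfix (preState Λ h X μ Z n ω) A ∂P := by
  have hlenext := hZ.obsSigmaNext_le n
  have hF : MeasurableSet {ω | obsTime X h (n + 1) ω < ⊤} :=
    hlenext _ (hZ.measurableSet_finite_next n)
  have hn := hZ.isCondLaw n
  set E : I → Set Ω := fun j => {ω | postJump Λ h νfix (h j) (preState Λ h X μ Z n ω) ∈ A} with hE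
  have hEm : ∀ j, MeasurableSet[obsSigmaNext X h n] (E j) := fun j =>
    ((measurable_postJump (h j)).comp (hZ.measurable_preState n)) hA
  have hw : ∀ j, Measurable fun ω => ENNReal.ofReal (exitProb Λ h j (preState Λ h X μ Z n ω)) :=
    fun j => ((measurable_exitProb j).comp
      ((hZ.measurable_preState n).mono hlenext le_rfl)).ennreal_ofReal
  have hsplit : D ∩ {ω | obsTime X h (n + 1) ω < ⊤ ∧ postState X h μ Z (n + 1) ω ∈ A} =
      ⋃ j, (D ∩ E j) ∩ {ω | obsTime X h (n + 1) ω < ⊤} ∩ {ω | signalAt X h (n + 1) ω = j} := by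
    ext ω
    rw [mem_iUnion]
    constructor
    · rintro ⟨h1, h2, h3⟩
      rw [hZ.postState_succ h2.ne] at h3
      exact ⟨_, ⟨⟨h1, h3⟩, h2⟩, rfl⟩
    · rintro ⟨j, ⟨⟨h1, h3⟩, h2⟩, h4⟩
      refine ⟨h1, h2, ?_⟩
      rw [hZ.postState_succ (LT.lt.ne h2), show signalAt X h (n + 1) ω = j from h4]
      exact h3
  have hdisj : Pairwise (Function.onFun Disjoint fun j => (D ∩ E j) ∩
      {ω | obsTime X h (n + 1) ω < ⊤} ∩ {ω | signalAt X h (n + 1) ω = j}) := fun k l hkl =>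
    Set.disjoint_left.2 fun ω h1 h2 =>
      hkl ((show signalAt X h (n + 1) ω = k from h1.2).symm.trans h2.2)
  rw [hsplit, measure_iUnion hdisj fun j => ((hlenext _ (hD.inter (hEm j))).inter hF).inter
    (hZ.measurableSet_signalAt (n + 1) j), tsum_fintype]
  simp only [fun j => hZ.measure_next_signal hn (hD.inter (hEm j)) j]
  have hterm : ∀ j, ∫⁻ ω in D ∩ E j ∩ {ω | obsTime X h (n + 1) ω < ⊤},
      ENNReal.ofReal (exitProb Λ h j (preState Λ h X μ Z n ω)) ∂P =
      ∫⁻ ω in D ∩ {ω | obsTime X h (n + 1) ω < ⊤},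
        (E j).indicator (fun ω => ENNReal.ofReal (exitProb Λ h j (preState Λ h X μ Z n ω))) ω
          ∂P := fun j => by
    rw [setLIntegral_indicator (hlenext _ (hEm j)), ← inter_assoc, inter_comm (E j) D]
  simp only [hterm]
  rw [← lintegral_finsetSum _ fun j _ => (hw j).indicator (hlenext _ (hEm j))]
  refine setLIntegral_congr_fun_ae ((hlenext _ hD).inter hF) ?_
  filter_upwards [hZ.jumpRate_preState_ne_zero hn] with ω hω hωD
  rw [transMeasure_eq_sum_exitProb hZ.rate hZ.fix qfix (hω hωD.2) hA]
  refine Finset.sum_congr rfl fun j _ => ?_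
  by_cases hj : ω ∈ E j
  · rw [indicator_of_mem hj, indicator_of_mem (show postJump Λ h νfix (h j) _ ∈ A from hj),
      Pi.one_apply, mul_one]
  · rw [indicator_of_notMem hj,
      indicator_of_notMem (show postJump Λ h νfix (h j) _ ∉ A from hj), mul_zero]

end IsFilterProcess

/-! ### The filter as a piecewise-deterministic process -/

/-- Recognising a conditional probability on an event `F` by its integrals; `g'` is a version that
is measurable with respect to the conditioning `σ`-algebra. -/
theorem condExp_indicator_ae_eq {Ω : Type*} {m mΩ : MeasurableSpace Ω} (hm : m ≤ mΩ)
    {P : Measure Ω} [IsProbabilityMeasure P] {S F : Set Ω} (hS : MeasurableSet S)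
    (hF : MeasurableSet F) {g : Ω → ℝ} (hg0 : ∀ ω, 0 ≤ g ω) (hg1 : ∀ ω, g ω ≤ 1) {g' : Ω → ℝ}
    (hg' : Measurable[m] g') (hgg' : F.indicator g =ᵐ[P] g')
    (H : ∀ D, MeasurableSet[m] D → P (D ∩ S) = ∫⁻ ω in D ∩ F, ENNReal.ofReal (g ω) ∂P) :
    P[S.indicator (fun _ => (1 : ℝ)) | m] =ᵐ[P] F.indicator g := by
  have h0 : ∀ ω, 0 ≤ F.indicator g ω := fun ω => indicator_nonneg (fun ω _ => hg0 ω) ω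
  have h1 : ∀ ω, F.indicator g ω ≤ 1 := fun ω =>
    indicator_le' (fun ω _ => hg1 ω) (fun _ _ => zero_le_one) ω
  have hgm : AEStronglyMeasurable[m] (F.indicator g) P := ⟨g', hg'.stronglyMeasurable, hgg'⟩
  have hg : Integrable (F.indicator g) P := Integrable.of_bound (hgm.mono hm) 1
    (Eventually.of_forall fun ω => by rw [Real.norm_of_nonneg (h0 ω)]; exact h1 ω)
  have hind : (fun ω => ENNReal.ofReal (F.indicator g ω)) =
      F.indicator fun ω => ENNReal.ofReal (g ω) :=
    (indicator_comp_of_zero (g := ENNReal.ofReal) ENNReal.ofReal_zero).symm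
  refine (ae_eq_condExp_of_forall_setIntegral_eq hm ((integrable_const 1).indicator hS)
    (fun D _ _ => hg.integrableOn) (fun D hD _ => ?_) hgm).symm
  rw [integral_indicator_const _ hS, measureReal_restrict_apply hS, smul_eq_mul, mul_one,
    measureReal_def, inter_comm, H D hD,
    integral_eq_lintegral_of_nonneg_ae (Eventually.of_forall h0) hg.integrableOn.1, hind,
    setLIntegral_indicator hF, inter_comm]

namespace IsFilterProcess

variable {Ω I O : Type*} [mΩ : MeasurableSpace Ω] [Fintype I] [DecidableEq I] [MeasurableSpace I]
  [DiscreteMeasurableSpace I] [Fintype O] [DecidableEq O] {P : Measure Ω} [IsProbabilityMeasure P]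
  {Λ : Matrix I I ℝ} {h : I → O} {νfix : O → I → ℝ} {μ : effSimplex h} {X : ℝ≥0 → Ω → I}
  {Z : ℝ≥0 → Ω → effSimplex h} (hZ : IsFilterProcess P X Λ h νfix μ Z)
include hZ

theorem jumpSigma_le_obsSigma (n : ℕ) : jumpSigma Z μ (obsTime X h) n ≤ obsSigma X h n := by
  refine iSup₂_le fun k hk => ?_
  have hkn := obsSigma_mono (X := X) (h := h) (Finset.mem_Icc.1 hk).2
  exact (sup_le (measurable_obsTime_obsSigma k).comap_le
    (hZ.measurable_postState k).comap_le).trans hkn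

theorem measurable_process (t : ℝ≥0) : Measurable (Z t) := by
  intro A hA
  have heq : Z t ⁻¹' A = ⋃ n, {ω | obsTime X h n ω ≤ t} ∩ {ω | (t : ℝ≥0∞) < obsTime X h (n + 1) ω} ∩
      {ω | flow Λ h (t - (obsTime X h n ω).toNNReal) (postState X h μ Z n ω) ∈ A} := by
    ext ω
    have hflow : ∀ n, obsTime X h n ω ≤ t → (t : ℝ≥0∞) < obsTime X h (n + 1) ω →
        Z t ω = flow Λ h (t - (obsTime X h n ω).toNNReal) (postState X h μ Z n ω) := by
      intro n h1 h2
      have hn : obsTime X h n ω ≠ ⊤ := (h1.trans_lt ENNReal.coe_lt_top).ne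
      rw [postState, atTime, if_neg hn]
      exact (hZ.path ω).eq_flow h1 h2
    rw [mem_iUnion]
    constructor
    · intro hω
      obtain ⟨n, h1, h2⟩ := (hZ.path ω).step.exists_jumpTime_mem t
      refine ⟨n, ⟨h1, h2⟩, ?_⟩
      change flow Λ h _ _ ∈ A
      rw [← hflow n h1 h2]
      exact hω
    · rintro ⟨n, ⟨h1, h2⟩, h3⟩
      change Z t ω ∈ A
      rw [hflow n h1 h2]
      exact h3
  rw [heq]
  refine MeasurableSet.iUnion fun n => ?_
  have hT := hZ.markov.measurable_obsTime (h := h) n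
  exact ((measurableSet_le hT measurable_const).inter
    (measurableSet_lt measurable_const (hZ.markov.measurable_obsTime (n + 1)))).inter
    (measurable_flow_comp hZ.rate (measurable_const.sub hT.ennreal_toNNReal)
      (hZ.measurable_postState' n) hA)

/-- Up to a null set, the state of the filter at a jump time is a function of the observed
jump times and of the states of the filter at these. -/
theorem exists_measurable_version (n : ℕ) : Measurable[jumpSigma Z μ (obsTime X h) n]
    (obsTime X h n) ∧ ∃ x : Ω → effSimplex h, Measurable[jumpSigma Z μ (obsTime X h) n] x ∧
      postState X h μ Z n =ᵐ[P] x := by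
  cases n with
  | zero => exact ⟨measurable_const, fun _ => μ, measurable_const, hZ.postState_zero⟩
  | succ n =>
    have hmem : n + 1 ∈ Finset.Icc 1 (n + 1) := Finset.mem_Icc.2 ⟨by omega, le_rfl⟩
    have hle := le_iSup₂_of_le (f := fun k (_ : k ∈ Finset.Icc 1 (n + 1)) =>
      MeasurableSpace.comap (obsTime X h k) inferInstance ⊔
        MeasurableSpace.comap (atTime Z μ (obsTime X h k)) inferInstance) (n + 1) hmem le_rfl
    exact ⟨(comap_measurable _).mono (le_sup_left.trans hle) le_rfl, postState X h μ Z (n + 1),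
      (comap_measurable (atTime Z μ (obsTime X h (n + 1)))).mono (le_sup_right.trans hle) le_rfl,
      EventuallyEq.rfl⟩

theorem eq_postState {n : ℕ} {ω : Ω} (hω : obsTime X h n ω < ⊤) :
    Z (obsTime X h n ω).toNNReal ω = postState X h μ Z n ω := by
  rw [postState, atTime, if_neg hω.ne]

theorem sojourn (n : ℕ) (t : ℝ≥0) :
    P[{ω | obsTime X h n ω + t < obsTime X h (n + 1) ω}.indicator (fun _ => (1 : ℝ)) |
        jumpSigma Z μ (obsTime X h) n] =ᵐ[P]
      {ω | obsTime X h n ω < ⊤}.indicator fun ω => Real.exp (-∫ s in (0 : ℝ)..t,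
        jumpRate Λ h (flow Λ h s.toNNReal (Z (obsTime X h n ω).toNNReal ω))) := by
  set G : effSimplex h → ℝ := fun x => ∑ i, unnorm Λ h (level x) x t i with hG
  have hGm : Measurable G := by
    refine measurable_of_index (l := level) (g := fun a (x : effSimplex h) =>
      ∑ i, unnorm Λ h a x t i) measurableSet_level_eq fun a => Continuous.measurable ?_
    have hu : Continuous fun x : effSimplex h => unnorm Λ h a x t :=
      continuous_unnorm.comp (f := fun x : effSimplex h => ((t : ℝ), (x : I → ℝ))) (by fun_prop)
    exact continuous_finsetSum _ fun i _ => (continuous_apply i).comp hu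
  have hexp : ∀ x, Real.exp (-∫ s in (0 : ℝ)..t, jumpRate Λ h (flow Λ h s.toNNReal x)) = G x :=
    fun x => exp_neg_integral_jumpRate hZ.rate x t
  have hG1 : ∀ x, G x ≤ 1 := fun x => by
    rw [← hexp, Real.exp_le_one_iff, neg_nonpos]
    exact intervalIntegral.integral_nonneg (NNReal.coe_nonneg t) fun s _ =>
      jumpRate_nonneg hZ.rate _
  have hG0 : ∀ x, 0 ≤ G x := fun x => by rw [← hexp]; exact (Real.exp_pos _).le
  have hrhs : ({ω | obsTime X h n ω < ⊤}.indicator fun ω => Real.exp (-∫ s in (0 : ℝ)..t,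
        jumpRate Λ h (flow Λ h s.toNNReal (Z (obsTime X h n ω).toNNReal ω)))) =
      {ω | obsTime X h n ω < ⊤}.indicator fun ω => G (postState X h μ Z n ω) := by
    refine indicator_congr fun ω hω => ?_
    rw [hexp, hZ.eq_postState hω]
  have hle := (hZ.jumpSigma_le_obsSigma n).trans (hZ.obsSigma_le n)
  obtain ⟨hT, x, hx, hxeq⟩ := hZ.exists_measurable_version n
  rw [hrhs]
  refine condExp_indicator_ae_eq hle (hZ.markov.measurableSet_survival n t)
    (hZ.obsSigma_le n _ (hZ.measurableSet_finite n)) (fun ω => hG0 _) (fun ω => hG1 _)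
    ((hGm.comp hx).indicator (hT (measurableSet_Iio (a := ⊤)))) ?_ fun D hD => ?_
  · exact (hxeq.fun_comp G).indicator
  · have hD' := hZ.jumpSigma_le_obsSigma n D hD
    have hset : D ∩ {ω | obsTime X h n ω + t < obsTime X h (n + 1) ω} =
        D ∩ {ω | obsTime X h n ω < ⊤} ∩ {ω | obsTime X h n ω + t < obsTime X h (n + 1) ω} := by
      ext ω
      refine ⟨fun hω => ⟨⟨hω.1, ?_⟩, hω.2⟩, fun hω => ⟨hω.1.1, hω.2⟩⟩
      exact le_self_add.trans_lt ((show obsTime X h n ω + t < obsTime X h (n + 1) ω from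
        hω.2).trans_le le_top)
    rw [hset, hZ.measure_sojourn (hZ.isCondLaw n) (hD'.inter (hZ.measurableSet_finite n))
      (fun ω hω => hω.2)]

theorem jump {qfix : O → O → ℝ} (hqfix : ∀ a, qfix a ∈ stdSimplex ℝ O ∧ qfix a a = 0) (n : ℕ)
    {A : Set (effSimplex h)} (hA : MeasurableSet A) :
    P[{ω | obsTime X h (n + 1) ω < ⊤ ∧ Z (obsTime X h (n + 1) ω).toNNReal ω ∈ A}.indicator
        (fun _ => (1 : ℝ)) | jumpSigma Z μ (obsTime X h) n ⊔
          MeasurableSpace.comap (obsTime X h (n + 1)) inferInstance] =ᵐ[P]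
      {ω | obsTime X h (n + 1) ω < ⊤}.indicator fun ω => (transMeasure Λ h νfix qfix
        (flow Λ h ((obsTime X h (n + 1) ω).toNNReal - (obsTime X h n ω).toNNReal)
          (Z (obsTime X h n ω).toNNReal ω))).real A := by
  have hQ := isPDPTriple hZ.rate hZ.fix hqfix
  have hQp := hQ.trans_prob
  have hrhs : ({ω | obsTime X h (n + 1) ω < ⊤}.indicator fun ω => (transMeasure Λ h νfix qfix
        (flow Λ h ((obsTime X h (n + 1) ω).toNNReal - (obsTime X h n ω).toNNReal)
          (Z (obsTime X h n ω).toNNReal ω))).real A) = {ω | obsTime X h (n + 1) ω < ⊤}.indicator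
        fun ω => (transMeasure Λ h νfix qfix (preState Λ h X μ Z n ω)).real A := by
    refine indicator_congr fun ω hω => ?_
    have hn : obsTime X h n ω < ⊤ := (jumpTime_le_succ _ n).trans_lt hω
    rw [hZ.eq_postState hn, preState]
  have hset : {ω | obsTime X h (n + 1) ω < ⊤ ∧ Z (obsTime X h (n + 1) ω).toNNReal ω ∈ A} =
      {ω | obsTime X h (n + 1) ω < ⊤ ∧ postState X h μ Z (n + 1) ω ∈ A} := by
    ext ω
    refine and_congr_right fun hω => ?_
    rw [hZ.eq_postState hω]
  have hle' : jumpSigma Z μ (obsTime X h) n ⊔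
      MeasurableSpace.comap (obsTime X h (n + 1)) inferInstance ≤ obsSigmaNext X h n :=
    sup_le_sup_right (hZ.jumpSigma_le_obsSigma n) _
  have hle := hle'.trans (hZ.obsSigmaNext_le n)
  obtain ⟨hT, x, hx, hxeq⟩ := hZ.exists_measurable_version n
  have hT1 : Measurable[jumpSigma Z μ (obsTime X h) n ⊔
      MeasurableSpace.comap (obsTime X h (n + 1)) inferInstance] (obsTime X h (n + 1)) :=
    (comap_measurable _).mono le_sup_right le_rfl
  have hy := ((Measure.measurable_coe hA).comp (hQ.trans_measurable.comp (measurable_flow_comp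
    (IsFilterProcess.rate (mΩ := mΩ) hZ)
    (measurable_toNNReal_sub hT1 (hT.mono le_sup_left le_rfl))
    (hx.mono le_sup_left le_rfl)))).ennreal_toReal
  rw [hrhs, hset]
  refine condExp_indicator_ae_eq hle ?_
    (hZ.markov.measurable_obsTime (n + 1) (measurableSet_Iio (a := ⊤)))
    (fun _ => measureReal_nonneg) (fun _ => measureReal_le_one)
    (hy.indicator (hT1 (measurableSet_Iio (a := ⊤)))) ?_ fun D hD => ?_
  · exact ((hZ.markov.measurable_obsTime (n + 1)) measurableSet_Iio).inter
      (hZ.measurable_postState' (n + 1) hA)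
  · filter_upwards [hxeq] with ω hω
    simp only [indicator, preState, hω]
    rfl
  · rw [hZ.measure_postState_succ qfix (hle' D hD) hA]
    refine lintegral_congr fun ω => ?_
    rw [ofReal_measureReal]

theorem isPDPWith {qfix : O → O → ℝ} (hqfix : ∀ a, qfix a ∈ stdSimplex ℝ O ∧ qfix a a = 0) :
    IsPDPWith P Z (flow Λ h) (jumpRate Λ h) (transMeasure Λ h νfix qfix) μ (obsTime X h) where
  measurable_process := hZ.measurable_process
  measurable_time := hZ.markov.measurable_obsTime
  measurable_post := hZ.measurable_postState'
  time_zero _ := rfl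
  time_mono ω := monotone_jumpTime _
  start := by
    filter_upwards [hZ.postState_zero] with ω hω
    rw [← hω, ← hZ.eq_postState (show obsTime X h 0 ω < ⊤ from ENNReal.zero_lt_top)]
    rfl
  cadlag := Eventually.of_forall fun ω => (hZ.path ω).isCadlag
  discontinuity := Eventually.of_forall fun ω => (hZ.path ω).not_continuousAt_iff
  deterministic := Eventually.of_forall fun ω _ _ h1 h2 => (hZ.path ω).eq_flow h1 h2
  sojourn := hZ.sojourn
  jump n _ hA := hZ.jump hqfix n hA

end IsFilterProcess

end FilterPDP

end

theorem theorem4 {I O : Type*} [Fintype I] [DecidableEq I] [TopologicalSpace I]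
    [DiscreteTopology I] [MeasurableSpace I] [DiscreteMeasurableSpace I]
    [Fintype O] [DecidableEq O]
    (Λ : Matrix I I ℝ) (hΛ : IsRateMatrix Λ)
    (h : I → O) (hsurj : Function.Surjective h)
    (νfix : O → I → ℝ) (hνfix : ∀ a, νfix a ∈ face h a)
    (qfix : O → O → ℝ) (hqfix : ∀ a, qfix a ∈ stdSimplex ℝ O ∧ qfix a a = 0)
    (ν : effSimplex h) (P : Measure (CadlagPath I)) [IsProbabilityMeasure P]
    (hP : IsMarkovLaw P Λ ν) :
    (∀ (a : O) (x : effSimplex h), (x : I → ℝ) ∈ face h a →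
      IsFlowCurve Λ h a x (fun t => flow Λ h t.toNNReal x) ∧
      ∀ y, IsFlowCurve Λ h a x y → ∀ t : ℝ≥0, y t = flow Λ h t x) ∧
    IsPDPTriple h (flow Λ h) (jumpRate Λ h) (transMeasure Λ h νfix qfix) ∧
    ∃ hmem : ∀ t ω, filterProcess Λ h νfix ν t ω ∈ effSimplex h,
      IsPDP P (fun t ω => (⟨filterProcess Λ h νfix ν t ω, hmem t ω⟩ : effSimplex h))
        (flow Λ h) (jumpRate Λ h) (transMeasure Λ h νfix qfix) ν := by
  have hstep : ∀ ω : CadlagPath I, IsStepPath fun t => h (ω.1 t) := fun ω =>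
    ω.2.isStepPath.comp h
  have hν0 : ∀ i, 0 ≤ (ν : I → ℝ) i := (mem_face_level ν).1.1
  have hmem : ∀ t ω, filterProcess Λ h νfix ν t ω ∈ effSimplex h := fun t ω =>
    mem_effSimplex (filterPath_mem_face hΛ hνfix hν0 (hstep ω) t)
  have hmarkov : IsMarkovStep P (fun (t : ℝ≥0) (ω : CadlagPath I) => ω.1 t) Λ :=
    { measurable := fun t => (measurable_pi_apply t).comp measurable_subtype_coe
      step := fun ω => ω.2.isStepPath
      markov := hP.markov }
  have hZ : IsFilterProcess P (fun (t : ℝ≥0) (ω : CadlagPath I) => ω.1 t) Λ h νfix ν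
      (fun t ω => ⟨filterProcess Λ h νfix ν t ω, hmem t ω⟩) :=
    { rate := hΛ
      fix := hνfix
      markov := hmarkov
      initial := hP.initial
      path := fun ω =>
        { rate := hΛ
          fix := hνfix
          init_nonneg := hν0
          step := hstep ω
          eq := fun _ => rfl } }
  refine ⟨fun a x hx => ?_, isPDPTriple hΛ hνfix hqfix, hmem, _, hZ.isPDPWith hqfix⟩
  refine ⟨isFlowCurve_flow hΛ hx, fun y hy t => ?_⟩
  rw [hy.eq_normFlow hΛ hx (NNReal.coe_nonneg t), coe_flow_of_mem hΛ t hx]
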